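/- **Setting.** Let $\beta>0$, let $H_0=\sum_\epsilon \epsilon\,\Pi(\epsilon)$ be a Hermitian operator on $\mathbb C^n$ ($\Pi(\epsilon)$ its spectral projectors) and $(A_\alpha)_\alpha$ a finite family of Hermitian operators on $\mathbb C^n$, with jump operators $A_\alpha(\omega)=\sum_{\epsilon'-\epsilon=\omega}\Pi(\epsilon)A_\alpha\Pi(\epsilon')$. A *Gibbs bath* consists of a self-adjoint operator $H_R$ (possibly unbounded) on a non-zero Hilbert space with $Z_R=\operatorname{Tr}e^{-\beta H_R}<\infty$, and bounded self-adjoint operators $R_\alpha$; it is *centred* if $\langle R_\alpha\rangle=0$ for all $\alpha$, where $\langle X\rangle=\operatorname{Tr}[X\gamma_R]$, $\gamma_R=e^{-\beta H_R}/Z_R$. Put $C_{\alpha\beta}(t)=\langle e^{itH_R}R_\alpha e^{-itH_R}R_\beta\rangle$ and $H=H_0+H_R+\lambda\sum_\alpha A_\alpha\otimes R_\alpha$. The mean-force Hamiltonian is the Hermitian operator $H_{\rm mf}(\lambda)$ on $\mathbb C^n$ with $e^{-\beta H_{\rm mf}(\lambda)}=Z_R^{-1}\operatorname{Tr}_R[e^{-\beta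 H}]$, and $H^{(2)}_{\rm mf}$ is its second-order correction: $H_{\rm mf}(\lambda)=H_0+\lambda^2H^{(2)}_{\rm mf}+o(\lambda^2)$ as $\lambda\to0$. Let $$D(\omega,\omega',\Omega)=\frac1{\omega'-\Omega}-\frac{(\omega-\omega')(e^{\beta(\omega-\Omega)}-1)}{(\omega-\Omega)(\omega'-\Omega)(e^{\beta(\omega-\omega')}-1)} .$$ **Theorem.** (0) All singularities of $D$ (at $\omega=\omega'$, $\Omega=\omega$, $\Omega=\omega'$) are removable: $D$ extends to a continuous function on $\mathbb R^3$, again denoted $D$. (1) Consider a centred Gibbs bath. The Fourier transform of $C_{\alpha\beta}$ is the discrete complex measure $\gamma_{\alpha\beta}=2\pi\sum_{k,l}\frac{e^{-\beta E_k}}{Z_R}\langle e_k,R_\alpha e_l\rangle\langle e_l,R_\beta e_k\rangle\,\delta_{E_l-E_k}$, where $(e_k)$ is an orthonormal eigenbasis of $H_R$ with energies $E_k$; that is, $C_{\alpha\beta}(t)=\frac1{2\pi}\int e^{-i\Omega t}\gamma_{\alpha\beta}(d\Omega)$. The correction $H^{(2)}_{\rm mf}$ exists, is unique, and equals $$H^{(2)}_{\rm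 mf}=\sum_{\omega,\omega'}\sum_{\alpha,\beta}\Upsilon^{(\rm mf)}_{\alpha\beta}(\omega,\omega')\,A_\alpha(\omega)^\dagger A_\beta(\omega'),\qquad \Upsilon^{(\rm mf)}_{\alpha\beta}(\omega,\omega')=\frac1{2\pi}\int D(\omega,\omega',\Omega)\,\gamma_{\alpha\beta}(d\Omega),$$ the integral being absolutely convergent. If $\omega\ne\omega'$, if $\gamma_{\alpha\beta}$ has no point mass at $\omega$ and $\omega'$, and if the principal values $S_{\alpha\beta}(x)=\mathcal P\frac1{2\pi}\int\frac{\gamma_{\alpha\beta}(d\Omega)}{x-\Omega}$ for $x=\omega,\omega'$, and likewise $S_{\beta\alpha}(-\omega)$ and $S_{\beta\alpha}(-\omega')$, exist, then $$\Upsilon^{(\rm mf)}_{\alpha\beta}(\omega,\omega')=\frac{e^{\beta\omega}S_{\alpha\beta}(\omega')-e^{\beta\omega'}S_{\alpha\beta}(\omega)+e^{\beta(\omega+\omega')}\bigl(S_{\beta\alpha}(-\omega')-S_{\beta\alpha}(-\omega)\bigr)}{e^{\beta\omega}-e^{\beta\omega'}}.\qquad(*)$$ (2) Consider a reservoir that is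 the limit of a sequence of centred Gibbs baths: their autocorrelation functions converge pointwise on $\mathbb R$ to continuous, integrable functions $C_{\alpha\beta}$. Put $\gamma_{\alpha\beta}(\Omega)=\int_{-\infty}^\infty e^{i\Omega s}C_{\alpha\beta}(s)\,ds$, $\Gamma_{\alpha\beta}(\omega)=\int_0^\infty e^{i\omega s}C_{\alpha\beta}(s)\,ds$ and $S_{\alpha\beta}(\omega)=\frac1{2i}\bigl(\Gamma_{\alpha\beta}(\omega)-\overline{\Gamma_{\beta\alpha}(\omega)}\bigr)$. Then the second-order mean-force corrections of the baths converge to $\sum_{\omega,\omega'}\sum_{\alpha,\beta}\Upsilon^{(\rm mf)}_{\alpha\beta}(\omega,\omega')A_\alpha(\omega)^\dagger A_\beta(\omega')$ with $$\Upsilon^{(\rm mf)}_{\alpha\beta}(\omega,\omega')=\frac1{2\pi}\int_{-\infty}^\infty D(\omega,\omega',\Omega)\,\gamma_{\alpha\beta}(\Omega)\,d\Omega ,$$ the integral being absolutely convergent. For all real $\omega\neq\omega'$ these coefficients satisfy $(*)$, and $\Upsilon^{(\rm mf)}_{\alpha\beta}(\omega,\omega)$ is the limit of the right-hand side of $(*)$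 as $\omega'\to\omega$. Moreover $S_{\alpha\beta}(\omega)=\mathcal P\frac1{2\pi}\int_{-\infty}^\infty\frac{\gamma_{\alpha\beta}(\Omega)}{\omega-\Omega}\,d\Omega$ for all $\omega$. -/

import Mathlib

open scoped InnerProductSpace Matrix Topology
open Filter MeasureTheory

/-- The open quantum system: a bare Hamiltonian `H0` and the Hermitian system operators `A a` of the
interaction, on the Hilbert space `ℂⁿ`. -/
structure OpenSystem (ι n : Type*) where
  H0 : Matrix n n ℂ
  H0_hermitian : H0.IsHermitian
  A : ι → Matrix n n ℂ
  A_hermitian : ∀ a, (A a).IsHermitian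

/-- The bath: its Hilbert space is `K`, its free Hamiltonian `H_R` (in general unbounded) is the
self-adjoint operator with orthonormal eigenbasis `e` and energies `E`, and `R a` are the bath
operators of the interaction. -/
structure Bath (ι κ K : Type*) [NormedAddCommGroup K] [InnerProductSpace ℂ K] [CompleteSpace K] where
  e : HilbertBasis κ ℂ K
  E : κ → ℝ
  R : ι → (K →L[ℂ] K)
  R_selfAdjoint : ∀ a, IsSelfAdjoint (R a)

noncomputable section

namespace OpenSystem

variable {ι n : Type*} [Fintype n] [DecidableEq n] (S : OpenSystem ι n)

/-- The finite set of energies (eigenvalues of `H0`). -/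
def energies : Finset ℝ := Finset.univ.image S.H0_hermitian.eigenvalues

/-- `Π(ε)`: the orthogonal projector onto the eigenspace of `H0` with energy `ε`. -/
def proj (ε : ℝ) : Matrix n n ℂ :=
  (S.H0_hermitian.eigenvectorUnitary : Matrix n n ℂ) *
    Matrix.diagonal (fun i => if S.H0_hermitian.eigenvalues i = ε then (1 : ℂ) else 0) *
    (S.H0_hermitian.eigenvectorUnitary : Matrix n n ℂ)ᴴ

/-- The finite set of Bohr frequencies `ω = ε' - ε`. -/
def bohr : Finset ℝ := (S.energies ×ˢ S.energies).image fun p => p.2 - p.1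

/-- The jump operators `A_a(ω) = ∑_{ε' - ε = ω} Π(ε) A_a Π(ε')`. -/
def jump (a : ι) (ω : ℝ) : Matrix n n ℂ :=
  ∑ p ∈ (S.energies ×ˢ S.energies).filter (fun p => p.2 - p.1 = ω),
    S.proj p.1 * S.A a * S.proj p.2

/-- `∑_{ω,ω'} ∑_{a,b} Υ_{ab}(ω,ω') A_a(ω)† A_b(ω')`. -/
def ofCoefficients [Fintype ι] (Υ : ι → ι → ℝ → ℝ → ℂ) : Matrix n n ℂ :=
  ∑ ω ∈ S.bohr, ∑ ω' ∈ S.bohr, ∑ a, ∑ b, Υ a b ω ω' • ((S.jump a ω)ᴴ * S.jump b ω')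

end OpenSystem

namespace Bath

variable {ι κ K : Type*} [NormedAddCommGroup K] [InnerProductSpace ℂ K] [CompleteSpace K]
  (B : Bath ι κ K)

/-- `Z_R = Tr e^{-β H_R} < ∞`. -/
def IsThermal (β : ℝ) : Prop := Summable fun k => Real.exp (-β * B.E k)

/-- `Z_R = Tr e^{-β H_R}`. -/
def Z (β : ℝ) : ℝ := ∑' k, Real.exp (-β * B.E k)

/-- The Gibbs expectation `⟨X⟩ = Tr[X γ_R]`, where `γ_R = e^{-β H_R} / Z_R`. -/
def gibbs (β : ℝ) (X : K → K) : ℂ :=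
  ∑' k, ((Real.exp (-β * B.E k) / B.Z β : ℝ) : ℂ) * ⟪B.e k, X (B.e k)⟫_ℂ

/-- The bath operators are centred: `⟨R_a⟩ = 0`. -/
def Centred (β : ℝ) : Prop := ∀ a, B.gibbs β (B.R a) = 0

/-- The unitary `e^{i t H_R}`. -/
def evolve (t : ℝ) (v : K) : K :=
  ∑' k, Complex.exp (Complex.I * t * B.E k) • ⟪B.e k, v⟫_ℂ • B.e k

/-- The autocorrelation function `⟨R_a(t) R_b(0)⟩`, where `R_a(t) = e^{i t H_R} R_a e^{-i t H_R}`. -/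
def corr (β : ℝ) (a b : ι) (t : ℝ) : ℂ :=
  B.gibbs β fun v => B.evolve t (B.R a (B.evolve (-t) (B.R b v)))

/-- The `(k, l)`-th term of `(2π)⁻¹ ∫ f(Ω) γ_{ab}(dΩ)` for a bath with a Gibbs state. The Fourier
transform `γ_{ab}` of the autocorrelation function is then the discrete complex measure
`2π ∑_{k,l} p_k ⟨e_k, R_a e_l⟩ ⟨e_l, R_b e_k⟩ δ_{E_l - E_k}`, where `p_k = e^{-β E_k} / Z_R`. -/
def spectralTerm (β : ℝ) (a b : ι) (f : ℝ → ℂ) (p : κ × κ) : ℂ :=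
  ((Real.exp (-β * B.E p.1) / B.Z β : ℝ) : ℂ) * ⟪B.e p.1, B.R a (B.e p.2)⟫_ℂ *
    ⟪B.e p.2, B.R b (B.e p.1)⟫_ℂ * f (B.E p.2 - B.E p.1)

/-- `(2π)⁻¹ ∫ f(Ω) γ_{ab}(dΩ)`. -/
def spectralSum (β : ℝ) (a b : ι) (f : ℝ → ℂ) : ℂ := ∑' p, B.spectralTerm β a b f p

open Classical in
/-- `γ_{ab}` has no point mass at `ω`. -/
def NoAtom (β : ℝ) (a b : ι) (ω : ℝ) : Prop :=
  B.spectralSum β a b (fun Ω => if Ω = ω then 1 else 0) = 0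

open Classical in
/-- `S_{ab}(ω) = P.V. (2π)⁻¹ ∫ γ_{ab}(dΩ) / (ω - Ω)` exists and equals `s`. -/
def HasLambShift (β : ℝ) (a b : ι) (ω : ℝ) (s : ℂ) : Prop :=
  Tendsto (fun r : ℝ => B.spectralSum β a b
    (fun Ω => if r < |Ω - ω| then 1 / ((ω : ℂ) - Ω) else 0)) (𝓝[>] 0) (𝓝 s)

end Bath

section MeanForce

variable {ι n κ K : Type*} [Fintype ι] [Fintype n] [DecidableEq n]
  [NormedAddCommGroup K] [InnerProductSpace ℂ K] [CompleteSpace K]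

/-- The `i`-th component of `H (u_j ⊗ e_k)`, where `H = H_0 + H_R + c ∑_a A_a ⊗ R_a`, and `u` is the
standard basis of `ℂⁿ`. -/
def totalHamiltonian (S : OpenSystem ι n) (B : Bath ι κ K) (c : ℝ) (i j : n) (k : κ) : K :=
  S.H0 i j • B.e k + (if i = j then (B.E k : ℂ) • B.e k else 0) +
    (c : ℂ) • ∑ a, S.A a i j • B.R a (B.e k)

/-- `P t = e^{-t H}` for `t ≥ 0`, where bounded operators on `ℂⁿ ⊗ K` are written as `n × n`-matrices
of bounded operators on `K`: the strongly continuous one-parameter semigroup generated by `-H`.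
(It is unique, since the vectors `u_j ⊗ e_k` span a core of `H`.) -/
structure IsBoltzmannSemigroup (S : OpenSystem ι n) (B : Bath ι κ K) (c : ℝ)
    (P : ℝ → Matrix n n (K →L[ℂ] K)) : Prop where
  zero : P 0 = 1
  add : ∀ s t, 0 ≤ s → 0 ≤ t → P (s + t) = P s * P t
  cont : ∀ i j v, ContinuousOn (fun t => P t i j v) (Set.Ici 0)
  deriv : ∀ i j k, HasDerivWithinAt (fun t => P t i j (B.e k))
    (-totalHamiltonian S B c i j k) (Set.Ici 0) 0

/-- `h` is the mean-force Hamiltonian at coupling `c`: it is Hermitian and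
`e^{-β h} = Z_R⁻¹ Tr_R[e^{-β H}]`. -/
def IsMeanForce (S : OpenSystem ι n) (B : Bath ι κ K) (β c : ℝ) (h : Matrix n n ℂ) : Prop :=
  h.IsHermitian ∧ ∃ P : ℝ → Matrix n n (K →L[ℂ] K), IsBoltzmannSemigroup S B c P ∧
    ∀ i j, HasSum (fun k => ⟪B.e k, P β i j (B.e k)⟫_ℂ)
      ((B.Z β : ℂ) * NormedSpace.exp (((-β : ℝ) : ℂ) • h) i j)

/-- `X` is the second-order mean-force correction: the mean-force Hamiltonian exists at every
coupling `c`, and it is `H_0 + c² X + o(c²)` as `c → 0`. -/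
def IsMeanForceCorrection (S : OpenSystem ι n) (B : Bath ι κ K) (β : ℝ) (X : Matrix n n ℂ) : Prop :=
  ∃ Hmf : ℝ → Matrix n n ℂ, (∀ c, IsMeanForce S B β c (Hmf c)) ∧
    ∀ i j, (fun c : ℝ => Hmf c i j - S.H0 i j - (c : ℂ) ^ 2 * X i j) =o[𝓝 0] fun c : ℝ => c ^ 2

end MeanForce

/-- `(e^{βx} - 1) / x`, with its limit `β` at `x = 0`. -/
def expQuot (β : ℝ) : ℝ → ℝ := dslope (fun y => Real.exp (β * y)) 0

/-- The kernel `1/(ω'-Ω) - (ω-ω')(e^{β(ω-Ω)}-1) / ((ω-Ω)(ω'-Ω)(e^{β(ω-ω')}-1))`, which is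
`(1 - q(ω-Ω)/q(ω-ω')) / (ω'-Ω)` with `q(x) = (e^{βx}-1)/x`, with its removable singularities at
`ω = ω'`, `Ω = ω` and `Ω = ω'` removed. -/
def kernelD (β ω ω' Ω : ℝ) : ℝ :=
  -(dslope (expQuot β) (ω - ω') (ω - Ω)) / expQuot β (ω - ω')

section Reservoir

variable {ι : Type*} (C : ι → ι → ℝ → ℂ)

/-- `γ_{ab}(Ω) = ∫ e^{iΩs} C_{ab}(s) ds`. -/
def specDensity (a b : ι) (Ω : ℝ) : ℂ := ∫ s : ℝ, Complex.exp (Complex.I * Ω * s) * C a b s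

/-- `Γ_{ab}(ω) = ∫₀^∞ e^{iωs} C_{ab}(s) ds`. -/
def halfFourier (a b : ι) (ω : ℝ) : ℂ :=
  ∫ s in Set.Ioi (0 : ℝ), Complex.exp (Complex.I * ω * s) * C a b s

/-- The Lamb-shift function `S_{ab}(ω) = (Γ_{ab}(ω) - Γ_{ba}(ω)^*) / (2i)`. -/
def lambShift (a b : ι) (ω : ℝ) : ℂ :=
  1 / (2 * Complex.I) * (halfFourier C a b ω - (starRingEnd ℂ) (halfFourier C b a ω))

/-- `(2π)⁻¹ ∫ D(ω,ω',Ω) γ_{ab}(Ω) dΩ`. -/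
def mfCoefficient (β : ℝ) (a b : ι) (ω ω' : ℝ) : ℂ :=
  1 / (2 * Real.pi) * ∫ Ω : ℝ, (kernelD β ω ω' Ω : ℂ) * specDensity C a b Ω

end Reservoir

/-- The combination of the Lamb-shift values `s₁ = S_{ab}(ω')`, `s₂ = S_{ab}(ω)`,
`s₃ = S_{ba}(-ω')`, `s₄ = S_{ba}(-ω)`. -/
def lambCombination (β ω ω' : ℝ) (s₁ s₂ s₃ s₄ : ℂ) : ℂ :=
  1 / ((Real.exp (β * ω) - Real.exp (β * ω') : ℝ) : ℂ) *
    (Real.exp (β * ω) * s₁ - Real.exp (β * ω') * s₂ + Real.exp (β * (ω + ω')) * (s₃ - s₄))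

end

/-!
The kernel is `D(ω,ω',Ω) = -q[ω-ω', ω-Ω] / q(ω-ω')`, where `q(x) = (e^{βx} - 1)/x` and the bracket is
a divided difference. Since `q` is itself a divided difference of the exponential, both are integrals
of exponentials over simplices (`expQuot_eq_integral`, `expDivDiff`). This makes `D` continuous and
bounded by a multiple of the thermal weight `1 + e^{-βΩ}`, and in partial fractions (`kernelD_eq_sub`)
`D` is a combination of the pole-free functions `q(ω-Ω)` and `q(ω'-Ω)`.

*Lamb shifts.* A function bounded by the thermal weight can be summed against the spectral measure of
a bath, because `e^{-βΩ} γ_{ab}(dΩ)` is, by the KMS condition (`Bath.spectralTerm_exp_mul`), the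
reflection of `γ_{ba}`. The same condition turns the integral of `q(ω-Ω) = (e^{β(ω-Ω)} - 1)/(ω-Ω)`,
cut off at `ω`, into `-e^{βω} S_{ba}(-ω) - S_{ab}(ω)`, which gives the formula for the coefficients.

*Reservoirs.* If the autocorrelation functions converge, then spectral sums of test functions converge
to integrals against the spectral density, by Parseval's identity. KMS condition and positivity of the
matrix of spectral measures pass to the limit, and so does the bound on the total mass; the spectral
density is therefore integrable even with the thermal weight, although only the integrability of the
autocorrelation functions is assumed. Together with bounds that are uniform in the baths, this extends
the convergence to all continuous functions that are small compared with the thermal weight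
(`IsGibbsLimit.tendsto_spectralSum`), such as the kernel, which decays like `1/Ω` relative to it. The
principal value is compared with the Abel summation of the half-sided Fourier transforms that define
the Lamb shift: the two regularizations of `1/y` differ by a rescaled odd integrable function
(`integral_cut_sub_integral_reg`).

*The mean-force Hamiltonian.* In the eigenbasis `v_p ⊗ e_k`, the uncoupled Hamiltonian is diagonal and
bounded below, and the interaction is bounded. The semigroup `e^{-tH}` is the sum of its Dyson series,
`DiagHam.Q`; every semigroup with the right derivatives on the eigenvectors satisfies the mild
equation, hence equals `DiagHam.Q` by iteration (`DiagHam.IsSemigroup.eq_Q`). The Dyson terms are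
time-ordered integrals of products of Boltzmann factors and interactions. Such a product is
Hilbert–Schmidt, with a bound into which the Boltzmann factors enter only through the total inverse
temperature (`DiagHam.hs_word_le`), since outer Boltzmann factors can be merged at the cost of a factor `2`. As a
product of two Hilbert–Schmidt operators at half the inverse temperature, `e^{-βH}` has a partial
trace that is a power series in the coupling (`hasSum_partialTrace`). Its term of first order vanishes
for centred baths. That of second order involves second divided differences of the exponential,
which are values of the kernel `D` times the divided difference of `e^{-β ·}` at the two system
energies (`traceCoeff_two`). The same divided difference is the derivative of `h ↦ e^{-βh}` at `H_0`,
through which the logarithm is linearized (`exists_norm_log_sub_le`), so it cancels, and the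
second-order correction is left.
The logarithm exists because the reduced state is the Gram matrix of vectors `e^{-βH/2} (v_p ⊗ e_k)`,
and `e^{-βH/2}` is injective (`reducedState_posDef`).
-/

/-! ### The kernel as a divided difference -/

theorem expQuot_eq_integral {β : ℝ} (x : ℝ) :
    expQuot β x = ∫ s in (0 : ℝ)..β, Real.exp (s * x) := by
  unfold expQuot
  by_cases hx : x = 0
  · subst hx
    have : HasDerivAt (fun y : ℝ => Real.exp (β * y)) (Real.exp (β * 0) * (β * 1)) 0 :=
      ((hasDerivAt_id (0 : ℝ)).const_mul β).exp
    simp [dslope_same, this.deriv]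
  · have h : ∀ s ∈ Set.uIcc (0 : ℝ) β,
        HasDerivAt (fun s => Real.exp (s * x) / x) (Real.exp (s * x)) s := by
      intro s _
      have := ((hasDerivAt_id s).mul_const x).exp.div_const x
      simpa [hx] using this
    rw [dslope_of_ne _ hx, slope_def_field,
      intervalIntegral.integral_eq_sub_of_hasDerivAt h
        (by apply Continuous.intervalIntegrable; fun_prop)]
    simp [sub_div]

/-- The second divided difference of `exp (β ·)` at the points `0, x, y`, as an integral. -/
noncomputable def expDivDiff (β x y : ℝ) : ℝ :=
  ∫ s in (0 : ℝ)..β, ∫ u in (0 : ℝ)..s, Real.exp ((s - u) * x + u * y)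

theorem continuous_expQuot (β : ℝ) : Continuous (expQuot β) := by
  rw [show expQuot β = fun x => ∫ s in (0 : ℝ)..β, Real.exp (s * x) from
    funext expQuot_eq_integral]
  exact intervalIntegral.continuous_parametric_intervalIntegral_of_continuous'
    (by fun_prop) _ _

theorem expQuot_pos {β : ℝ} (hβ : 0 < β) (x : ℝ) : 0 < expQuot β x := by
  rw [expQuot_eq_integral]
  exact intervalIntegral.intervalIntegral_pos_of_pos
    (Continuous.intervalIntegrable (by fun_prop) _ _) (fun _ => Real.exp_pos _) hβ

theorem continuous_expDivDiff_comp (β : ℝ) {Z : Type*} [TopologicalSpace Z]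
    [FirstCountableTopology Z] {f g : Z → ℝ}
    (hf : Continuous f) (hg : Continuous g) : Continuous fun z => expDivDiff β (f z) (g z) := by
  unfold expDivDiff
  refine intervalIntegral.continuous_parametric_intervalIntegral_of_continuous' ?_ _ _
  refine intervalIntegral.continuous_parametric_intervalIntegral_of_continuous
    (f := fun (p : Z × ℝ) u => Real.exp ((p.2 - u) * f p.1 + u * g p.1)) ?_ continuous_snd
  simp only [Function.uncurry_def]
  fun_prop

theorem expDivDiff_comm (β x y : ℝ) : expDivDiff β x y = expDivDiff β y x := by
  unfold expDivDiff
  congr 1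
  ext s
  have := intervalIntegral.integral_comp_sub_left (a := 0) (b := s)
    (fun u => Real.exp ((s - u) * y + u * x)) s
  simp only [sub_self, sub_zero] at this
  rw [← this]
  congr 1
  ext u
  ring_nf

/-- `expDivDiff` is the first divided difference of `expQuot`, which is itself a divided difference
of `exp (β ·)` with one node at `0`. -/
theorem expDivDiff_of_ne (β : ℝ) {x y : ℝ} (h : y ≠ x) :
    expDivDiff β x y = (expQuot β y - expQuot β x) / (y - x) := by
  have hne : y - x ≠ 0 := sub_ne_zero.2 h
  rw [expQuot_eq_integral, expQuot_eq_integral, ← intervalIntegral.integral_sub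
    (Continuous.intervalIntegrable (by fun_prop) _ _)
    (Continuous.intervalIntegrable (by fun_prop) _ _), ← intervalIntegral.integral_div]
  unfold expDivDiff
  congr 1
  ext s
  have h : ∀ u ∈ Set.uIcc (0 : ℝ) s,
      HasDerivAt (fun u => Real.exp ((s - u) * x + u * y) / (y - x))
        (Real.exp ((s - u) * x + u * y)) u := by
    intro u _
    have := ((((hasDerivAt_id u).const_sub s).mul_const x).add
      ((hasDerivAt_id u).mul_const y)).exp.div_const (y - x)
    refine this.congr_deriv ?_
    rw [div_eq_iff hne]
    simp only [id, Pi.add_apply]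
    ring
  rw [intervalIntegral.integral_eq_sub_of_hasDerivAt h
    (Continuous.intervalIntegrable (by fun_prop) _ _)]
  simp [sub_div]

theorem hasDerivAt_expQuot (β x : ℝ) : HasDerivAt (expQuot β) (expDivDiff β x x) x := by
  rw [hasDerivAt_iff_tendsto_slope]
  have hc : Continuous fun y => expDivDiff β x y :=
    continuous_expDivDiff_comp β continuous_const continuous_id
  refine ((hc.tendsto x).mono_left nhdsWithin_le_nhds).congr' ?_
  filter_upwards [self_mem_nhdsWithin] with y hy
  rw [slope_def_field, expDivDiff_of_ne β hy]

/-- The integral representation is valid on the diagonal too, where `dslope` is the derivative;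
continuity of the kernel can therefore be read off from the integral. -/
theorem dslope_expQuot (β x y : ℝ) : dslope (expQuot β) x y = expDivDiff β x y := by
  by_cases h : y = x
  · subst h
    rw [dslope_same, (hasDerivAt_expQuot β y).deriv]
  · rw [dslope_of_ne _ h, slope_def_field, expDivDiff_of_ne β h]

theorem kernelD_eq (β ω ω' Ω : ℝ) :
    kernelD β ω ω' Ω = -expDivDiff β (ω - ω') (ω - Ω) / expQuot β (ω - ω') := by
  rw [kernelD, dslope_expQuot]

theorem continuous_kernelD {β : ℝ} (hβ : 0 < β) :
    Continuous (fun p : ℝ × ℝ × ℝ => kernelD β p.1 p.2.1 p.2.2) := by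
  simp only [kernelD_eq]
  refine Continuous.div (continuous_expDivDiff_comp β (by fun_prop) (by fun_prop)).neg
    ((continuous_expQuot β).comp (by fun_prop)) fun p => (expQuot_pos hβ _).ne'

theorem expQuot_of_ne (β : ℝ) {x : ℝ} (hx : x ≠ 0) :
    expQuot β x = (Real.exp (β * x) - 1) / x := by
  rw [expQuot, dslope_of_ne _ hx, slope_def_field]
  simp

theorem kernelD_eq_formula {β : ℝ} (hβ : 0 < β) {ω ω' Ω : ℝ} (h : ω ≠ ω') (h1 : Ω ≠ ω)
    (h2 : Ω ≠ ω') :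
    kernelD β ω ω' Ω = 1 / (ω' - Ω) - ((ω - ω') * (Real.exp (β * (ω - Ω)) - 1)) /
      ((ω - Ω) * (ω' - Ω) * (Real.exp (β * (ω - ω')) - 1)) := by
  have a1 : ω - ω' ≠ 0 := sub_ne_zero.2 h
  have a2 : ω - Ω ≠ 0 := sub_ne_zero.2 h1.symm
  have a3 : ω' - Ω ≠ 0 := sub_ne_zero.2 h2.symm
  have a4 : Real.exp (β * (ω - ω')) - 1 ≠ 0 := by
    rw [sub_ne_zero, Ne, Real.exp_eq_one_iff]
    exact mul_ne_zero hβ.ne' a1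
  have a5 : ω - Ω ≠ ω - ω' := fun h => a3 (by linarith)
  rw [kernelD_eq, expDivDiff_of_ne β a5, expQuot_of_ne β a1, expQuot_of_ne β a2,
    show ω - Ω - (ω - ω') = ω' - Ω by ring]
  field_simp
  ring

/-- Partial fractions: off the diagonal, the kernel splits into two terms without poles, each
attached to one of the two Bohr frequencies. -/
theorem kernelD_eq_sub {β : ℝ} (hβ : 0 < β) {ω ω' : ℝ} (h : ω ≠ ω') (Ω : ℝ) :
    kernelD β ω ω' Ω = (Real.exp (β * ω') * expQuot β (ω - Ω) -
      Real.exp (β * ω) * expQuot β (ω' - Ω)) / (Real.exp (β * ω) - Real.exp (β * ω')) := by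
  have hd : Real.exp (β * ω) - Real.exp (β * ω') ≠ 0 := by
    rw [sub_ne_zero, Ne, Real.exp_eq_exp]
    exact fun h' => h (mul_left_cancel₀ hβ.ne' h')
  have hcd : Continuous fun Ω => kernelD β ω ω' Ω :=
    (continuous_kernelD hβ).comp (f := fun Ω : ℝ => (ω, ω', Ω)) (by fun_prop)
  have hq := continuous_expQuot β
  -- Both sides are continuous in `Ω`, so it is enough to compare them off the removable points.
  have hdense : Dense ({ω, ω'}ᶜ : Set ℝ) :=
    (dense_univ.sdiff_finite (Set.toFinite {ω, ω'})).mono fun x hx => hx.2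
  refine congrFun (Continuous.ext_on (g := fun Ω => (Real.exp (β * ω') * expQuot β (ω - Ω) -
    Real.exp (β * ω) * expQuot β (ω' - Ω)) / (Real.exp (β * ω) - Real.exp (β * ω')))
    hdense hcd (by fun_prop) ?_) Ω
  intro Ω hΩ
  simp only [Set.mem_compl_iff, Set.mem_insert_iff, Set.mem_singleton_iff, not_or] at hΩ
  have a1 : ω - ω' ≠ 0 := sub_ne_zero.2 h
  have a2 : ω - Ω ≠ 0 := sub_ne_zero.2 (Ne.symm hΩ.1)
  have a3 : ω' - Ω ≠ 0 := sub_ne_zero.2 (Ne.symm hΩ.2)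
  have e1 : Real.exp (β * (ω - ω')) = Real.exp (β * ω) / Real.exp (β * ω') := by
    rw [← Real.exp_sub]; ring_nf
  have e2 : Real.exp (β * (ω - Ω)) = Real.exp (β * ω) / Real.exp (β * Ω) := by
    rw [← Real.exp_sub]; ring_nf
  have e3 : Real.exp (β * (ω' - Ω)) = Real.exp (β * ω') / Real.exp (β * Ω) := by
    rw [← Real.exp_sub]; ring_nf
  have e4 : Real.exp (β * ω) / Real.exp (β * ω') - 1 ≠ 0 := by
    rw [div_sub_one (Real.exp_pos _).ne']
    exact div_ne_zero hd (Real.exp_pos _).ne'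
  have p1 := (Real.exp_pos (β * ω')).ne'
  have p2 := (Real.exp_pos (β * Ω)).ne'
  simp only
  rw [kernelD_eq_formula hβ h hΩ.1 hΩ.2, expQuot_of_ne β a2, expQuot_of_ne β a3, e1, e2, e3,
    div_sub_one p1]
  generalize Real.exp (β * ω) = a at *
  generalize Real.exp (β * ω') = b at *
  generalize Real.exp (β * Ω) = z at *
  field_simp
  ring

/-- An exponential with exponent between `0` and `β` is bounded by the sum of the extreme ones. All
bounds by the thermal weight `1 + e^{-βΩ}` come from this. -/
theorem exp_mul_le_one_add_exp {β u : ℝ} (h0 : 0 ≤ u) (h1 : u ≤ β) (y : ℝ) :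
    Real.exp (u * y) ≤ 1 + Real.exp (β * y) := by
  rcases le_total 0 y with hy | hy
  · have : Real.exp (u * y) ≤ Real.exp (β * y) := Real.exp_le_exp.2 (by gcongr)
    linarith
  · have : Real.exp (u * y) ≤ 1 := Real.exp_le_one_iff.2 (mul_nonpos_of_nonneg_of_nonpos h0 hy)
    linarith [Real.exp_pos (β * y)]

theorem expQuot_le {β : ℝ} (hβ : 0 < β) (y : ℝ) :
    expQuot β y ≤ β * (1 + Real.exp (β * y)) := by
  rw [expQuot_eq_integral]
  calc ∫ s in (0 : ℝ)..β, Real.exp (s * y) ≤ ∫ s in (0 : ℝ)..β, (1 + Real.exp (β * y)) := by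
        refine intervalIntegral.integral_mono_on hβ.le
          (Continuous.intervalIntegrable (by fun_prop) _ _)
          (Continuous.intervalIntegrable (by fun_prop) _ _) fun s hs => ?_
        exact exp_mul_le_one_add_exp hs.1 hs.2 y
    _ = β * (1 + Real.exp (β * y)) := by simp [mul_add]

theorem expDivDiff_nonneg {β : ℝ} (hβ : 0 < β) (x y : ℝ) : 0 ≤ expDivDiff β x y :=
  intervalIntegral.integral_nonneg hβ.le fun _ hs =>
    intervalIntegral.integral_nonneg hs.1 fun _ _ => (Real.exp_pos _).le

theorem expDivDiff_le {β : ℝ} (hβ : 0 < β) (x y : ℝ) :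
    expDivDiff β x y ≤ β * (β * (Real.exp (β * |x|) * (1 + Real.exp (β * y)))) := by
  unfold expDivDiff
  set M := Real.exp (β * |x|) * (1 + Real.exp (β * y)) with hM
  have hM0 : 0 ≤ M := by positivity
  have inner : ∀ s ∈ Set.Icc (0 : ℝ) β,
      ∫ u in (0 : ℝ)..s, Real.exp ((s - u) * x + u * y) ≤ β * M := by
    intro s hs
    calc ∫ u in (0 : ℝ)..s, Real.exp ((s - u) * x + u * y) ≤ ∫ u in (0 : ℝ)..s, M := by
          refine intervalIntegral.integral_mono_on hs.1
            (Continuous.intervalIntegrable (by fun_prop) _ _)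
            (Continuous.intervalIntegrable (by fun_prop) _ _) fun u hu => ?_
          rw [Real.exp_add]
          refine mul_le_mul (Real.exp_le_exp.2 ?_)
            (exp_mul_le_one_add_exp hu.1 (hu.2.trans hs.2) y) (Real.exp_pos _).le
            (Real.exp_pos _).le
          calc (s - u) * x ≤ (s - u) * |x| :=
                mul_le_mul_of_nonneg_left (le_abs_self x) (by linarith [hu.2])
            _ ≤ β * |x| := mul_le_mul_of_nonneg_right (by linarith [hu.1, hs.2]) (abs_nonneg x)
      _ = s * M := by simp
      _ ≤ β * M := mul_le_mul_of_nonneg_right hs.2 hM0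
  calc _ ≤ ∫ s in (0 : ℝ)..β, β * M := by
        refine intervalIntegral.integral_mono_on hβ.le (Continuous.intervalIntegrable ?_ _ _)
          (Continuous.intervalIntegrable (by fun_prop) _ _) inner
        refine intervalIntegral.continuous_parametric_intervalIntegral_of_continuous
          (f := fun (s : ℝ) u => Real.exp ((s - u) * x + u * y)) ?_ continuous_id
        simp only [Function.uncurry_def]
        fun_prop
    _ = β * (β * M) := by simp

/-- The kernel grows at most like `1 + e^{-βΩ}`, locally uniformly in the Bohr frequencies. -/
theorem abs_kernelD_le {β : ℝ} (hβ : 0 < β) (ω ω' Ω : ℝ) :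
    |kernelD β ω ω' Ω| ≤ β * (β * (Real.exp (β * |ω - ω'|) * (1 + Real.exp (β * ω)))) /
      expQuot β (ω - ω') * (1 + Real.exp (-β * Ω)) := by
  rw [kernelD_eq, abs_div, abs_neg, abs_of_nonneg (expDivDiff_nonneg hβ _ _),
    abs_of_pos (expQuot_pos hβ _), div_mul_eq_mul_div]
  refine div_le_div_of_nonneg_right ((expDivDiff_le hβ _ _).trans ?_) (expQuot_pos hβ _).le
  have h1 : 1 + Real.exp (β * (ω - Ω)) ≤ (1 + Real.exp (β * ω)) * (1 + Real.exp (-β * Ω)) := by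
    have : Real.exp (β * (ω - Ω)) = Real.exp (β * ω) * Real.exp (-β * Ω) := by
      rw [← Real.exp_add]; ring_nf
    rw [this]
    nlinarith [Real.exp_pos (β * ω), Real.exp_pos (-β * Ω)]
  calc _ ≤ β * (β * (Real.exp (β * |ω - ω'|) *
        ((1 + Real.exp (β * ω)) * (1 + Real.exp (-β * Ω))))) := by gcongr
    _ = _ := by ring

/-- The kernel decays like `1/Ω`, up to the thermal factor `1 + e^{-βΩ}`. -/
theorem exists_abs_kernelD_mul_le {β : ℝ} (hβ : 0 < β) (ω ω' : ℝ) :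
    ∃ c : ℝ, ∀ Ω, |kernelD β ω ω' Ω| * |ω' - Ω| ≤ c * (1 + Real.exp (-β * Ω)) := by
  have hq := expQuot_pos hβ (ω - ω')
  refine ⟨(β * (1 + Real.exp (β * ω)) + expQuot β (ω - ω')) / expQuot β (ω - ω'), fun Ω => ?_⟩
  by_cases h : ω' - Ω = 0
  · rw [h, abs_zero, mul_zero]
    positivity
  have hne : ω - Ω ≠ ω - ω' := fun h' => h (by linarith)
  have hy := expQuot_le hβ (ω - Ω)
  have hy0 := expQuot_pos hβ (ω - Ω)
  rw [kernelD_eq, expDivDiff_of_ne β hne, show ω - Ω - (ω - ω') = ω' - Ω by ring, abs_div,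
    abs_neg, abs_div, abs_of_pos hq, div_mul_eq_mul_div, div_mul_cancel₀ _ (abs_ne_zero.2 h),
    div_mul_eq_mul_div]
  refine div_le_div_of_nonneg_right ?_ hq.le
  have h1 : 1 + Real.exp (β * (ω - Ω)) ≤ (1 + Real.exp (β * ω)) * (1 + Real.exp (-β * Ω)) := by
    have : Real.exp (β * (ω - Ω)) = Real.exp (β * ω) * Real.exp (-β * Ω) := by
      rw [← Real.exp_add]; ring_nf
    rw [this]
    nlinarith [Real.exp_pos (β * ω), Real.exp_pos (-β * Ω)]
  have h2 : expQuot β (ω - Ω) ≤ β * ((1 + Real.exp (β * ω)) * (1 + Real.exp (-β * Ω))) :=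
    hy.trans (by gcongr)
  have h3 : |expQuot β (ω - Ω) - expQuot β (ω - ω')| ≤
      expQuot β (ω - Ω) + expQuot β (ω - ω') := by
    rw [abs_le]; constructor <;> linarith
  have h4 : 0 < expQuot β (ω - ω') * Real.exp (-β * Ω) := by positivity
  nlinarith

/-! ### Operators that are diagonal in a Hilbert basis -/

namespace HilbertBasis

variable {X 𝓗 : Type*} [NormedAddCommGroup 𝓗] [InnerProductSpace ℂ 𝓗]
  (b : HilbertBasis X ℂ 𝓗)

theorem hasSum_sq_norm_inner (v : 𝓗) : HasSum (fun x => ‖⟪b x, v⟫_ℂ‖ ^ 2) (‖v‖ ^ 2) := by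
  have h := b.hasSum_inner_mul_inner v v
  rw [inner_self_eq_norm_sq_to_K] at h
  have h2 := Complex.hasSum_re h
  convert h2 using 1
  · ext x
    rw [← inner_conj_symm v (b x), mul_comm, Complex.mul_conj, Complex.normSq_eq_norm_sq,
      Complex.ofReal_re]
  · norm_cast

theorem ext_inner {v w : 𝓗} (h : ∀ x, ⟪b x, v⟫_ℂ = ⟪b x, w⟫_ℂ) : v = w := by
  apply b.repr.injective
  ext x
  rw [b.repr_apply_apply, b.repr_apply_apply, h]

/-- The coordinates of a vector, multiplied by bounded scalars, are again square-summable. -/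
theorem memℓp_diag {g : X → ℂ} (hg : ∃ M, ∀ x, ‖g x‖ ≤ M) (v : 𝓗) :
    Memℓp (fun x => g x * b.repr v x) 2 := by
  obtain ⟨M, hM⟩ := hg
  refine ((lp.memℓp (b.repr v)).const_smul (M : ℂ)).mono' fun x => ?_
  simp only [Pi.smul_apply, norm_smul, norm_mul, Complex.norm_real]
  exact mul_le_mul_of_nonneg_right ((hM x).trans (le_abs_self M)) (norm_nonneg _)

theorem norm_repr_symm_mul_le {g : X → ℂ} (hg : ∃ M, ∀ x, ‖g x‖ ≤ M) {M : ℝ}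
    (hM : ∀ x, ‖g x‖ ≤ M) (hM0 : 0 ≤ M) (v : 𝓗) :
    ‖b.repr.symm ⟨_, b.memℓp_diag hg v⟩‖ ≤ M * ‖v‖ := by
  rw [LinearIsometryEquiv.norm_map, ← b.repr.norm_map v,
    show M * ‖b.repr v‖ = ‖(M : ℂ) • b.repr v‖ by
      rw [norm_smul, Complex.norm_real, Real.norm_of_nonneg hM0]]
  refine lp.norm_mono (by norm_num) fun x => ?_
  simp only [lp.coeFn_smul, Pi.smul_apply, norm_smul, norm_mul, Complex.norm_real,
    Real.norm_of_nonneg hM0]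
  exact mul_le_mul_of_nonneg_right (hM x) (norm_nonneg _)

/-- The bounded operator that multiplies the basis vector `b x` by `g x`. -/
noncomputable def diag (g : X → ℂ) (hg : ∃ M, ∀ x, ‖g x‖ ≤ M) : 𝓗 →L[ℂ] 𝓗 :=
  LinearMap.mkContinuousOfExistsBound
    { toFun := fun v => b.repr.symm ⟨_, b.memℓp_diag hg v⟩
      map_add' := fun v w => by
        rw [← map_add]
        congr 1
        ext x
        simp only [map_add, lp.coeFn_add, Pi.add_apply, mul_add]
      map_smul' := fun c v => by
        rw [RingHom.id_apply, ← map_smul]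
        congr 1
        ext x
        simp only [map_smul, lp.coeFn_smul, Pi.smul_apply, smul_eq_mul, mul_left_comm] }
    ⟨|hg.choose|, fun v => b.norm_repr_symm_mul_le hg
      (fun x => (hg.choose_spec x).trans (le_abs_self _)) (abs_nonneg _) v⟩

variable {g : X → ℂ} (hg : ∃ M, ∀ x, ‖g x‖ ≤ M)

theorem norm_diag_apply_le {M : ℝ} (hM : ∀ x, ‖g x‖ ≤ M) (hM0 : 0 ≤ M) (v : 𝓗) :
    ‖b.diag g hg v‖ ≤ M * ‖v‖ :=
  b.norm_repr_symm_mul_le hg hM hM0 v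

theorem inner_diag (x : X) (v : 𝓗) : ⟪b x, b.diag g hg v⟫_ℂ = g x * ⟪b x, v⟫_ℂ := by
  rw [← b.repr_apply_apply, ← b.repr_apply_apply]
  change b.repr (b.repr.symm _) x = _
  rw [LinearIsometryEquiv.apply_symm_apply]

theorem hasSum_diag (v : 𝓗) :
    HasSum (fun x => g x • ⟪b x, v⟫_ℂ • b x) (b.diag g hg v) := by
  have := b.hasSum_repr (b.diag g hg v)
  simpa only [b.repr_apply_apply, b.inner_diag hg, mul_smul] using this

theorem diag_apply_self (x : X) : b.diag g hg (b x) = g x • b x := by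
  apply b.ext_inner
  intro y
  rw [b.inner_diag, inner_smul_right]
  by_cases h : y = x
  · rw [h]
  · rw [b.orthonormal.2 h, mul_zero, mul_zero]

end HilbertBasis

/-! ### Discrete spectral sums of a bath -/

namespace Bath

variable {ι κ K : Type*} [NormedAddCommGroup K] [InnerProductSpace ℂ K] [CompleteSpace K]
  (B : Bath ι κ K) {β : ℝ}

variable {B} in
theorem IsThermal.Z_pos [Nonempty κ] (hB : B.IsThermal β) : 0 < B.Z β :=
  Summable.tsum_pos hB (fun _ => (Real.exp_pos _).le) (Classical.arbitrary κ) (Real.exp_pos _)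

theorem inner_R_symm (a : ι) (v w : K) : ⟪v, B.R a w⟫_ℂ = ⟪B.R a v, w⟫_ℂ := by
  rw [← ContinuousLinearMap.adjoint_inner_right, (B.R_selfAdjoint a).adjoint_eq]

theorem inner_R_conj (a : ι) (v w : K) : (starRingEnd ℂ) ⟪v, B.R a w⟫_ℂ = ⟪w, B.R a v⟫_ℂ := by
  rw [inner_conj_symm, inner_R_symm]

theorem norm_inner_R_comm (a : ι) (v w : K) : ‖⟪v, B.R a w⟫_ℂ‖ = ‖⟪w, B.R a v⟫_ℂ‖ := by
  rw [← B.inner_R_conj a v w, RCLike.norm_conj]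

theorem Z_nonneg : 0 ≤ B.Z β := tsum_nonneg fun _ => (Real.exp_pos _).le

/-- The Gibbs weight `p_k`. -/
noncomputable def weight (β : ℝ) (k : κ) : ℝ := Real.exp (-β * B.E k) / B.Z β

theorem weight_nonneg (k : κ) : 0 ≤ B.weight β k :=
  div_nonneg (Real.exp_pos _).le B.Z_nonneg

variable {B} in
theorem IsThermal.summable_weight (hB : B.IsThermal β) : Summable (B.weight β) :=
  hB.div_const _

theorem spectralTerm_eq (a b : ι) (f : ℝ → ℂ) (p : κ × κ) :
    B.spectralTerm β a b f p = B.spectralTerm β a b 1 p * f (B.E p.2 - B.E p.1) := by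
  simp [spectralTerm]

/-- The diagonal spectral terms `p_k |⟨e_l, R_a e_k⟩|²` are non-negative. -/
theorem spectralTerm_self_one (a : ι) (p : κ × κ) :
    B.spectralTerm β a a 1 p =
      ((B.weight β p.1 * ‖⟪B.e p.2, B.R a (B.e p.1)⟫_ℂ‖ ^ 2 : ℝ) : ℂ) := by
  rw [spectralTerm, ← B.inner_R_conj a (B.e p.2) (B.e p.1), mul_assoc (Complex.ofReal _),
    mul_comm ((starRingEnd ℂ) _), Complex.mul_conj, Complex.normSq_eq_norm_sq]
  simp [weight]

/-- The matrix of spectral terms is positive semidefinite, so that its off-diagonal entries are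
bounded by the diagonal ones. -/
theorem norm_spectralTerm_one_le (a b : ι) (p : κ × κ) :
    ‖B.spectralTerm β a b 1 p‖ ≤
      (B.spectralTerm β a a 1 p).re + (B.spectralTerm β b b 1 p).re := by
  rw [spectralTerm_self_one, spectralTerm_self_one, Complex.ofReal_re, Complex.ofReal_re,
    spectralTerm, norm_mul, norm_mul, norm_mul, Complex.norm_real,
    Real.norm_of_nonneg (show 0 ≤ Real.exp (-β * B.E p.1) / B.Z β from B.weight_nonneg (β := β) p.1),
    B.norm_inner_R_comm a (B.e p.1) (B.e p.2)]
  have := B.weight_nonneg (β := β) p.1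
  simp only [Pi.one_apply, norm_one, mul_one]
  change B.weight β p.1 * _ * _ ≤ _
  rw [← mul_add, mul_assoc]
  refine mul_le_mul_of_nonneg_left ?_ this
  nlinarith [sq_nonneg (‖⟪B.e p.2, B.R a (B.e p.1)⟫_ℂ‖ - ‖⟪B.e p.2, B.R b (B.e p.1)⟫_ℂ‖),
    sq_nonneg (‖⟪B.e p.2, B.R a (B.e p.1)⟫_ℂ‖), sq_nonneg (‖⟪B.e p.2, B.R b (B.e p.1)⟫_ℂ‖)]

theorem spectralTerm_self_re_nonneg (a : ι) (p : κ × κ) :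
    0 ≤ (B.spectralTerm β a a 1 p).re := by
  rw [spectralTerm_self_one, Complex.ofReal_re]
  exact mul_nonneg (B.weight_nonneg _) (sq_nonneg _)

variable {B}

theorem IsThermal.summable_spectralTerm_self_re (hB : B.IsThermal β) (a : ι) :
    Summable fun p => (B.spectralTerm β a a 1 p).re := by
  refine (summable_prod_of_nonneg (fun p => B.spectralTerm_self_re_nonneg a p)).2 ⟨?_, ?_⟩
  · intro k
    simp only [spectralTerm_self_one, Complex.ofReal_re]
    exact (B.e.hasSum_sq_norm_inner _).summable.mul_left _
  · simp only [spectralTerm_self_one, Complex.ofReal_re, tsum_mul_left,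
      (B.e.hasSum_sq_norm_inner _).tsum_eq]
    refine Summable.of_nonneg_of_le (fun k => mul_nonneg (B.weight_nonneg _) (sq_nonneg _))
      (fun k => ?_) (hB.summable_weight.mul_right (‖B.R a‖ ^ 2))
    refine mul_le_mul_of_nonneg_left ?_ (B.weight_nonneg _)
    have := (B.R a).le_opNorm (B.e k)
    rw [B.e.orthonormal.1 k, mul_one] at this
    gcongr

theorem IsThermal.summable_norm_spectralTerm_one (hB : B.IsThermal β) (a b : ι) :
    Summable fun p => ‖B.spectralTerm β a b 1 p‖ :=
  Summable.of_nonneg_of_le (fun _ => norm_nonneg _) (B.norm_spectralTerm_one_le a b)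
    ((hB.summable_spectralTerm_self_re a).add (hB.summable_spectralTerm_self_re b))

variable (B) in
/-- The KMS condition for spectral terms: the thermal factor `e^{-βΩ}` exchanges the two bath
operators and reverses the energy transfer. -/
theorem spectralTerm_exp_mul (a b : ι) (f : ℝ → ℂ) (p : κ × κ) :
    B.spectralTerm β a b (fun Ω => (Real.exp (-β * Ω) : ℂ) * f Ω) p =
      B.spectralTerm β b a (fun Ω => f (-Ω)) p.swap := by
  simp only [spectralTerm, Prod.fst_swap, Prod.snd_swap, neg_sub]
  have : Real.exp (-β * B.E p.2) / B.Z β =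
      Real.exp (-β * B.E p.1) / B.Z β * Real.exp (-β * (B.E p.2 - B.E p.1)) := by
    rw [div_mul_eq_mul_div, ← Real.exp_add]
    ring_nf
  rw [this]
  push_cast
  ring

variable (B) in
/-- A summable majorant for spectral terms of functions that are `O(1 + e^{-βΩ})`. -/
noncomputable def majorant (β : ℝ) (a b : ι) (p : κ × κ) : ℝ :=
  ‖B.spectralTerm β a b 1 p‖ + ‖B.spectralTerm β b a 1 p.swap‖

theorem IsThermal.summable_majorant (hB : B.IsThermal β) (a b : ι) :
    Summable (B.majorant β a b) :=
  (hB.summable_norm_spectralTerm_one a b).add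
    ((Equiv.prodComm κ κ).summable_iff.2 (hB.summable_norm_spectralTerm_one b a))

variable (B) in
/-- The contribution of `e^{-βΩ}` to the bound is, by the KMS condition, a spectral term of the
reversed transition. -/
theorem norm_spectralTerm_le {f : ℝ → ℂ} {c : ℝ} (a b : ι) (p : κ × κ)
    (hf : ‖f (B.E p.2 - B.E p.1)‖ ≤ c * (1 + Real.exp (-β * (B.E p.2 - B.E p.1)))) :
    ‖B.spectralTerm β a b f p‖ ≤ c * B.majorant β a b p := by
  have h : ‖B.spectralTerm β b a 1 p.swap‖ =
      ‖B.spectralTerm β a b 1 p‖ * Real.exp (-β * (B.E p.2 - B.E p.1)) := by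
    have := B.spectralTerm_exp_mul (β := β) a b 1 p
    rw [show (fun Ω => (1 : ℝ → ℂ) (-Ω)) = 1 from rfl] at this
    rw [← this, spectralTerm_eq, norm_mul]
    simp [Complex.norm_exp]
  rw [spectralTerm_eq, norm_mul, majorant, h]
  calc _ ≤ ‖B.spectralTerm β a b 1 p‖ * (c * (1 + Real.exp (-β * (B.E p.2 - B.E p.1)))) := by
        gcongr
    _ = _ := by ring

theorem IsThermal.summable_spectralTerm (hB : B.IsThermal β) {f : ℝ → ℂ} {c : ℝ} (a b : ι)
    (hf : ∀ Ω, ‖f Ω‖ ≤ c * (1 + Real.exp (-β * Ω))) : Summable (B.spectralTerm β a b f) :=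
  Summable.of_norm_bounded ((hB.summable_majorant a b).mul_left c)
    fun p => B.norm_spectralTerm_le a b p (hf _)

theorem IsThermal.summable_spectralTerm_of_bounded (hB : B.IsThermal β) {f : ℝ → ℂ} {c : ℝ}
    (a b : ι) (hf : ∀ Ω, ‖f Ω‖ ≤ c) : Summable (B.spectralTerm β a b f) :=
  hB.summable_spectralTerm a b fun Ω => (hf Ω).trans <| by
    have := mul_nonneg ((norm_nonneg _).trans (hf Ω)) (Real.exp_pos (-β * Ω)).le
    linarith

variable (B) in
theorem spectralSum_exp_mul (a b : ι) (f : ℝ → ℂ) :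
    B.spectralSum β a b (fun Ω => (Real.exp (-β * Ω) : ℂ) * f Ω) =
      B.spectralSum β b a (fun Ω => f (-Ω)) := by
  unfold spectralSum
  rw [← (Equiv.prodComm κ κ).tsum_eq (B.spectralTerm β b a _)]
  exact tsum_congr fun p => B.spectralTerm_exp_mul a b f p

variable (B) in
theorem spectralSum_const_mul (a b : ι) (c : ℂ) (f : ℝ → ℂ) :
    B.spectralSum β a b (fun Ω => c * f Ω) = c * B.spectralSum β a b f := by
  unfold spectralSum
  rw [← tsum_mul_left]
  exact tsum_congr fun p => by simp only [spectralTerm]; ring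

theorem spectralSum_sub {a b : ι} {f g : ℝ → ℂ} (hf : Summable (B.spectralTerm β a b f))
    (hg : Summable (B.spectralTerm β a b g)) :
    B.spectralSum β a b (fun Ω => f Ω - g Ω) = B.spectralSum β a b f - B.spectralSum β a b g := by
  unfold spectralSum
  rw [← hf.tsum_sub hg]
  exact tsum_congr fun p => by simp only [spectralTerm]; ring

/-! ### The autocorrelation function as a spectral sum -/

theorem norm_phase (t E : ℝ) : ‖Complex.exp (Complex.I * t * E)‖ ≤ 1 := by
  rw [show Complex.I * (t : ℂ) * E = ((t * E : ℝ) : ℂ) * Complex.I by push_cast; ring,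
    Complex.norm_exp_ofReal_mul_I]

variable (B) in
theorem inner_evolve (t : ℝ) (k : κ) (v : K) :
    ⟪B.e k, B.evolve t v⟫_ℂ = Complex.exp (Complex.I * t * B.E k) * ⟪B.e k, v⟫_ℂ := by
  have hg : ∃ M, ∀ k, ‖Complex.exp (Complex.I * t * B.E k)‖ ≤ M := ⟨1, fun k => norm_phase t _⟩
  rw [evolve, (B.e.hasSum_diag hg v).tsum_eq, B.e.inner_diag]

/-- The Fourier transform of the autocorrelation function is the discrete measure of the spectral
sums: insert the eigenbasis of the bath between the two bath operators. -/
theorem IsThermal.hasSum_corr (hB : B.IsThermal β) (a b : ι) (t : ℝ) :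
    HasSum (B.spectralTerm β a b (fun Ω => Complex.exp (-(Complex.I * Ω * t))))
      (B.corr β a b t) := by
  have hs : Summable (B.spectralTerm β a b (fun Ω => Complex.exp (-(Complex.I * Ω * t)))) := by
    refine hB.summable_spectralTerm_of_bounded (c := 1) a b fun Ω => ?_
    rw [show -(Complex.I * (Ω : ℂ) * t) = Complex.I * ((-Ω : ℝ) : ℂ) * t by push_cast; ring]
    exact norm_phase _ _
  have hfib : ∀ k, HasSum
      (fun l => B.spectralTerm β a b (fun Ω => Complex.exp (-(Complex.I * Ω * t))) (k, l))
      (((Real.exp (-β * B.E k) / B.Z β : ℝ) : ℂ) *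
        ⟪B.e k, B.evolve t (B.R a (B.evolve (-t) (B.R b (B.e k))))⟫_ℂ) := by
    intro k
    rw [inner_evolve, inner_R_symm]
    refine (((B.e.hasSum_inner_mul_inner _ _).mul_left _).mul_left _).congr_fun fun l => ?_
    rw [inner_evolve, ← inner_R_symm]
    simp only [spectralTerm]
    rw [show -(Complex.I * ((B.E l - B.E k : ℝ) : ℂ) * t) =
      Complex.I * t * B.E k + Complex.I * ((-t : ℝ) : ℂ) * B.E l by push_cast; ring,
      Complex.exp_add]
    ring
  have := hs.hasSum.prod_fiberwise hfib
  rw [corr, gibbs, this.tsum_eq]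
  exact hs.hasSum

/-! ### The principal-value form of the coefficients of a bath -/

/-- `expQuot β (ω - Ω)` is of the order of the thermal weight `1 + e^{-βΩ}`. -/
theorem norm_expQuot_sub_le (hβ : 0 < β) (ω Ω : ℝ) : ‖(expQuot β (ω - Ω) : ℂ)‖ ≤
    β * (1 + Real.exp (β * ω)) * (1 + Real.exp (-β * Ω)) := by
  rw [Complex.norm_real, Real.norm_of_nonneg (expQuot_pos hβ _).le]
  refine (expQuot_le hβ _).trans ?_
  have : Real.exp (β * (ω - Ω)) = Real.exp (β * ω) * Real.exp (-β * Ω) := by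
    rw [← Real.exp_add]; ring_nf
  rw [this, mul_assoc]
  refine mul_le_mul_of_nonneg_left ?_ hβ.le
  nlinarith [Real.exp_pos (β * ω), Real.exp_pos (-β * Ω)]

open Classical in
/-- A pole-free integrand may be cut off at `ω` if there is no point mass there. -/
theorem IsThermal.tendsto_cutoff (hB : B.IsThermal β) (hβ : 0 < β) {a b : ι} {ω : ℝ}
    (hω : B.NoAtom β a b ω) :
    Tendsto (fun r : ℝ => B.spectralSum β a b
        (fun Ω => if r < |Ω - ω| then (expQuot β (ω - Ω) : ℂ) else 0)) (𝓝[>] 0)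
      (𝓝 (B.spectralSum β a b (fun Ω => (expQuot β (ω - Ω) : ℂ)))) := by
  have hbd := norm_expQuot_sub_le hβ ω
  -- A vanishing point mass at `ω` lets the limit ignore the transitions of frequency `ω`.
  have hlim : B.spectralSum β a b (fun Ω => (expQuot β (ω - Ω) : ℂ)) =
      ∑' p, B.spectralTerm β a b
        (fun Ω => (expQuot β (ω - Ω) : ℂ) - (expQuot β 0 : ℂ) * if Ω = ω then 1 else 0) p := by
    have h1 : Summable (B.spectralTerm β a b (fun Ω => if Ω = ω then (1 : ℂ) else 0)) :=
      hB.summable_spectralTerm_of_bounded (c := 1) a b fun Ω => by split_ifs <;> simp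
    have h2 := spectralSum_sub (hB.summable_spectralTerm a b hbd)
      (g := fun Ω => (expQuot β 0 : ℂ) * if Ω = ω then 1 else 0)
      ((h1.mul_left (expQuot β 0 : ℂ)).congr fun p => by simp only [spectralTerm]; ring)
    rw [spectralSum_const_mul, show B.spectralSum β a b (fun Ω => if Ω = ω then 1 else 0) = 0
      from hω, mul_zero, sub_zero] at h2
    exact h2.symm
  rw [hlim]
  refine tendsto_tsum_of_dominated_convergence
    ((hB.summable_majorant a b).mul_left (β * (1 + Real.exp (β * ω)))) (fun p => ?_)
    (Eventually.of_forall fun r p => ?_)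
  · by_cases h : B.E p.2 - B.E p.1 = ω
    · refine tendsto_const_nhds.congr' ?_
      filter_upwards [self_mem_nhdsWithin] with r hr
      have : ¬ r < 0 := not_lt.2 (le_of_lt hr)
      simp [spectralTerm, h, this]
    · refine tendsto_const_nhds.congr' ?_
      have : ∀ᶠ r : ℝ in 𝓝[>] 0, r < |B.E p.2 - B.E p.1 - ω| :=
        nhdsWithin_le_nhds (gt_mem_nhds (abs_pos.2 (sub_ne_zero.2 h)))
      filter_upwards [this] with r hr
      simp [spectralTerm, h, hr]
  · refine B.norm_spectralTerm_le a b p ?_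
    split_ifs
    · exact hbd _
    · rw [norm_zero]
      exact (norm_nonneg _).trans (hbd (B.E p.2 - B.E p.1))

open Classical in
/-- The spectral sum of the pole-free function `(e^{β(ω-Ω)} - 1)/(ω - Ω)`. Cut off at `ω`, it splits
into two dispersion sums; the KMS condition turns the one with the factor `e^{-βΩ}` into a
dispersion sum at `-ω` with the bath operators exchanged. -/
theorem IsThermal.spectralSum_expQuot (hB : B.IsThermal β) (hβ : 0 < β) {a b : ι} {ω : ℝ}
    {s s' : ℂ} (hω : B.NoAtom β a b ω) (hs : B.HasLambShift β a b ω s)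
    (hs' : B.HasLambShift β b a (-ω) s') :
    B.spectralSum β a b (fun Ω => (expQuot β (ω - Ω) : ℂ)) = -(Real.exp (β * ω) * s') - s := by
  refine tendsto_nhds_unique (hB.tendsto_cutoff hβ hω) ?_
  refine (((hs'.const_mul _).neg).sub hs).congr' ?_
  filter_upwards [self_mem_nhdsWithin] with r hr
  have hr : 0 < r := hr
  have hcut : ∀ (a b : ι) (ω : ℝ), Summable (B.spectralTerm β a b
      (fun Ω => if r < |Ω - ω| then 1 / ((ω : ℂ) - Ω) else 0)) := by
    intro a b ω
    refine hB.summable_spectralTerm_of_bounded (c := 1 / r) a b fun Ω => ?_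
    split_ifs with h
    · rw [norm_div, norm_one, ← Complex.ofReal_sub, Complex.norm_real, Real.norm_eq_abs,
        abs_sub_comm]
      gcongr
    · simp only [norm_zero]
      positivity
  have h1 := B.spectralSum_exp_mul (β := β) a b
    (fun Ω => if r < |Ω - ω| then 1 / ((ω : ℂ) - Ω) else 0)
  have h2 : (fun Ω : ℝ => if r < |-Ω - ω| then 1 / ((ω : ℂ) - (-Ω : ℝ)) else 0) =
      fun Ω => (-1 : ℂ) * if r < |Ω - -ω| then 1 / (((-ω : ℝ) : ℂ) - Ω) else 0 := by
    ext Ω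
    rw [show -Ω - ω = -(Ω - -ω) by ring, abs_neg]
    split_ifs with h
    · push_cast
      rw [show -(ω : ℂ) - Ω = -((ω : ℂ) - -Ω) by ring, one_div, one_div, inv_neg]
      ring
    · simp
  rw [h2, spectralSum_const_mul] at h1
  have h4 : ∀ S' : ℂ, -((Real.exp (β * ω) : ℂ) * S') = (Real.exp (β * ω) : ℂ) * (-1 * S') :=
    fun S' => by ring
  rw [h4, ← h1, ← spectralSum_const_mul, ← spectralSum_sub _ (hcut a b ω)]
  · congr 1
    ext Ω
    split_ifs with h
    · have hne : ω - Ω ≠ 0 := by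
        intro h0
        rw [abs_sub_comm, h0, abs_zero] at h
        exact lt_asymm h hr
      have hne' : (ω : ℂ) - Ω ≠ 0 := by exact_mod_cast hne
      have he : Real.exp (β * (ω - Ω)) = Real.exp (β * ω) * Real.exp (-β * Ω) := by
        rw [← Real.exp_add]; ring_nf
      rw [expQuot_of_ne β hne, he]
      push_cast
      field_simp
    · simp
  · have := (hcut b a (-ω)).mul_left (-(Real.exp (β * ω) : ℂ))
    rw [← (Equiv.prodComm κ κ).summable_iff] at this
    refine this.congr fun p => ?_
    have h3 := B.spectralTerm_exp_mul (β := β) a b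
      (fun Ω => if r < |Ω - ω| then 1 / ((ω : ℂ) - Ω) else 0) p
    rw [h2] at h3
    simp only [Function.comp, Equiv.prodComm_apply]
    simp only [spectralTerm] at h3 ⊢
    linear_combination (-(Real.exp (β * ω) : ℂ)) * h3

theorem IsThermal.summable_kernelD (hB : B.IsThermal β) (hβ : 0 < β) (a b : ι) (ω ω' : ℝ) :
    Summable (B.spectralTerm β a b (fun Ω => (kernelD β ω ω' Ω : ℂ))) := by
  refine hB.summable_spectralTerm
    (c := β * (β * (Real.exp (β * |ω - ω'|) * (1 + Real.exp (β * ω)))) / expQuot β (ω - ω'))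
    a b fun Ω => ?_
  rw [Complex.norm_real, Real.norm_eq_abs]
  exact abs_kernelD_le hβ ω ω' Ω

/-- The integral of the kernel, in terms of the two pole-free integrals into which it splits. -/
theorem lambCombination_of_expQuot {β : ℝ} (hβ : 0 < β) {ω ω' : ℝ} (h : ω ≠ ω')
    {T T' s₁ s₂ s₃ s₄ : ℂ}
    (hT : T = -(Real.exp (β * ω) * s₄) - s₂) (hT' : T' = -(Real.exp (β * ω') * s₃) - s₁) :
    (Real.exp (β * ω') * T - Real.exp (β * ω) * T') /
      ((Real.exp (β * ω) - Real.exp (β * ω') : ℝ) : ℂ) = lambCombination β ω ω' s₁ s₂ s₃ s₄ := by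
  have hd : ((Real.exp (β * ω) - Real.exp (β * ω') : ℝ) : ℂ) ≠ 0 := by
    rw [Complex.ofReal_ne_zero, sub_ne_zero, Ne, Real.exp_eq_exp]
    exact fun h' => h (mul_left_cancel₀ hβ.ne' h')
  rw [lambCombination, mul_add β, Real.exp_add, hT, hT']
  generalize ((Real.exp (β * ω) - Real.exp (β * ω') : ℝ) : ℂ) = d at *
  field_simp
  push_cast
  ring

theorem IsThermal.spectralSum_kernelD (hB : B.IsThermal β) (hβ : 0 < β) {a b : ι} {ω ω' : ℝ}
    {s₁ s₂ s₃ s₄ : ℂ} (h : ω ≠ ω') (hω : B.NoAtom β a b ω) (hω' : B.NoAtom β a b ω')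
    (h₁ : B.HasLambShift β a b ω' s₁) (h₂ : B.HasLambShift β a b ω s₂)
    (h₃ : B.HasLambShift β b a (-ω') s₃) (h₄ : B.HasLambShift β b a (-ω) s₄) :
    B.spectralSum β a b (fun Ω => (kernelD β ω ω' Ω : ℂ)) =
      lambCombination β ω ω' s₁ s₂ s₃ s₄ := by
  rw [← lambCombination_of_expQuot hβ h (hB.spectralSum_expQuot hβ hω h₂ h₄)
    (hB.spectralSum_expQuot hβ hω' h₁ h₃)]
  have hs : ∀ ω, Summable (B.spectralTerm β a b (fun Ω => (expQuot β (ω - Ω) : ℂ))) :=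
    fun ω => hB.summable_spectralTerm a b (norm_expQuot_sub_le hβ ω)
  have hc : ∀ (c : ℂ) ω,
      Summable (B.spectralTerm β a b (fun Ω => c * (expQuot β (ω - Ω) : ℂ))) := fun c ω =>
    ((hs ω).mul_left c).congr fun p => by simp only [spectralTerm]; ring
  rw [div_eq_inv_mul, ← spectralSum_const_mul, ← spectralSum_const_mul,
    ← spectralSum_sub (hc _ _) (hc _ _), ← spectralSum_const_mul]
  congr 1
  ext Ω
  rw [kernelD_eq_sub hβ h]
  push_cast
  ring

end Bath

/-! ### Fourier analysis on the real line -/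

/-- The Fourier integral `∫ e^{ixs} f(s) ds`, in the normalization of the spectral density. -/
noncomputable def fourierInt (f : ℝ → ℂ) (x : ℝ) : ℂ := ∫ s : ℝ, Complex.exp (Complex.I * x * s) * f s

theorem specDensity_eq {ι : Type*} (C : ι → ι → ℝ → ℂ) (a b : ι) :
    specDensity C a b = fourierInt (C a b) := rfl

theorem norm_exp_I_mul (x s : ℝ) : ‖Complex.exp (Complex.I * x * s)‖ = 1 := by
  rw [show Complex.I * (x : ℂ) * s = ((x * s : ℝ) : ℂ) * Complex.I by push_cast; ring,
    Complex.norm_exp_ofReal_mul_I]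

theorem norm_exp_neg_I_mul (x s : ℝ) : ‖Complex.exp (-(Complex.I * x * s))‖ = 1 := by
  rw [show -(Complex.I * (x : ℂ) * s) = ((-(x * s) : ℝ) : ℂ) * Complex.I by push_cast; ring,
    Complex.norm_exp_ofReal_mul_I]

open scoped FourierTransform in
/-- Comparison with Mathlib's normalization of the Fourier transform. -/
theorem fourierInt_two_pi_mul (f : ℝ → ℂ) (ξ : ℝ) :
    fourierInt f (2 * Real.pi * ξ) = 𝓕⁻ f ξ := by
  rw [Real.fourierInv_eq', fourierInt]
  congr 1
  ext s
  rw [smul_eq_mul]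
  congr 2
  simp
  ring

theorem norm_fourierInt_le (f : ℝ → ℂ) (x : ℝ) : ‖fourierInt f x‖ ≤ ∫ s, ‖f s‖ := by
  refine (norm_integral_le_integral_norm _).trans (le_of_eq ?_)
  congr 1
  ext s
  rw [norm_mul, norm_exp_I_mul, one_mul]

theorem continuous_fourierInt {f : ℝ → ℂ} (hf : Integrable f) : Continuous (fourierInt f) := by
  unfold fourierInt
  refine continuous_of_dominated (bound := fun s => ‖f s‖) (fun x => ?_) (fun x => ?_) hf.norm ?_
  · exact (Continuous.aestronglyMeasurable (by fun_prop)).mul hf.aestronglyMeasurable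
  · exact Eventually.of_forall fun s => by rw [norm_mul, norm_exp_I_mul, one_mul]
  · exact Eventually.of_forall fun s => by fun_prop

open scoped FourierTransform in
/-- Fourier inversion. -/
theorem eq_integral_fourierInt {f : ℝ → ℂ} (hc : Continuous f) (hf : Integrable f)
    (hg : Integrable (fourierInt f)) (s : ℝ) :
    f s = 1 / (2 * Real.pi) * ∫ x : ℝ, Complex.exp (-(Complex.I * x * s)) * fourierInt f x := by
  have hpi : (2 * Real.pi) ≠ 0 := by positivity
  have hinv : 𝓕⁻ f = fun ξ => fourierInt f (2 * Real.pi * ξ) :=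
    funext fun ξ => (fourierInt_two_pi_mul f ξ).symm
  have hi : Integrable (𝓕⁻ f) := by
    rw [hinv]
    exact hg.comp_mul_left' hpi
  have hi' : Integrable (𝓕 f) := by
    refine hi.comp_neg.congr (Eventually.of_forall fun ξ => ?_)
    simp only [Real.fourierInv_eq_fourier_neg, neg_neg]
  have h := congrFun (hc.fourier_fourierInv_eq hf hi') s
  rw [← h, Real.fourier_eq', hinv]
  have := Measure.integral_comp_mul_left
    (fun x : ℝ => Complex.exp (-(Complex.I * x * s)) * fourierInt f x) (2 * Real.pi)
  rw [show ((1 : ℂ) / (2 * Real.pi)) = (((2 * Real.pi)⁻¹ : ℝ) : ℂ) by push_cast; ring,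
    ← Complex.real_smul, ← abs_of_pos (show 0 < (2 * Real.pi)⁻¹ by positivity), ← this]
  congr 1
  ext x
  rw [smul_eq_mul]
  congr 2
  simp
  ring

open scoped FourierTransform in
theorem integrable_fourierInt_of_contDiff {f : ℝ → ℂ} (hc : HasCompactSupport f)
    (hf : ContDiff ℝ (⊤ : ℕ∞) f) : Integrable (fourierInt f) := by
  have h : Integrable (𝓕⁻ (hc.toSchwartzMap hf) : SchwartzMap ℝ ℂ) := SchwartzMap.integrable _
  have h2 : ((𝓕⁻ (hc.toSchwartzMap hf) : SchwartzMap ℝ ℂ) : ℝ → ℂ) =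
      fun ξ => fourierInt f (2 * Real.pi * ξ) := by
    rw [SchwartzMap.fourierInv_coe]
    ext ξ
    rw [fourierInt_two_pi_mul]
    rfl
  rw [h2] at h
  exact (integrable_comp_mul_left_iff _ (by positivity)).1 h

/-- Parseval's identity for a Fourier integral. -/
theorem integral_fourierInt_mul {f g : ℝ → ℂ} (hf : Integrable f) (hg : Integrable g) :
    ∫ t, fourierInt f t * g t = ∫ x, f x * fourierInt g x := by
  unfold fourierInt
  simp only [← integral_mul_const, ← integral_const_mul]
  rw [integral_integral_swap]
  · congr 1
    ext x
    congr 1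
    ext t
    rw [show Complex.I * (t : ℂ) * x = Complex.I * x * t by ring]
    ring
  · have h : Integrable (fun p : ℝ × ℝ => g p.1 * f p.2) (volume.prod volume) := hg.mul_prod hf
    refine h.norm.mono' ?_ (Eventually.of_forall fun p => ?_)
    · have h1 : AEStronglyMeasurable (fun p : ℝ × ℝ => Complex.exp (Complex.I * p.1 * p.2))
        (volume.prod volume) := Continuous.aestronglyMeasurable (by fun_prop)
      refine (h1.mul h.aestronglyMeasurable).congr (Eventually.of_forall fun p => ?_)
      simp only [Function.uncurry, Pi.mul_apply]
      ring
    · simp only [Function.uncurry, norm_mul, norm_exp_I_mul]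
      rw [one_mul, mul_comm]

/-- A continuous function that is non-negative against all smooth non-negative test functions is
non-negative. -/
theorem nonneg_of_forall_integral_nonneg {g : ℝ → ℝ} (hg : Continuous g)
    (h : ∀ f : ℝ → ℝ, ContDiff ℝ (⊤ : ℕ∞) f → HasCompactSupport f → 0 ≤ f →
      0 ≤ ∫ x, f x * g x) (x : ℝ) : 0 ≤ g x := by
  by_contra! hx
  obtain ⟨ε, hε, hball⟩ := Metric.mem_nhds_iff.1 (hg.continuousAt.eventually (gt_mem_nhds hx))
  let φ : ContDiffBump x := ⟨ε / 4, ε / 2, by positivity, by linarith⟩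
  have h0 := h φ φ.contDiff φ.hasCompactSupport fun y => φ.nonneg
  have hneg : ∀ y, φ y * g y ≤ 0 := by
    intro y
    by_cases hy : y ∈ Metric.ball x ε
    · exact mul_nonpos_of_nonneg_of_nonpos φ.nonneg (le_of_lt (hball hy))
    · rw [φ.zero_of_le_dist, zero_mul]
      have : ε ≤ dist y x := not_lt.1 hy
      change ε / 2 ≤ _
      linarith
  have hlt : 0 < ∫ y, -(φ y * g y) := by
    refine Continuous.integral_pos_of_hasCompactSupport_nonneg_nonzero (x := x)
      (φ.continuous.mul hg).neg ?_ (fun y => neg_nonneg.2 (hneg y)) ?_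
    · exact (φ.hasCompactSupport.mul_right (f' := g)).neg
    · have : φ x = 1 := φ.one_of_mem_closedBall (Metric.mem_closedBall_self (by change 0 ≤ ε / 4; positivity))
      simp [this, hx.ne]
  rw [integral_neg] at hlt
  linarith

/-! ### Correlation functions of a bath -/

namespace Bath

variable {ι κ K : Type*} [NormedAddCommGroup K] [InnerProductSpace ℂ K] [CompleteSpace K]
  {B : Bath ι κ K} {β : ℝ}

/-- A family of positive numbers with finite sum is countable. -/
theorem IsThermal.countable (hB : B.IsThermal β) : Countable κ := by
  have h := Summable.countable_support hB
  rwa [show Function.support (fun k => Real.exp (-β * B.E k)) = Set.univ from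
    Set.eq_univ_of_forall fun k => (Real.exp_pos _).ne', Set.countable_univ_iff] at h

theorem IsThermal.hasSum_corr' (hB : B.IsThermal β) (a b : ι) (t : ℝ) :
    HasSum (fun p : κ × κ => B.spectralTerm β a b 1 p *
      Complex.exp (-(Complex.I * ((B.E p.2 - B.E p.1 : ℝ) : ℂ) * t))) (B.corr β a b t) := by
  refine (hB.hasSum_corr a b t).congr_fun fun p => ?_
  rw [B.spectralTerm_eq a b fun Ω => Complex.exp (-(Complex.I * Ω * t))]

/-- The total mass of the diagonal spectral measure is the autocorrelation function at time zero. -/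
theorem IsThermal.hasSum_mass (hB : B.IsThermal β) (a : ι) :
    HasSum (fun p => (B.spectralTerm β a a 1 p).re) (B.corr β a a 0).re := by
  have := Complex.hasSum_re (hB.hasSum_corr' a a 0)
  simpa using this

theorem IsThermal.tsum_norm_spectralTerm_le (hB : B.IsThermal β) (a b : ι) :
    ∑' p, ‖B.spectralTerm β a b 1 p‖ ≤ (B.corr β a a 0).re + (B.corr β b b 0).re := by
  rw [← (hB.hasSum_mass a).tsum_eq, ← (hB.hasSum_mass b).tsum_eq,
    ← (hB.hasSum_mass a).summable.tsum_add (hB.hasSum_mass b).summable]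
  exact (hB.summable_norm_spectralTerm_one a b).tsum_le_tsum (B.norm_spectralTerm_one_le a b)
    ((hB.hasSum_mass a).summable.add (hB.hasSum_mass b).summable)

theorem IsThermal.tsum_majorant_le (hB : B.IsThermal β) (a b : ι) :
    ∑' p, B.majorant β a b p ≤ 2 * ((B.corr β a a 0).re + (B.corr β b b 0).re) := by
  have h1 := hB.tsum_norm_spectralTerm_le a b
  have h2 := hB.tsum_norm_spectralTerm_le b a
  have h3 : ∑' p : κ × κ, ‖B.spectralTerm β b a 1 p.swap‖ = ∑' p, ‖B.spectralTerm β b a 1 p‖ :=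
    (Equiv.prodComm κ κ).tsum_eq fun p => ‖B.spectralTerm β b a 1 p‖
  have h4 : Summable fun p : κ × κ => ‖B.spectralTerm β b a 1 p.swap‖ :=
    (Equiv.prodComm κ κ).summable_iff.2 (hB.summable_norm_spectralTerm_one b a)
  unfold majorant
  rw [(hB.summable_norm_spectralTerm_one a b).tsum_add h4, h3]
  linarith

theorem IsThermal.norm_corr_le (hB : B.IsThermal β) (a b : ι) (t : ℝ) :
    ‖B.corr β a b t‖ ≤ (B.corr β a a 0).re + (B.corr β b b 0).re := by
  refine le_trans ?_ (hB.tsum_norm_spectralTerm_le a b)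
  refine (hB.hasSum_corr' a b t).norm_le_of_bounded
    (hB.summable_norm_spectralTerm_one a b).hasSum fun p => ?_
  rw [norm_mul, norm_exp_neg_I_mul, mul_one]

theorem IsThermal.continuous_corr (hB : B.IsThermal β) (a b : ι) :
    Continuous (B.corr β a b) := by
  rw [show B.corr β a b = fun t : ℝ => ∑' p : κ × κ, B.spectralTerm β a b 1 p *
    Complex.exp (-(Complex.I * ((B.E p.2 - B.E p.1 : ℝ) : ℂ) * t)) from
    funext fun t => (hB.hasSum_corr' a b t).tsum_eq.symm]
  refine continuous_tsum (fun p => by fun_prop) (hB.summable_norm_spectralTerm_one a b)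
    fun p t => ?_
  rw [norm_mul, norm_exp_neg_I_mul, mul_one]

theorem IsThermal.conj_corr (hB : B.IsThermal β) (a b : ι) (t : ℝ) :
    (starRingEnd ℂ) (B.corr β b a t) = B.corr β a b (-t) := by
  refine (Complex.hasSum_conj'.2 (hB.hasSum_corr b a t)).unique
    ((hB.hasSum_corr a b (-t)).congr_fun fun p => ?_)
  simp only [spectralTerm, map_mul, inner_R_conj, Complex.conj_ofReal, ← Complex.exp_conj, map_neg,
    Complex.conj_I]
  rw [show -(-Complex.I * ((B.E p.2 - B.E p.1 : ℝ) : ℂ) * (t : ℂ)) =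
    -(Complex.I * ((B.E p.2 - B.E p.1 : ℝ) : ℂ) * ((-t : ℝ) : ℂ)) by push_cast; ring]
  ring

/-- Parseval's identity for a bath: the spectral sum of a function is the integral of its inverse
Fourier transform against the autocorrelation function. -/
theorem IsThermal.spectralSum_eq_integral_corr (hB : B.IsThermal β) (a b : ι) {f ψ : ℝ → ℂ}
    (hψ : Integrable ψ)
    (hf : ∀ Ω : ℝ, f Ω = ∫ t : ℝ, Complex.exp (-(Complex.I * Ω * t)) * ψ t) :
    B.spectralSum β a b f = ∫ t, ψ t * B.corr β a b t := by
  have := hB.countable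
  have hint : ∀ p : κ × κ, Integrable fun t : ℝ => ψ t * (B.spectralTerm β a b 1 p *
      Complex.exp (-(Complex.I * ((B.E p.2 - B.E p.1 : ℝ) : ℂ) * t))) := by
    intro p
    refine hψ.mul_bdd (c := ‖B.spectralTerm β a b 1 p‖)
      (Continuous.aestronglyMeasurable (by fun_prop)) (Eventually.of_forall fun t => ?_)
    rw [norm_mul, norm_exp_neg_I_mul, mul_one]
  have h := hasSum_integral_of_summable_integral_norm hint ?_
  · simp only [tsum_mul_left, (hB.hasSum_corr' a b _).tsum_eq] at h
    rw [← h.tsum_eq, spectralSum]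
    refine tsum_congr fun p => ?_
    rw [spectralTerm_eq, hf, ← integral_const_mul]
    congr 1
    ext t
    ring
  · simp only [norm_mul, norm_exp_neg_I_mul, mul_one, integral_mul_const]
    exact (hB.summable_norm_spectralTerm_one a b).mul_left _

/-- Spectral sums are bounded by the thermally weighted sup norm of the function, with a constant
that depends on the bath only through its autocorrelation functions at time zero. -/
theorem IsThermal.norm_spectralSum_le (hB : B.IsThermal β) (a b : ι) {f : ℝ → ℂ} {c : ℝ}
    (hc : 0 ≤ c) (hf : ∀ Ω, ‖f Ω‖ ≤ c * (1 + Real.exp (-β * Ω))) :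
    ‖B.spectralSum β a b f‖ ≤ c * (2 * ((B.corr β a a 0).re + (B.corr β b b 0).re)) := by
  refine (tsum_of_norm_bounded ((hB.summable_majorant a b).mul_left c).hasSum
    fun p => B.norm_spectralTerm_le a b p (hf _)).trans ?_
  rw [tsum_mul_left]
  exact mul_le_mul_of_nonneg_left (hB.tsum_majorant_le a b) hc

theorem IsThermal.hasSum_re_spectralSum_self (hB : B.IsThermal β) (a : ι) {f : ℝ → ℝ} {c : ℝ}
    (hf : ∀ Ω, |f Ω| ≤ c) :
    HasSum (fun p : κ × κ => (B.spectralTerm β a a 1 p).re * f (B.E p.2 - B.E p.1))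
      (B.spectralSum β a a (fun Ω => (f Ω : ℂ))).re := by
  have hs : Summable (B.spectralTerm β a a (fun Ω => (f Ω : ℂ))) :=
    hB.summable_spectralTerm_of_bounded (c := c) a a fun Ω => by
      rw [Complex.norm_real]; exact hf Ω
  refine (Complex.hasSum_re hs.hasSum).congr_fun fun p => ?_
  rw [B.spectralTerm_eq a a fun Ω => (f Ω : ℂ), Complex.re_mul_ofReal]

/-- Positivity of the matrix of spectral measures: the spectral sum of a non-negative function is
bounded by the diagonal ones. -/
theorem IsThermal.norm_spectralSum_le_add (hB : B.IsThermal β) (a b : ι) {f : ℝ → ℝ} {c : ℝ}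
    (hf0 : 0 ≤ f) (hf : ∀ Ω, |f Ω| ≤ c) :
    ‖B.spectralSum β a b (fun Ω => (f Ω : ℂ))‖ ≤
      (B.spectralSum β a a (fun Ω => (f Ω : ℂ))).re +
      (B.spectralSum β b b (fun Ω => (f Ω : ℂ))).re := by
  refine tsum_of_norm_bounded ((hB.hasSum_re_spectralSum_self a hf).add
    (hB.hasSum_re_spectralSum_self b hf)) fun p => ?_
  rw [spectralTerm_eq, norm_mul, Complex.norm_real, Real.norm_of_nonneg (hf0 _), ← add_mul]
  exact mul_le_mul_of_nonneg_right (B.norm_spectralTerm_one_le a b p) (hf0 _)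

theorem IsThermal.re_spectralSum_self_le (hB : B.IsThermal β) (a : ι) {f : ℝ → ℝ}
    (hf0 : 0 ≤ f) (hf : ∀ Ω, f Ω ≤ 1) :
    (B.spectralSum β a a (fun Ω => (f Ω : ℂ))).re ≤ (B.corr β a a 0).re := by
  refine hasSum_le (fun p => ?_) (hB.hasSum_re_spectralSum_self a (c := 1)
    fun Ω => by rw [abs_of_nonneg (hf0 Ω)]; exact hf Ω) (hB.hasSum_mass a)
  exact mul_le_of_le_one_right (B.spectralTerm_self_re_nonneg a p) (hf _)

end Bath

/-! ### Limits of Gibbs baths -/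

section GibbsLimit

variable {ι : Type*} {κ K : ℕ → Type*} [∀ N, NormedAddCommGroup (K N)]
  [∀ N, InnerProductSpace ℂ (K N)] [∀ N, CompleteSpace (K N)]

/-- The autocorrelation functions of the Gibbs baths `B N` converge pointwise to continuous and
integrable functions `C a b`. -/
structure IsGibbsLimit (β : ℝ) (B : ∀ N, Bath ι (κ N) (K N)) (C : ι → ι → ℝ → ℂ) : Prop where
  thermal : ∀ N, (B N).IsThermal β
  tendsto : ∀ a b t, Tendsto (fun N => (B N).corr β a b t) atTop (𝓝 (C a b t))
  cont : ∀ a b, Continuous (C a b)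
  integrable : ∀ a b, Integrable (C a b)

namespace IsGibbsLimit

variable {β : ℝ} {B : ∀ N, Bath ι (κ N) (K N)} {C : ι → ι → ℝ → ℂ}

theorem conj_corr (h : IsGibbsLimit β B C) (a b : ι) (t : ℝ) :
    (starRingEnd ℂ) (C b a t) = C a b (-t) := by
  refine tendsto_nhds_unique
    ((Complex.continuous_conj.tendsto _).comp (h.tendsto b a t)) ?_
  refine (h.tendsto a b (-t)).congr fun N => ?_
  exact ((h.thermal N).conj_corr a b t).symm

theorem continuous_specDensity (h : IsGibbsLimit β B C) (a b : ι) :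
    Continuous (specDensity C a b) :=
  continuous_fourierInt (h.integrable a b)

theorem conj_specDensity (h : IsGibbsLimit β B C) (a b : ι) (Ω : ℝ) :
    (starRingEnd ℂ) (specDensity C b a Ω) = specDensity C a b Ω := by
  unfold specDensity
  rw [← integral_conj, ← integral_neg_eq_self]
  congr 1
  ext s
  rw [map_mul, h.conj_corr, ← Complex.exp_conj, neg_neg]
  simp

/-- The total masses of the spectral measures of the baths are bounded, because they converge. -/
theorem exists_mass_le (h : IsGibbsLimit β B C) (a b : ι) :
    ∃ M : ℝ, 0 ≤ M ∧ ∀ N, ((B N).corr β a a 0).re + ((B N).corr β b b 0).re ≤ M := by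
  have h1 : Tendsto (fun N => ((B N).corr β a a 0).re + ((B N).corr β b b 0).re) atTop
      (𝓝 ((C a a 0).re + (C b b 0).re)) :=
    ((Complex.continuous_re.tendsto _).comp (h.tendsto a a 0)).add
      ((Complex.continuous_re.tendsto _).comp (h.tendsto b b 0))
  obtain ⟨M, hM⟩ := h1.bddAbove_range
  have hM' : ∀ N, _ ≤ M := fun N => hM ⟨N, rfl⟩
  exact ⟨M, (norm_nonneg _).trans (((h.thermal 0).norm_corr_le a b 0).trans (hM' 0)), hM'⟩

/-- Spectral sums of test functions converge to the integral against the spectral density of the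
reservoir. -/
theorem tendsto_spectralSum_contDiff (h : IsGibbsLimit β B C) (a b : ι) {f : ℝ → ℂ}
    (hc : HasCompactSupport f) (hf : ContDiff ℝ (⊤ : ℕ∞) f) :
    Tendsto (fun N => (B N).spectralSum β a b f) atTop
      (𝓝 (1 / (2 * Real.pi) * ∫ Ω, f Ω * specDensity C a b Ω)) := by
  have hfi : Integrable f := hf.continuous.integrable_of_hasCompactSupport hc
  have hgi := integrable_fourierInt_of_contDiff hc hf
  set ψ : ℝ → ℂ := fun t => 1 / (2 * Real.pi) * fourierInt f t with hψ
  have hψi : Integrable ψ := hgi.const_mul _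
  have hrep : ∀ Ω : ℝ, f Ω = ∫ t : ℝ, Complex.exp (-(Complex.I * Ω * t)) * ψ t := by
    intro Ω
    rw [eq_integral_fourierInt hf.continuous hfi hgi Ω, ← integral_const_mul]
    congr 1
    ext t
    rw [hψ, show Complex.I * (t : ℂ) * Ω = Complex.I * Ω * t by ring]
    ring
  -- Both sides are integrals of `ψ` against an autocorrelation function.
  have hlim : 1 / (2 * Real.pi) * ∫ Ω, f Ω * specDensity C a b Ω = ∫ t, ψ t * C a b t := by
    rw [specDensity_eq, ← integral_fourierInt_mul hfi (h.integrable a b), ← integral_const_mul]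
    congr 1
    ext t
    rw [hψ]
    ring
  rw [hlim]
  simp only [fun N => (h.thermal N).spectralSum_eq_integral_corr a b hψi hrep]
  obtain ⟨M, hM0, hM⟩ := h.exists_mass_le a b
  refine tendsto_integral_of_dominated_convergence (fun t => ‖ψ t‖ * M) (fun N => ?_)
    (hψi.norm.mul_const M) (fun N => ?_) ?_
  · exact hψi.aestronglyMeasurable.mul
      ((h.thermal N).continuous_corr a b).aestronglyMeasurable
  · refine Eventually.of_forall fun t => ?_
    rw [norm_mul]
    exact mul_le_mul_of_nonneg_left (((h.thermal N).norm_corr_le a b t).trans (hM N))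
      (norm_nonneg _)
  · exact Eventually.of_forall fun t => (h.tendsto a b t).const_mul _

theorem tendsto_spectralSum_real (h : IsGibbsLimit β B C) (a b : ι) {f : ℝ → ℝ}
    (hc : HasCompactSupport f) (hf : ContDiff ℝ (⊤ : ℕ∞) f) :
    Tendsto (fun N => (B N).spectralSum β a b (fun Ω => (f Ω : ℂ))) atTop
      (𝓝 (1 / (2 * Real.pi) * ∫ Ω, (f Ω : ℂ) * specDensity C a b Ω)) :=
  h.tendsto_spectralSum_contDiff a b (hc.comp_left (g := Complex.ofReal) rfl)
    (Complex.ofRealCLM.contDiff.comp hf)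

/-- The KMS condition for the spectral density of the reservoir. -/
theorem kms (h : IsGibbsLimit β B C) (a b : ι) (Ω : ℝ) :
    specDensity C b a (-Ω) = (Real.exp (-β * Ω) : ℂ) * specDensity C a b Ω := by
  have hcont : Continuous fun Ω : ℝ => (Real.exp (-β * Ω) : ℂ) * specDensity C a b Ω := by
    have := h.continuous_specDensity a b
    fun_prop
  have hcont' : Continuous fun Ω : ℝ => specDensity C b a (-Ω) :=
    (h.continuous_specDensity b a).comp continuous_neg
  -- Two continuous functions agree if they agree as distributions.
  refine congrFun (Continuous.ae_eq_iff_eq (volume : Measure ℝ) hcont' hcont |>.1 ?_) Ω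
  refine ae_eq_of_integral_contDiff_smul_eq hcont'.locallyIntegrable hcont.locallyIntegrable
    fun f hf hfc => ?_
  have hf1 : ContDiff ℝ (⊤ : ℕ∞) fun Ω => Real.exp (-β * Ω) * f Ω :=
    (Real.contDiff_exp.comp (contDiff_const.mul contDiff_id)).mul hf
  have hf2 : ContDiff ℝ (⊤ : ℕ∞) fun Ω => f (-Ω) := hf.comp contDiff_neg
  have t1 := h.tendsto_spectralSum_real a b (hfc.mul_left (f := fun Ω => Real.exp (-β * Ω))) hf1
  have t2 := h.tendsto_spectralSum_real b a
    (hfc.comp_homeomorph (Homeomorph.neg ℝ)) hf2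
  have heq : ∀ N, (B N).spectralSum β a b
      (fun Ω => (((fun Ω => Real.exp (-β * Ω)) * f) Ω : ℂ)) =
      (B N).spectralSum β b a (fun Ω => ((f ∘ Homeomorph.neg ℝ) Ω : ℂ)) := by
    intro N
    have := (B N).spectralSum_exp_mul (β := β) a b (fun Ω => (f Ω : ℂ))
    simpa using this
  have key := tendsto_nhds_unique t1 (t2.congr fun N => (heq N).symm)
  have hpi : (1 / (2 * (Real.pi : ℂ))) ≠ 0 := by
    have : (Real.pi : ℂ) ≠ 0 := by exact_mod_cast Real.pi_ne_zero
    simp [this]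
  have key := mul_left_cancel₀ hpi key
  rw [← integral_neg_eq_self] at key
  have e1 : ∫ x, f x • specDensity C b a (-x) =
      ∫ x, ((f ∘ Homeomorph.neg ℝ) x : ℂ) * specDensity C b a x := by
    rw [← integral_neg_eq_self (fun x => f x • _)]
    congr 1
    ext x
    simp
  rw [e1, ← key, ← integral_neg_eq_self]
  congr 1
  ext x
  simp
  ring

/-- A real-valued form of `tendsto_spectralSum_contDiff`, in which inequalities between spectral
sums pass to the limit. -/
theorem tendsto_re_mul_spectralSum (h : IsGibbsLimit β B C) (a b : ι) {f : ℝ → ℝ}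
    (hc : HasCompactSupport f) (hf : ContDiff ℝ (⊤ : ℕ∞) f) (z : ℂ) :
    Tendsto (fun N => (z * (B N).spectralSum β a b (fun Ω => (f Ω : ℂ))).re) atTop
      (𝓝 ((2 * Real.pi)⁻¹ * ∫ Ω, f Ω * (z * specDensity C a b Ω).re)) := by
  have hint : Integrable fun Ω => z * ((f Ω : ℂ) * specDensity C a b Ω) :=
    (Continuous.integrable_of_hasCompactSupport
      ((Complex.continuous_ofReal.comp hf.continuous).mul (h.continuous_specDensity a b))
      ((hc.comp_left (g := Complex.ofReal) rfl).mul_right)).const_mul z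
  have hlim := (Complex.continuous_re.tendsto _).comp
    ((h.tendsto_spectralSum_real a b hc hf).const_mul z)
  refine Eq.subst (motive := fun w => Tendsto _ _ (𝓝 w)) ?_ hlim
  rw [mul_left_comm,
    show (1 / (2 * Real.pi) : ℂ) = (((2 * Real.pi)⁻¹ : ℝ) : ℂ) by push_cast; ring,
    Complex.re_ofReal_mul]
  congr 1
  rw [← integral_const_mul]
  refine (integral_re hint).symm.trans ?_
  congr 1
  ext Ω
  change (z * ((f Ω : ℂ) * specDensity C a b Ω)).re = _
  rw [mul_left_comm, Complex.re_ofReal_mul]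

/-- Positivity of the matrix of spectral densities, obtained in the limit from that of the spectral
measures of the baths, tested against smooth functions. -/
theorem re_mul_specDensity_le (h : IsGibbsLimit β B C) (a b : ι) {z : ℂ} (hz : ‖z‖ ≤ 1)
    (Ω : ℝ) :
    (z * specDensity C a b Ω).re ≤ (specDensity C a a Ω).re + (specDensity C b b Ω).re := by
  have hca := h.continuous_specDensity a a
  have hcb := h.continuous_specDensity b b
  have hcab := h.continuous_specDensity a b
  rw [← sub_nonneg]
  refine nonneg_of_forall_integral_nonneg (g := fun Ω =>
    (specDensity C a a Ω).re + (specDensity C b b Ω).re - (z * specDensity C a b Ω).re)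
    (by fun_prop) (fun f hf hc hf0 => ?_) Ω
  have hlim := ((h.tendsto_re_mul_spectralSum a a hc hf 1).add
    (h.tendsto_re_mul_spectralSum b b hc hf 1)).sub
    (h.tendsto_re_mul_spectralSum a b hc hf z)
  have hint : ∀ g : ℝ → ℝ, Continuous g → Integrable fun Ω => f Ω * g Ω := fun g hg =>
    (hf.continuous.mul hg).integrable_of_hasCompactSupport hc.mul_right
  obtain ⟨c, hc'⟩ := hf.continuous.bounded_above_of_compact_support hc
  have hnn := ge_of_tendsto hlim (b := 0) (Eventually.of_forall fun N => ?_)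
  · simp only [one_mul] at hnn
    rw [← mul_add, ← mul_sub] at hnn
    have h2 := nonneg_of_mul_nonneg_right hnn (by positivity)
    have i1 := hint (fun Ω => (specDensity C a a Ω).re) (by fun_prop)
    have i2 := hint (fun Ω => (specDensity C b b Ω).re) (by fun_prop)
    have i3 := hint (fun Ω => (z * specDensity C a b Ω).re) (by fun_prop)
    simp only [mul_sub, mul_add]
    have i4 : Integrable fun Ω =>
      f Ω * (specDensity C a a Ω).re + f Ω * (specDensity C b b Ω).re := i1.add i2
    rw [integral_sub i4 i3, integral_add i1 i2]
    exact h2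
  · have h1 := (h.thermal N).norm_spectralSum_le_add a b hf0 hc'
    have h2 := Complex.re_le_norm (z * (B N).spectralSum β a b (fun Ω => (f Ω : ℂ)))
    have h3 : ‖z * (B N).spectralSum β a b (fun Ω => (f Ω : ℂ))‖ ≤
        ‖(B N).spectralSum β a b (fun Ω => (f Ω : ℂ))‖ := by
      rw [norm_mul]
      exact mul_le_of_le_one_left (norm_nonneg _) hz
    simp only [one_mul]
    linarith

theorem re_specDensity_nonneg (h : IsGibbsLimit β B C) (a : ι) (Ω : ℝ) :
    0 ≤ (specDensity C a a Ω).re := by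
  have := h.re_mul_specDensity_le a a (z := 0) (by simp) Ω
  simp at this
  linarith

theorem norm_specDensity_le (h : IsGibbsLimit β B C) (a b : ι) (Ω : ℝ) :
    ‖specDensity C a b Ω‖ ≤ (specDensity C a a Ω).re + (specDensity C b b Ω).re := by
  set w := specDensity C a b Ω with hw
  have h1 := h.re_mul_specDensity_le a b (z := (starRingEnd ℂ) w / ‖w‖) (by
    rw [norm_div, RCLike.norm_conj, Complex.norm_real, norm_norm]
    exact div_self_le_one _) Ω
  refine le_trans (le_of_eq ?_) h1
  rw [← hw, div_mul_eq_mul_div, mul_comm, Complex.mul_conj, Complex.normSq_eq_norm_sq,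
    ← Complex.ofReal_div, Complex.ofReal_re]
  by_cases h0 : ‖w‖ = 0
  · simp [h0]
  · field_simp

/-- The diagonal spectral densities are non-negative, and their masses on bounded intervals are
limits of masses of the spectral measures of the baths, which are bounded by the autocorrelation
functions at time zero. That `C a a` is integrable would only give a bounded spectral density. -/
theorem integrable_re_specDensity (h : IsGibbsLimit β B C) (a : ι) :
    Integrable fun Ω => (specDensity C a a Ω).re := by
  have hca := h.continuous_specDensity a a
  have hcont : Continuous fun Ω => (specDensity C a a Ω).re := by fun_prop
  refine integrable_of_intervalIntegral_norm_bounded (l := atTop) (a := fun n : ℕ => -(n : ℝ))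
    (b := fun n : ℕ => (n : ℝ)) (2 * Real.pi * (C a a 0).re)
    (fun n => hcont.integrableOn_Ioc) (tendsto_neg_atTop_atBot.comp tendsto_natCast_atTop_atTop)
    tendsto_natCast_atTop_atTop (Eventually.of_forall fun n => ?_)
  let φ : ContDiffBump (0 : ℝ) := ⟨n + 1, n + 2, by positivity, by linarith⟩
  have hlim := h.tendsto_re_mul_spectralSum a a φ.hasCompactSupport φ.contDiff 1
  have hle := le_of_tendsto_of_tendsto hlim
    ((Complex.continuous_re.tendsto _).comp (h.tendsto a a 0)) (Eventually.of_forall fun N => by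
      simp only [one_mul]
      exact (h.thermal N).re_spectralSum_self_le a (fun Ω => φ.nonneg) (fun Ω => φ.le_one))
  simp only [one_mul] at hle
  rw [inv_mul_le_iff₀ (by positivity)] at hle
  refine le_trans ?_ hle
  rw [intervalIntegral.integral_of_le (by linarith [Nat.cast_nonneg (α := ℝ) n])]
  calc ∫ Ω in Set.Ioc (-(n : ℝ)) n, ‖(specDensity C a a Ω).re‖
      = ∫ Ω in Set.Ioc (-(n : ℝ)) n, φ Ω * (specDensity C a a Ω).re := by
        refine setIntegral_congr_fun measurableSet_Ioc fun Ω hΩ => ?_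
        have : φ Ω = 1 := φ.one_of_mem_closedBall (by
          rw [mem_closedBall_zero_iff, Real.norm_eq_abs]
          change |Ω| ≤ (n : ℝ) + 1
          rw [abs_le]
          constructor <;> linarith [hΩ.1, hΩ.2])
        simp only [this, one_mul, Real.norm_of_nonneg (h.re_specDensity_nonneg a Ω)]
    _ ≤ _ := by
        refine setIntegral_le_integral
          ((φ.continuous.mul hcont).integrable_of_hasCompactSupport φ.hasCompactSupport.mul_right)
          (Eventually.of_forall fun Ω => mul_nonneg φ.nonneg (h.re_specDensity_nonneg a Ω))

theorem integrable_specDensity (h : IsGibbsLimit β B C) (a b : ι) :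
    Integrable (specDensity C a b) :=
  ((h.integrable_re_specDensity a).add (h.integrable_re_specDensity b)).mono'
    (h.continuous_specDensity a b).aestronglyMeasurable
    (Eventually.of_forall fun Ω => h.norm_specDensity_le a b Ω)

/-- By the KMS condition, `e^{-βΩ} γ_{ab}(Ω)` is another spectral density, reflected. -/
theorem integrable_exp_mul_specDensity (h : IsGibbsLimit β B C) (a b : ι) :
    Integrable fun Ω : ℝ => (Real.exp (-β * Ω) : ℂ) * specDensity C a b Ω := by
  simp only [← h.kms]
  exact (h.integrable_specDensity b a).comp_neg

theorem integrable_one_add_exp_mul (h : IsGibbsLimit β B C) (a b : ι) :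
    Integrable fun Ω => (1 + Real.exp (-β * Ω)) * ‖specDensity C a b Ω‖ := by
  refine ((h.integrable_specDensity a b).norm.add
    (h.integrable_exp_mul_specDensity a b).norm).congr (Eventually.of_forall fun Ω => ?_)
  simp only [Pi.add_apply, norm_mul, Complex.norm_real, Real.norm_of_nonneg (Real.exp_pos _).le]
  ring

theorem integrable_mul_specDensity (h : IsGibbsLimit β B C) (a b : ι) {f : ℝ → ℂ} {c : ℝ}
    (hm : AEStronglyMeasurable f)
    (hf : ∀ Ω, ‖f Ω‖ ≤ c * (1 + Real.exp (-β * Ω))) :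
    Integrable fun Ω => f Ω * specDensity C a b Ω := by
  refine ((h.integrable_one_add_exp_mul a b).const_mul c).mono'
    (hm.mul (h.continuous_specDensity a b).aestronglyMeasurable)
    (Eventually.of_forall fun Ω => ?_)
  rw [norm_mul, ← mul_assoc]
  exact mul_le_mul_of_nonneg_right (hf Ω) (norm_nonneg _)

/-- Spectral sums of continuous functions that are `o(1 + e^{-βΩ})` converge to the integral
against the spectral density of the reservoir. -/
theorem tendsto_spectralSum (h : IsGibbsLimit β B C) (a b : ι) {f : ℝ → ℂ} (hf : Continuous f)
    (hdecay : ∀ ε > 0, ∃ M : ℝ, ∀ Ω, M ≤ |Ω| → ‖f Ω‖ ≤ ε * (1 + Real.exp (-β * Ω))) :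
    Tendsto (fun N => (B N).spectralSum β a b f) atTop
      (𝓝 (1 / (2 * Real.pi) * ∫ Ω, f Ω * specDensity C a b Ω)) := by
  obtain ⟨M, hM0, hM⟩ := h.exists_mass_le a b
  set J := ∫ Ω, (1 + Real.exp (-β * Ω)) * ‖specDensity C a b Ω‖ with hJ
  have hJ0 : 0 ≤ J := integral_nonneg fun Ω => by positivity
  -- In the thermally weighted sup norm, `f` is a limit of test functions. Both the spectral sums of
  -- the baths (uniformly) and the integral against the spectral density are continuous in this
  -- norm.
  have approx : ∀ ε > 0, ∃ g : ℝ → ℂ, ContDiff ℝ (⊤ : ℕ∞) g ∧ HasCompactSupport g ∧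
      ∀ Ω, ‖f Ω - g Ω‖ ≤ ε * (1 + Real.exp (-β * Ω)) := by
    intro ε hε
    obtain ⟨R, hR⟩ := hdecay (ε / 2) (by positivity)
    let φ : ContDiffBump (0 : ℝ) := ⟨|R| + 1, |R| + 2, by positivity, by linarith⟩
    have hφc : HasCompactSupport fun Ω => (φ Ω : ℂ) * f Ω :=
      (φ.hasCompactSupport.comp_left (g := Complex.ofReal) rfl).mul_right
    obtain ⟨g, hg, hgf, hsupp⟩ := Continuous.exists_contDiff_approx (f := fun Ω => (φ Ω : ℂ) * f Ω)
      ⊤ (ε := fun _ => ε / 2) ((Complex.continuous_ofReal.comp φ.continuous).mul hf)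
      continuous_const (fun _ => by positivity)
    refine ⟨g, hg, hφc.mono hsupp, fun Ω => ?_⟩
    have h1 : ‖f Ω - (φ Ω : ℂ) * f Ω‖ ≤ ε / 2 * (1 + Real.exp (-β * Ω)) := by
      rcases le_total R |Ω| with hΩ | hΩ
      · refine le_trans ?_ (hR Ω hΩ)
        rw [← one_sub_mul, norm_mul, ← Complex.ofReal_one, ← Complex.ofReal_sub,
          Complex.norm_real, Real.norm_of_nonneg (sub_nonneg.2 φ.le_one)]
        exact mul_le_of_le_one_left (norm_nonneg _) (by linarith [φ.nonneg (x := Ω)])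
      · have : φ Ω = 1 := φ.one_of_mem_closedBall (by
          rw [mem_closedBall_zero_iff, Real.norm_eq_abs]
          change |Ω| ≤ |R| + 1
          linarith [le_abs_self R])
        rw [this]
        simp only [Complex.ofReal_one, one_mul, sub_self, norm_zero]
        positivity
    have h2 : ‖(φ Ω : ℂ) * f Ω - g Ω‖ ≤ ε / 2 := by
      rw [← dist_eq_norm, dist_comm]
      exact (hgf Ω).le
    calc ‖f Ω - g Ω‖ ≤ ‖f Ω - (φ Ω : ℂ) * f Ω‖ + ‖(φ Ω : ℂ) * f Ω - g Ω‖ :=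
          norm_sub_le_norm_sub_add_norm_sub _ _ _
      _ ≤ ε / 2 * (1 + Real.exp (-β * Ω)) + ε / 2 := add_le_add h1 h2
      _ ≤ ε * (1 + Real.exp (-β * Ω)) := by nlinarith [Real.exp_pos (-β * Ω)]
  have hbound : ∀ g : ℝ → ℂ, Continuous g → HasCompactSupport g →
      ∃ c : ℝ, ∀ Ω, ‖g Ω‖ ≤ c * (1 + Real.exp (-β * Ω)) := by
    intro g hg hgc
    obtain ⟨c, hc⟩ := hg.bounded_above_of_compact_support hgc
    refine ⟨c, fun Ω => (hc Ω).trans ?_⟩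
    have := mul_nonneg ((norm_nonneg _).trans (hc Ω)) (Real.exp_pos (-β * Ω)).le
    linarith
  rw [Metric.tendsto_atTop]
  intro ε hε
  set δ := ε / (2 * (2 * M + J + 1)) with hδ
  have hδ0 : 0 < δ := by positivity
  obtain ⟨g, hg, hgc, hfg⟩ := approx δ hδ0
  obtain ⟨c, hc⟩ := hbound g hg.continuous hgc
  have hfc : ∀ Ω, ‖f Ω‖ ≤ (c + δ) * (1 + Real.exp (-β * Ω)) := fun Ω => by
    have := norm_sub_norm_le (f Ω) (g Ω)
    linarith [hc Ω, hfg Ω]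
  obtain ⟨N₀, hN₀⟩ := Metric.tendsto_atTop.1 (h.tendsto_spectralSum_contDiff a b hgc hg) (ε / 2)
    (by positivity)
  refine ⟨N₀, fun N hN => ?_⟩
  have e1 : ‖(B N).spectralSum β a b f - (B N).spectralSum β a b g‖ ≤ δ * (2 * M) := by
    rw [← Bath.spectralSum_sub ((h.thermal N).summable_spectralTerm a b hfc)
      ((h.thermal N).summable_spectralTerm a b hc)]
    refine ((h.thermal N).norm_spectralSum_le a b hδ0.le hfg).trans ?_
    have := hM N
    gcongr
  have e2 : ‖1 / (2 * Real.pi) * (∫ Ω, f Ω * specDensity C a b Ω) -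
      1 / (2 * Real.pi) * ∫ Ω, g Ω * specDensity C a b Ω‖ ≤ δ * J := by
    rw [← mul_sub, ← integral_sub
      (h.integrable_mul_specDensity a b hf.aestronglyMeasurable hfc)
      (h.integrable_mul_specDensity a b hg.continuous.aestronglyMeasurable hc), norm_mul]
    have h1 : ‖(1 / (2 * Real.pi) : ℂ)‖ ≤ 1 := by
      rw [show (1 / (2 * Real.pi) : ℂ) = (((2 * Real.pi)⁻¹ : ℝ) : ℂ) by push_cast; ring,
        Complex.norm_real, Real.norm_of_nonneg (by positivity)]
      exact inv_le_one_of_one_le₀ (by linarith [Real.pi_gt_three])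
    refine (mul_le_of_le_one_left (norm_nonneg _) h1).trans ?_
    rw [hJ, ← integral_const_mul]
    refine norm_integral_le_of_norm_le ((h.integrable_one_add_exp_mul a b).const_mul δ)
      (Eventually.of_forall fun Ω => ?_)
    rw [← sub_mul, norm_mul, ← mul_assoc]
    exact mul_le_mul_of_nonneg_right (hfg Ω) (norm_nonneg _)
  have e3 := hN₀ N hN
  rw [dist_eq_norm] at e3 ⊢
  have e4 : δ * (2 * M) + δ * J < ε / 2 := by
    have : δ * (2 * (2 * M + J + 1)) = ε := div_mul_cancel₀ _ (by positivity)
    nlinarith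
  have e5 := norm_sub_rev (1 / (2 * Real.pi) * (∫ Ω, f Ω * specDensity C a b Ω) : ℂ)
    (1 / (2 * Real.pi) * ∫ Ω, g Ω * specDensity C a b Ω)
  rw [e5] at e2
  calc _ ≤ ‖(B N).spectralSum β a b f - (B N).spectralSum β a b g‖ +
        ‖(B N).spectralSum β a b g - 1 / (2 * Real.pi) * ∫ Ω, g Ω * specDensity C a b Ω‖ +
        ‖1 / (2 * Real.pi) * (∫ Ω, g Ω * specDensity C a b Ω) -
          1 / (2 * Real.pi) * ∫ Ω, f Ω * specDensity C a b Ω‖ := by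
        refine le_trans (le_of_eq ?_) (norm_add₃_le)
        congr 1
        ring
    _ < ε := by linarith

end IsGibbsLimit

end GibbsLimit

/-! ### Principal values -/

/-- The difference between the sharply cut and the smoothly regularized kernel `1/z`. -/
noncomputable def cutDiff (z : ℝ) : ℝ := (if 1 < |z| then 1 / z else 0) - z / (1 + z ^ 2)

/-- The tails of `1/z` cancel, so that `cutDiff` is integrable. -/
theorem abs_cutDiff_le (z : ℝ) : |cutDiff z| ≤ (1 + z ^ 2)⁻¹ := by
  have h1 : 0 < 1 + z ^ 2 := by positivity
  unfold cutDiff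
  split_ifs with h
  · have hz : z ≠ 0 := by
      rintro rfl
      simp at h
      linarith
    have : 1 / z - z / (1 + z ^ 2) = (1 / z) * (1 + z ^ 2)⁻¹ := by
      field_simp
      ring
    rw [this, abs_mul, abs_of_pos (inv_pos.2 h1), abs_div, abs_one]
    refine mul_le_of_le_one_left (inv_pos.2 h1).le ?_
    rw [div_le_one (by linarith)]
    exact h.le
  · rw [zero_sub, abs_neg, abs_div, abs_of_pos h1, div_eq_mul_inv]
    exact mul_le_of_le_one_left (inv_pos.2 h1).le (not_lt.1 h)

theorem measurable_cutDiff : Measurable cutDiff := by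
  unfold cutDiff
  refine Measurable.sub (Measurable.ite ?_ (by fun_prop) measurable_const) (by fun_prop)
  exact measurableSet_lt measurable_const (by fun_prop)

/-- `cutDiff` is odd. -/
theorem integral_cutDiff_mul (c : ℂ) : ∫ z, c * (cutDiff z : ℂ) = 0 := by
  have h : ∀ z, cutDiff (-z) = -cutDiff z := by
    intro z
    simp only [cutDiff, abs_neg, neg_sq]
    split_ifs <;> ring
  have h2 := integral_neg_eq_self (fun z => c * (cutDiff z : ℂ)) volume
  simp only [h, Complex.ofReal_neg, mul_neg, integral_neg] at h2
  exact self_eq_neg.1 h2.symm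

/-- The rescaled odd kernel tests only the value of `g` at `ω`, and annihilates constants. -/
theorem tendsto_integral_cutDiff {g : ℝ → ℂ} (hg : Continuous g) {M : ℝ} (hM : ∀ x, ‖g x‖ ≤ M)
    (ω : ℝ) :
    Tendsto (fun r : ℝ => ∫ z, g (ω - r * z) * (cutDiff z : ℂ)) (𝓝[>] 0) (𝓝 0) := by
  rw [← integral_cutDiff_mul (g ω)]
  refine tendsto_integral_filter_of_dominated_convergence (fun z => M * (1 + z ^ 2)⁻¹)
    (Eventually.of_forall fun r => ?_) (Eventually.of_forall fun r => ?_)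
    (integrable_inv_one_add_sq.const_mul M) (Eventually.of_forall fun z => ?_)
  · have := measurable_cutDiff
    exact (Continuous.aestronglyMeasurable (by fun_prop)).mul
      (Complex.measurable_ofReal.comp measurable_cutDiff).aestronglyMeasurable
  · refine Eventually.of_forall fun z => ?_
    rw [norm_mul, Complex.norm_real]
    exact mul_le_mul (hM _) (abs_cutDiff_le z) (abs_nonneg _) ((norm_nonneg _).trans (hM 0))
  · refine Tendsto.mul_const _ ?_
    have : Tendsto (fun r : ℝ => g (ω - r * z)) (𝓝 0) (𝓝 (g (ω - 0 * z))) :=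
      Continuous.tendsto (by fun_prop) 0
    rw [zero_mul, sub_zero] at this
    exact this.mono_left nhdsWithin_le_nhds

/-- The principal value of `∫ g(x)/(ω-x) dx` may be computed with the smooth regularization
`y/(r²+y²)` of `1/y`: the difference to the sharp cut-off is the integral of `g` against an odd,
integrable kernel concentrating at `ω`. -/
theorem integral_cut_sub_integral_reg {g : ℝ → ℂ} (hg : Integrable g) (ω : ℝ) {r : ℝ}
    (hr : 0 < r) :
    (∫ x in {x : ℝ | r < |x - ω|}, g x / ((ω : ℂ) - x)) -
      ∫ x, g x * (((ω - x) / (r ^ 2 + (ω - x) ^ 2) : ℝ) : ℂ) =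
      ∫ z, g (ω - r * z) * (cutDiff z : ℂ) := by
  have hS : MeasurableSet {x : ℝ | r < |x - ω|} :=
    measurableSet_lt measurable_const (by fun_prop)
  rw [← integral_indicator hS]
  have hind : ∀ x, {x : ℝ | r < |x - ω|}.indicator (fun x => g x / ((ω : ℂ) - x)) x =
      g x * (((if r < |x - ω| then 1 / (ω - x) else 0) : ℝ) : ℂ) := by
    intro x
    rw [Set.indicator_apply]
    simp only [Set.mem_ofPred_eq]
    split_ifs
    · push_cast
      ring
    · simp
  simp only [hind]
  rw [← integral_sub]
  · have e1 := integral_sub_left_eq_self (fun x => g x * (((if r < |x - ω| then 1 / (ω - x) else 0)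
      : ℝ) : ℂ) - g x * (((ω - x) / (r ^ 2 + (ω - x) ^ 2) : ℝ) : ℂ)) volume ω
    have e2 := Measure.integral_comp_mul_left (fun y => g (ω - y) *
      (((if r < |ω - y - ω| then 1 / (ω - (ω - y)) else 0) : ℝ) : ℂ) -
      g (ω - y) * (((ω - (ω - y)) / (r ^ 2 + (ω - (ω - y)) ^ 2) : ℝ) : ℂ)) r
    have e3 := congrArg (fun w => r • w) e2
    simp only [abs_of_pos (inv_pos.2 hr), smul_smul, mul_inv_cancel₀ hr.ne', one_smul] at e3
    rw [← e1, ← e3, ← integral_smul]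
    congr 1
    ext z
    have hc : (r < |ω - r * z - ω|) ↔ 1 < |z| := by
      rw [show ω - r * z - ω = -(r * z) by ring, abs_neg, abs_mul, abs_of_pos hr]
      exact lt_mul_iff_one_lt_right hr
    simp only [hc, sub_sub_cancel]
    rw [← mul_sub, ← Complex.ofReal_sub, ← mul_smul_comm, Complex.real_smul, ← Complex.ofReal_mul]
    congr 2
    unfold cutDiff
    have : r * z / (r ^ 2 + (r * z) ^ 2) = (1 / r) * (z / (1 + z ^ 2)) := by
      field_simp
    rw [this]
    split_ifs
    · field_simp
    · field_simp
      ring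
  · refine hg.mul_bdd (c := 1 / r) ?_ (Eventually.of_forall fun x => ?_)
    · refine (Complex.measurable_ofReal.comp (Measurable.ite hS (by fun_prop)
        measurable_const)).aestronglyMeasurable
    · rw [Complex.norm_real]
      split_ifs with h
      · rw [norm_div, norm_one, Real.norm_eq_abs, abs_sub_comm]
        gcongr
      · rw [norm_zero]
        positivity
  · refine hg.mul_bdd (c := 1 / r) ?_ (Eventually.of_forall fun x => ?_)
    · refine (Complex.measurable_ofReal.comp ?_).aestronglyMeasurable
      fun_prop
    · rw [Complex.norm_real, Real.norm_eq_abs, abs_div, abs_of_pos (by positivity :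
        0 < r ^ 2 + (ω - x) ^ 2), div_le_div_iff₀ (by positivity) hr]
      nlinarith [sq_nonneg (r - |ω - x|), sq_abs (ω - x), abs_nonneg (ω - x)]

namespace IsGibbsLimit

variable {ι : Type*} {κ K : ℕ → Type*} [∀ N, NormedAddCommGroup (K N)]
  [∀ N, InnerProductSpace ℂ (K N)] [∀ N, CompleteSpace (K N)]
  {β : ℝ} {B : ∀ N, Bath ι (κ N) (K N)} {C : ι → ι → ℝ → ℂ}

/-- The half-sided Fourier transform, regularized by `e^{-εs}`. -/
theorem integral_Ioi_exp_mul (h : IsGibbsLimit β B C) (a b : ι) (ω : ℝ) {ε : ℝ} (hε : 0 < ε) :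
    ∫ s in Set.Ioi (0 : ℝ), Complex.exp (-(ε * s : ℝ)) * (Complex.exp (Complex.I * ω * s) * C a b s) =
      1 / (2 * Real.pi) * ∫ Ω : ℝ, specDensity C a b Ω * (1 / (ε - Complex.I * (ω - Ω))) := by
  have hinv : ∀ s : ℝ, C a b s = 1 / (2 * Real.pi) *
      ∫ x : ℝ, Complex.exp (-(Complex.I * x * s)) * specDensity C a b x :=
    eq_integral_fourierInt (h.cont a b) (h.integrable a b) (h.integrable_specDensity a b)
  simp only [hinv]
  have e1 : ∀ s : ℝ, Complex.exp (-(ε * s : ℝ)) * (Complex.exp (Complex.I * ω * s) *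
      (1 / (2 * Real.pi) * ∫ x : ℝ, Complex.exp (-(Complex.I * x * s)) * specDensity C a b x)) =
      1 / (2 * Real.pi) * ∫ x : ℝ, specDensity C a b x *
        Complex.exp ((-(ε : ℂ) + Complex.I * (ω - x)) * s) := by
    intro s
    rw [mul_left_comm (Complex.exp (Complex.I * ω * s)), mul_left_comm, ← integral_const_mul,
      ← integral_const_mul]
    congr 2
    ext x
    rw [show (-(ε : ℂ) + Complex.I * (ω - x)) * s = -(ε * s : ℝ) + (Complex.I * ω * s +
      -(Complex.I * x * s)) by push_cast; ring, Complex.exp_add, Complex.exp_add]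
    ring
  simp only [e1]
  rw [integral_const_mul, integral_integral_swap]
  · congr 2
    ext x
    rw [integral_const_mul, integral_exp_mul_complex_Ioi (by simp [hε])]
    congr 1
    rw [Complex.ofReal_zero, mul_zero, Complex.exp_zero,
      show -(ε : ℂ) + Complex.I * (ω - x) = -(ε - Complex.I * (ω - x)) by ring, neg_div_neg_eq]
  · have hi : IntegrableOn (fun s : ℝ => Real.exp (-ε * s)) (Set.Ioi 0) :=
      integrableOn_exp_mul_Ioi (by linarith) 0
    refine (Integrable.mul_prod hi (h.integrable_specDensity a b).norm).mono' ?_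
      (Eventually.of_forall fun p => ?_)
    · refine (((h.continuous_specDensity a b).comp continuous_snd).mul
        (by fun_prop)).aestronglyMeasurable
    · simp only [Function.uncurry, norm_mul, Complex.norm_exp]
      rw [mul_comm]
      refine mul_le_mul_of_nonneg_right (le_of_eq ?_) (norm_nonneg _)
      simp

theorem tendsto_integral_Ioi_exp_mul (h : IsGibbsLimit β B C) (a b : ι) (ω : ℝ) :
    Tendsto (fun ε : ℝ => ∫ s in Set.Ioi (0 : ℝ),
      Complex.exp (-(ε * s : ℝ)) * (Complex.exp (Complex.I * ω * s) * C a b s)) (𝓝[>] 0)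
      (𝓝 (halfFourier C a b ω)) := by
  have hc := h.cont a b
  refine tendsto_integral_filter_of_dominated_convergence (fun s => ‖C a b s‖)
    (Eventually.of_forall fun ε => Continuous.aestronglyMeasurable (by fun_prop)) ?_
    (h.integrable a b).norm.integrableOn (Eventually.of_forall fun s => ?_)
  · filter_upwards [self_mem_nhdsWithin] with ε hε
    refine (ae_restrict_mem measurableSet_Ioi).mono fun s hs => ?_
    rw [norm_mul, norm_mul, norm_exp_I_mul, one_mul, Complex.norm_exp]
    refine mul_le_of_le_one_left (norm_nonneg _) (Real.exp_le_one_iff.2 ?_)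
    have : 0 ≤ ε * s := mul_nonneg (le_of_lt hε) (le_of_lt hs)
    simpa using this
  · have : Tendsto (fun ε : ℝ => Complex.exp (-(ε * s : ℝ)) *
        (Complex.exp (Complex.I * ω * s) * C a b s)) (𝓝 0) (𝓝 (Complex.exp (-((0 : ℝ) * s : ℝ)) *
        (Complex.exp (Complex.I * ω * s) * C a b s))) := Continuous.tendsto (by fun_prop) 0
    simp only [zero_mul, Complex.ofReal_zero, neg_zero, Complex.exp_zero, one_mul] at this
    exact this.mono_left nhdsWithin_le_nhds

/-- Abel summation of the half-sided Fourier transforms gives the Lamb shift as a smoothly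
regularized dispersion integral: the spectral density has the Hermitian symmetry `γ_{ba}^* =
γ_{ab}`, and `1/(ε - iy) - 1/(ε + iy) = 2i y/(ε² + y²)`. -/
theorem tendsto_integral_reg (h : IsGibbsLimit β B C) (a b : ι) (ω : ℝ) :
    Tendsto (fun ε : ℝ => 1 / (2 * (Real.pi : ℂ)) *
      ∫ x, specDensity C a b x * (((ω - x) / (ε ^ 2 + (ω - x) ^ 2) : ℝ) : ℂ)) (𝓝[>] 0)
      (𝓝 (lambShift C a b ω)) := by
  have hlim := (((h.tendsto_integral_Ioi_exp_mul a b ω).sub ((Complex.continuous_conj.tendsto _).comp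
    (h.tendsto_integral_Ioi_exp_mul b a ω))).const_mul (1 / (2 * Complex.I)))
  refine hlim.congr' ?_
  filter_upwards [self_mem_nhdsWithin] with ε hε
  have hε : 0 < ε := hε
  have hne : ∀ x : ℝ, (ε : ℂ) - Complex.I * (ω - x) ≠ 0 := fun x hx => by
    have := congrArg Complex.re hx
    simp at this
    exact hε.ne' this
  have hne' : ∀ x : ℝ, (ε : ℂ) + Complex.I * (ω - x) ≠ 0 := fun x hx => by
    have := congrArg Complex.re hx
    simp at this
    exact hε.ne' this
  have hb : ∀ z : ℂ, z.re = ε → ‖1 / z‖ ≤ 1 / ε := fun z hz => by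
    rw [norm_div, norm_one]
    have := Complex.re_le_norm z
    rw [hz] at this
    gcongr
  have i1 : Integrable fun x : ℝ => specDensity C a b x * (1 / (ε - Complex.I * (ω - x))) := by
    refine (h.integrable_specDensity a b).mul_bdd (c := 1 / ε)
      (Continuous.aestronglyMeasurable ?_) (Eventually.of_forall fun x => hb _ (by simp))
    exact continuous_const.div (by fun_prop) hne
  have i2 : Integrable fun x : ℝ => specDensity C a b x * (1 / (ε + Complex.I * (ω - x))) := by
    refine (h.integrable_specDensity a b).mul_bdd (c := 1 / ε)
      (Continuous.aestronglyMeasurable ?_) (Eventually.of_forall fun x => hb _ (by simp))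
    exact continuous_const.div (by fun_prop) hne'
  have hconj : (starRingEnd ℂ) (1 / (2 * Real.pi) *
      ∫ Ω : ℝ, specDensity C b a Ω * (1 / (ε - Complex.I * (ω - Ω)))) =
      1 / (2 * Real.pi) * ∫ Ω : ℝ, specDensity C a b Ω * (1 / (ε + Complex.I * (ω - Ω))) := by
    rw [map_mul, ← integral_conj]
    congr 1
    · rw [show (1 / (2 * Real.pi) : ℂ) = ((1 / (2 * Real.pi) : ℝ) : ℂ) by push_cast; ring,
        Complex.conj_ofReal]
    · congr 1
      ext x
      rw [map_mul, h.conj_specDensity]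
      simp
  simp only [Function.comp]
  rw [h.integral_Ioi_exp_mul a b ω hε, h.integral_Ioi_exp_mul b a ω hε, hconj, ← mul_sub,
    ← integral_sub i1 i2, mul_left_comm, ← integral_const_mul]
  congr 2
  ext x
  have hp : ((ε : ℂ) ^ 2 + (ω - x) ^ 2) ≠ 0 := by
    have : (ε ^ 2 + (ω - x) ^ 2) ≠ 0 := by positivity
    exact_mod_cast this
  have h1 := hne x
  have h2 := hne' x
  have hsub : 1 / ((ε : ℂ) - Complex.I * (ω - x)) - 1 / ((ε : ℂ) + Complex.I * (ω - x)) =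
      2 * Complex.I * ((ω - x) / (ε ^ 2 + (ω - x) ^ 2)) := by
    rw [div_sub_div _ _ h1 h2, ← mul_div_assoc, div_eq_div_iff (mul_ne_zero h1 h2) hp]
    linear_combination 2 * Complex.I * ((ω : ℂ) - x) ^ 3 * Complex.I_sq
  rw [← mul_sub, hsub]
  push_cast
  field_simp

/-- The Lamb shift of the reservoir is the principal value of its dispersion integral. -/
theorem tendsto_principalValue (h : IsGibbsLimit β B C) (a b : ι) (ω : ℝ) :
    Tendsto (fun r : ℝ => 1 / (2 * (Real.pi : ℂ)) *
      ∫ Ω in {Ω : ℝ | r < |Ω - ω|}, specDensity C a b Ω / ((ω : ℂ) - Ω))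
      (𝓝[>] 0) (𝓝 (lambShift C a b ω)) := by
  have h1 := (tendsto_integral_cutDiff (h.continuous_specDensity a b)
    (norm_fourierInt_le (C a b)) ω).const_mul (1 / (2 * (Real.pi : ℂ)))
  have h2 := h1.add (h.tendsto_integral_reg a b ω)
  rw [mul_zero, zero_add] at h2
  refine h2.congr' ?_
  filter_upwards [self_mem_nhdsWithin] with r hr
  rw [← integral_cut_sub_integral_reg (h.integrable_specDensity a b) ω hr]
  ring

/-- Away from `ω`, the two terms of `(e^{β(ω-Ω)} - 1)/(ω - Ω)` may be integrated separately, and the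
KMS condition reflects the first one. -/
theorem integral_cut_expQuot (h : IsGibbsLimit β B C) (a b : ι) (ω : ℝ) {r : ℝ} (hr : 0 < r) :
    ∫ Ω in {Ω : ℝ | r < |Ω - ω|}, (expQuot β (ω - Ω) : ℂ) * specDensity C a b Ω =
      -(Real.exp (β * ω) *
        ∫ Ω in {Ω : ℝ | r < |Ω - -ω|}, specDensity C b a Ω / (((-ω : ℝ) : ℂ) - Ω)) -
      ∫ Ω in {Ω : ℝ | r < |Ω - ω|}, specDensity C a b Ω / ((ω : ℂ) - Ω) := by
  have hS : ∀ ω : ℝ, MeasurableSet {x : ℝ | r < |x - ω|} := fun ω =>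
    measurableSet_lt measurable_const (by fun_prop)
  have hint : ∀ (a b : ι) (ω : ℝ), Integrable ({x : ℝ | r < |x - ω|}.indicator
      fun Ω => specDensity C a b Ω / ((ω : ℂ) - Ω)) := by
    intro a b ω
    refine ((h.integrable_specDensity a b).norm.const_mul (1 / r)).mono' ?_
      (Eventually.of_forall fun x => ?_)
    · refine AEStronglyMeasurable.indicator ?_ (hS ω)
      simp only [div_eq_mul_inv]
      refine (h.continuous_specDensity a b).aestronglyMeasurable.mul ?_
      exact Measurable.aestronglyMeasurable (by fun_prop)
    · rw [Set.indicator_apply]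
      split_ifs with hx
      · have hx : r < |x - ω| := hx
        rw [norm_div, ← Complex.ofReal_sub, Complex.norm_real, Real.norm_eq_abs, abs_sub_comm,
          div_eq_inv_mul, one_div]
        gcongr
      · rw [norm_zero]
        positivity
  rw [← integral_indicator (hS _), ← integral_indicator (hS _), ← integral_indicator (hS _),
    ← integral_neg_eq_self (Set.indicator {Ω : ℝ | r < |Ω - -ω|} _), ← integral_const_mul,
    ← integral_neg, ← integral_sub]
  · congr 1
    ext x
    have hiff : (r < |-x - -ω|) ↔ r < |x - ω| := by
      rw [show -x - -ω = -(x - ω) by ring, abs_neg]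
    simp only [Set.indicator_apply, Set.mem_ofPred_eq, hiff]
    split_ifs with hx
    · have hne : ω - x ≠ 0 := by
        intro h0
        rw [abs_sub_comm, h0, abs_zero] at hx
        exact lt_asymm hx hr
      have hne' : (ω : ℂ) - x ≠ 0 := by exact_mod_cast hne
      have he : Real.exp (β * (ω - x)) = Real.exp (β * ω) * Real.exp (-β * x) := by
        rw [← Real.exp_add]; ring_nf
      rw [expQuot_of_ne β hne, he, h.kms a b x]
      push_cast
      rw [show -(ω : ℂ) - -x = -((ω : ℂ) - x) by ring, div_neg]
      field_simp
    · simp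
  · exact (((hint b a (-ω)).comp_neg).const_mul _).neg
  · exact hint a b ω

/-- The pole-free half of the mean-force coefficient, in terms of Lamb shifts. -/
theorem integral_expQuot (h : IsGibbsLimit β B C) (hβ : 0 < β) (a b : ι) (ω : ℝ) :
    1 / (2 * (Real.pi : ℂ)) * ∫ Ω, (expQuot β (ω - Ω) : ℂ) * specDensity C a b Ω =
      -(Real.exp (β * ω) * lambShift C b a (-ω)) - lambShift C a b ω := by
  have hq := continuous_expQuot β
  have hi := h.integrable_mul_specDensity a b (f := fun Ω => (expQuot β (ω - Ω) : ℂ))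
    (Continuous.aestronglyMeasurable (by fun_prop)) (Bath.norm_expQuot_sub_le hβ ω)
  have hS : ∀ r : ℝ, MeasurableSet {x : ℝ | r < |x - ω|} := fun r =>
    measurableSet_lt measurable_const (by fun_prop)
  have hcut : Tendsto (fun r : ℝ => ∫ Ω in {Ω : ℝ | r < |Ω - ω|},
      (expQuot β (ω - Ω) : ℂ) * specDensity C a b Ω) (𝓝[>] 0)
      (𝓝 (∫ Ω, (expQuot β (ω - Ω) : ℂ) * specDensity C a b Ω)) := by
    simp only [← integral_indicator (hS _)]
    refine tendsto_integral_filter_of_dominated_convergence _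
      (Eventually.of_forall fun r => (hi.indicator (hS r)).aestronglyMeasurable)
      (Eventually.of_forall fun r => Eventually.of_forall fun x => norm_indicator_le_norm_self _ _)
      hi.norm ?_
    have hae : ∀ᵐ x : ℝ, x ≠ ω := by simp [ae_iff]
    filter_upwards [hae] with x hx
    refine tendsto_const_nhds.congr' ?_
    have : ∀ᶠ r : ℝ in 𝓝[>] 0, r < |x - ω| :=
      nhdsWithin_le_nhds (gt_mem_nhds (abs_pos.2 (sub_ne_zero.2 hx)))
    filter_upwards [this] with r hr
    rw [Set.indicator_of_mem (show x ∈ {x : ℝ | r < |x - ω|} from hr)]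
  refine tendsto_nhds_unique (hcut.const_mul _) ?_
  refine ((((h.tendsto_principalValue b a (-ω)).const_mul _).neg).sub
    (h.tendsto_principalValue a b ω)).congr' ?_
  filter_upwards [self_mem_nhdsWithin] with r hr
  rw [h.integral_cut_expQuot a b ω hr]
  ring

theorem integrable_kernelD_mul (h : IsGibbsLimit β B C) (hβ : 0 < β) (a b : ι) (ω ω' : ℝ) :
    Integrable fun Ω : ℝ => (kernelD β ω ω' Ω : ℂ) * specDensity C a b Ω := by
  have hc := (continuous_kernelD hβ).comp (f := fun Ω : ℝ => (ω, ω', Ω)) (by fun_prop)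
  refine h.integrable_mul_specDensity a b
    (c := β * (β * (Real.exp (β * |ω - ω'|) * (1 + Real.exp (β * ω)))) / expQuot β (ω - ω'))
    (Complex.continuous_ofReal.comp hc).aestronglyMeasurable fun Ω => ?_
  rw [Complex.norm_real, Real.norm_eq_abs]
  exact abs_kernelD_le hβ ω ω' Ω

theorem mfCoefficient_eq (h : IsGibbsLimit β B C) (hβ : 0 < β) (a b : ι) {ω ω' : ℝ}
    (hne : ω ≠ ω') :
    mfCoefficient C β a b ω ω' = lambCombination β ω ω' (lambShift C a b ω') (lambShift C a b ω)
      (lambShift C b a (-ω')) (lambShift C b a (-ω)) := by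
  have hq := continuous_expQuot β
  have hi := fun ω => h.integrable_mul_specDensity a b (f := fun Ω => (expQuot β (ω - Ω) : ℂ))
    (Continuous.aestronglyMeasurable (by fun_prop)) (Bath.norm_expQuot_sub_le hβ ω)
  rw [← Bath.lambCombination_of_expQuot hβ hne (h.integral_expQuot hβ a b ω)
    (h.integral_expQuot hβ a b ω'), mfCoefficient, mul_left_comm, mul_left_comm (Complex.ofReal _),
    ← mul_sub, ← integral_const_mul (Real.exp (β * ω') : ℂ),
    ← integral_const_mul (Real.exp (β * ω) : ℂ),
    ← integral_sub ((hi _).const_mul _) ((hi _).const_mul _), mul_div_assoc, ← integral_div]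
  congr 2
  ext Ω
  rw [kernelD_eq_sub hβ hne]
  push_cast
  ring

/-- The coefficient is continuous in `ω'`, because the kernel is, with a thermal bound that is
locally uniform in `ω'`. -/
theorem tendsto_mfCoefficient (h : IsGibbsLimit β B C) (hβ : 0 < β) (a b : ι) (ω : ℝ) :
    Tendsto (fun ω' => mfCoefficient C β a b ω ω') (𝓝 ω) (𝓝 (mfCoefficient C β a b ω ω)) := by
  refine Tendsto.const_mul _ ?_
  have hq := continuous_expQuot β
  -- The constant of the bound of the kernel depends continuously on `ω'`.
  set c : ℝ → ℝ := fun ω' =>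
    β * (β * (Real.exp (β * |ω - ω'|) * (1 + Real.exp (β * ω)))) / expQuot β (ω - ω') with hc
  have hcc : Continuous c := by
    refine Continuous.div (by fun_prop) (by fun_prop) fun ω' => (expQuot_pos hβ _).ne'
  refine tendsto_integral_filter_of_dominated_convergence
    (fun Ω => (c ω + 1) * ((1 + Real.exp (-β * Ω)) * ‖specDensity C a b Ω‖))
    (Eventually.of_forall fun ω' => (h.integrable_kernelD_mul hβ a b ω ω').aestronglyMeasurable)
    ?_ ((h.integrable_one_add_exp_mul a b).const_mul _) (Eventually.of_forall fun Ω => ?_)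
  · have hev : ∀ᶠ ω' in 𝓝 ω, c ω' < c ω + 1 := hcc.continuousAt.eventually (gt_mem_nhds (by linarith))
    filter_upwards [hev] with ω' hω'
    refine Eventually.of_forall fun Ω => ?_
    rw [norm_mul, Complex.norm_real, Real.norm_eq_abs, ← mul_assoc]
    refine mul_le_mul_of_nonneg_right ((abs_kernelD_le hβ ω ω' Ω).trans ?_) (norm_nonneg _)
    exact mul_le_mul_of_nonneg_right hω'.le (by positivity)
  · refine Tendsto.mul_const _ ?_
    have := (continuous_kernelD hβ).comp (f := fun ω' : ℝ => (ω, ω', Ω)) (by fun_prop)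
    exact (Complex.continuous_ofReal.comp this).tendsto ω

theorem tendsto_lambCombination (h : IsGibbsLimit β B C) (hβ : 0 < β) (a b : ι) (ω : ℝ) :
    Tendsto (fun ω' => lambCombination β ω ω' (lambShift C a b ω') (lambShift C a b ω)
      (lambShift C b a (-ω')) (lambShift C b a (-ω))) (𝓝[≠] ω)
      (𝓝 (mfCoefficient C β a b ω ω)) := by
  refine ((h.tendsto_mfCoefficient hβ a b ω).mono_left nhdsWithin_le_nhds).congr' ?_
  filter_upwards [self_mem_nhdsWithin] with ω' hω'
  exact h.mfCoefficient_eq hβ a b (Ne.symm hω')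

theorem tendsto_spectralSum_kernelD (h : IsGibbsLimit β B C) (hβ : 0 < β) (a b : ι) (ω ω' : ℝ) :
    Tendsto (fun N => (B N).spectralSum β a b (fun Ω => (kernelD β ω ω' Ω : ℂ))) atTop
      (𝓝 (mfCoefficient C β a b ω ω')) := by
  have hc := (continuous_kernelD hβ).comp (f := fun Ω : ℝ => (ω, ω', Ω)) (by fun_prop)
  refine h.tendsto_spectralSum a b (Complex.continuous_ofReal.comp hc) fun ε hε => ?_
  obtain ⟨c, hc⟩ := exists_abs_kernelD_mul_le hβ ω ω'
  refine ⟨|ω'| + |c| / ε + 1, fun Ω hΩ => ?_⟩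
  have h1 : |c| / ε + 1 ≤ |ω' - Ω| := by
    have := abs_sub_abs_le_abs_sub Ω ω'
    rw [abs_sub_comm] at this
    linarith
  have h0 : 0 < |ω' - Ω| := lt_of_lt_of_le (by positivity) h1
  have h2 : |c| ≤ ε * |ω' - Ω| := by
    have : |c| / ε ≤ |ω' - Ω| := by linarith
    rwa [div_le_iff₀' hε] at this
  change ‖((kernelD β ω ω' Ω : ℝ) : ℂ)‖ ≤ _
  rw [Complex.norm_real, Real.norm_eq_abs]
  refine le_of_mul_le_mul_right ((hc Ω).trans ?_) h0
  calc c * (1 + Real.exp (-β * Ω)) ≤ (ε * |ω' - Ω|) * (1 + Real.exp (-β * Ω)) :=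
        mul_le_mul_of_nonneg_right ((le_abs_self c).trans h2) (by positivity)
    _ = _ := by ring

end IsGibbsLimit

/-! ### The free semigroup -/

/-- A self-adjoint operator, bounded below by `-μ`, with orthonormal eigenbasis `b` and
eigenvalues `E`. -/
structure DiagHam (X 𝓗 : Type*) [NormedAddCommGroup 𝓗] [InnerProductSpace ℂ 𝓗] where
  b : HilbertBasis X ℂ 𝓗
  E : X → ℝ
  μ : ℝ
  μ_nonneg : 0 ≤ μ
  neg_μ_le : ∀ x, -μ ≤ E x

set_option linter.unusedSectionVars false

namespace DiagHam

variable {X 𝓗 : Type*} [NormedAddCommGroup 𝓗] [InnerProductSpace ℂ 𝓗] (H : DiagHam X 𝓗)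

theorem norm_exp_neg_mul_le (t : ℝ) (x : X) :
    ‖((Real.exp (-(max t 0) * H.E x) : ℝ) : ℂ)‖ ≤ Real.exp (H.μ * max t 0) := by
  rw [Complex.norm_real, Real.norm_of_nonneg (Real.exp_pos _).le, Real.exp_le_exp]
  nlinarith [H.neg_μ_le x, le_max_right t 0]

/-- The semigroup `e^{-tH}`; it is extended by the identity to negative times, so that it is
strongly continuous on the whole line. -/
noncomputable def T (t : ℝ) : 𝓗 →L[ℂ] 𝓗 :=
  H.b.diag (fun x => ((Real.exp (-(max t 0) * H.E x) : ℝ) : ℂ))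
    ⟨_, H.norm_exp_neg_mul_le t⟩

theorem norm_T_apply_le (t : ℝ) (v : 𝓗) : ‖H.T t v‖ ≤ Real.exp (H.μ * max t 0) * ‖v‖ :=
  H.b.norm_diag_apply_le _ (H.norm_exp_neg_mul_le t) (Real.exp_pos _).le v

theorem inner_T' (t : ℝ) (x : X) (v : 𝓗) :
    ⟪H.b x, H.T t v⟫_ℂ = (Real.exp (-(max t 0) * H.E x) : ℂ) * ⟪H.b x, v⟫_ℂ :=
  H.b.inner_diag _ x v

theorem inner_T {t : ℝ} (ht : 0 ≤ t) (x : X) (v : 𝓗) :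
    ⟪H.b x, H.T t v⟫_ℂ = (Real.exp (-t * H.E x) : ℂ) * ⟪H.b x, v⟫_ℂ := by
  rw [inner_T', max_eq_left ht]

theorem T_b {t : ℝ} (ht : 0 ≤ t) (x : X) :
    H.T t (H.b x) = (Real.exp (-t * H.E x) : ℂ) • H.b x := by
  rw [T, H.b.diag_apply_self, max_eq_left ht]

theorem T_of_nonpos {t : ℝ} (ht : t ≤ 0) : H.T t = 1 := by
  ext v
  refine H.b.ext_inner fun x => ?_
  rw [inner_T', max_eq_right ht]
  simp

theorem T_zero : H.T 0 = 1 := H.T_of_nonpos le_rfl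

theorem T_add {s t : ℝ} (hs : 0 ≤ s) (ht : 0 ≤ t) (v : 𝓗) : H.T (s + t) v = H.T s (H.T t v) := by
  refine H.b.ext_inner fun x => ?_
  rw [H.inner_T (add_nonneg hs ht), H.inner_T hs, H.inner_T ht, ← mul_assoc, ← Complex.ofReal_mul,
    ← Real.exp_add]
  congr 3
  ring

theorem inner_T_symm (t : ℝ) (v w : 𝓗) : ⟪v, H.T t w⟫_ℂ = ⟪H.T t v, w⟫_ℂ := by
  refine (H.b.hasSum_inner_mul_inner v (H.T t w)).unique
    ((H.b.hasSum_inner_mul_inner (H.T t v) w).congr_fun fun x => ?_)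
  rw [inner_T', ← inner_conj_symm (H.T t v), inner_T', map_mul, Complex.conj_ofReal,
    inner_conj_symm]
  ring

theorem continuous_T_apply (v : 𝓗) : Continuous fun t => H.T t v := by
  rw [continuous_iff_continuousAt]
  intro t₀
  rw [ContinuousAt, tendsto_iff_norm_sub_tendsto_zero]
  have key : Tendsto (fun t => ‖H.T t v - H.T t₀ v‖ ^ 2) (𝓝 t₀) (𝓝 0) := by
    have e : ∀ t, ‖H.T t v - H.T t₀ v‖ ^ 2 = ∑' x, ‖((Real.exp (-(max t 0) * H.E x) : ℂ) -
        (Real.exp (-(max t₀ 0) * H.E x) : ℂ)) * ⟪H.b x, v⟫_ℂ‖ ^ 2 := by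
      intro t
      rw [← (H.b.hasSum_sq_norm_inner _).tsum_eq]
      simp only [inner_sub_right, inner_T', sub_mul]
    simp only [e]
    have hlim : Tendsto (fun t => ∑' x, ‖((Real.exp (-(max t 0) * H.E x) : ℂ) -
        (Real.exp (-(max t₀ 0) * H.E x) : ℂ)) * ⟪H.b x, v⟫_ℂ‖ ^ 2) (𝓝 t₀)
        (𝓝 (∑' _ : X, (0 : ℝ))) := by
      refine tendsto_tsum_of_dominated_convergence (bound := fun x =>
        (2 * Real.exp (H.μ * max (t₀ + 1) 0)) ^ 2 * ‖⟪H.b x, v⟫_ℂ‖ ^ 2)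
        ((H.b.hasSum_sq_norm_inner v).summable.mul_left _) (fun x => ?_) ?_
      · have : Continuous fun t : ℝ => ‖((Real.exp (-(max t 0) * H.E x) : ℂ) -
          (Real.exp (-(max t₀ 0) * H.E x) : ℂ)) * ⟪H.b x, v⟫_ℂ‖ ^ 2 := by fun_prop
        have h2 := this.tendsto t₀
        simpa using h2
      · filter_upwards [gt_mem_nhds (lt_add_one t₀)] with t ht x
        rw [Real.norm_of_nonneg (by positivity), norm_mul, mul_pow]
        refine mul_le_mul_of_nonneg_right ?_ (by positivity)
        refine pow_le_pow_left₀ (norm_nonneg _) ((norm_sub_le _ _).trans ?_) 2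
        have h1 : ∀ s ≤ t₀ + 1, ‖((Real.exp (-(max s 0) * H.E x) : ℝ) : ℂ)‖ ≤
            Real.exp (H.μ * max (t₀ + 1) 0) := fun s hs =>
          (H.norm_exp_neg_mul_le s x).trans (Real.exp_le_exp.2
            (mul_le_mul_of_nonneg_left (max_le_max_right 0 hs) H.μ_nonneg))
        linarith [h1 t ht.le, h1 t₀ (by linarith)]
    rwa [tsum_zero] at hlim
  have := key.sqrt
  simpa [Real.sqrt_sq] using this

/-- Joint strong continuity. -/
theorem continuous_T : Continuous fun p : ℝ × 𝓗 => H.T p.1 p.2 := by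
  rw [continuous_iff_continuousAt]
  rintro ⟨t₀, v₀⟩
  rw [ContinuousAt, tendsto_iff_norm_sub_tendsto_zero]
  have h1 : Tendsto (fun p : ℝ × 𝓗 => Real.exp (H.μ * max p.1 0) * ‖p.2 - v₀‖ +
      ‖H.T p.1 v₀ - H.T t₀ v₀‖) (𝓝 (t₀, v₀)) (𝓝 0) := by
    have hc := H.continuous_T_apply v₀
    have : Continuous (fun p : ℝ × 𝓗 => Real.exp (H.μ * max p.1 0) * ‖p.2 - v₀‖ +
      ‖H.T p.1 v₀ - H.T t₀ v₀‖) := by fun_prop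
    simpa using this.tendsto (t₀, v₀)
  refine squeeze_zero (fun _ => norm_nonneg _) (fun p => ?_) h1
  calc ‖H.T p.1 p.2 - H.T t₀ v₀‖ = ‖H.T p.1 (p.2 - v₀) + (H.T p.1 v₀ - H.T t₀ v₀)‖ := by
        rw [map_sub]; congr 1; abel
    _ ≤ _ := (norm_add_le _ _).trans (add_le_add_left (H.norm_T_apply_le _ _) _)

theorem continuous_T_comp {Z : Type*} [TopologicalSpace Z] {f : Z → ℝ} {g : Z → 𝓗}
    (hf : Continuous f) (hg : Continuous g) : Continuous fun z => H.T (f z) (g z) :=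
  H.continuous_T.comp (hf.prodMk hg)

/-! ### The Dyson series -/

variable [CompleteSpace 𝓗] (V : 𝓗 →L[ℂ] 𝓗)

/-- The `m`-th term of the Dyson series of `e^{-t(H+V)}`, applied to a vector. -/
noncomputable def dysonFun : ℕ → ℝ → 𝓗 → 𝓗
  | 0, t, v => H.T t v
  | m + 1, t, v => -∫ s in (0 : ℝ)..max t 0, H.T (t - s) (V (dysonFun m s v))

theorem continuous_dysonFun (m : ℕ) (v : 𝓗) : Continuous fun t => H.dysonFun V m t v := by
  induction m with
  | zero => exact H.continuous_T_apply v
  | succ m ih =>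
    refine Continuous.neg ?_
    refine intervalIntegral.continuous_parametric_intervalIntegral_of_continuous
      (f := fun t s => H.T (t - s) (V (H.dysonFun V m s v))) ?_ (by fun_prop)
    exact H.continuous_T_comp (by fun_prop) (V.continuous.comp (ih.comp continuous_snd))

theorem continuous_dyson_integrand (m : ℕ) (t : ℝ) (v : 𝓗) :
    Continuous fun s => H.T (t - s) (V (H.dysonFun V m s v)) :=
  H.continuous_T_comp (by fun_prop) (V.continuous.comp (H.continuous_dysonFun V m v))

theorem dysonFun_add (m : ℕ) (t : ℝ) (v w : 𝓗) :
    H.dysonFun V m t (v + w) = H.dysonFun V m t v + H.dysonFun V m t w := by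
  induction m generalizing t with
  | zero => exact map_add _ _ _
  | succ m ih =>
    simp only [dysonFun, ih, map_add]
    rw [intervalIntegral.integral_add
      ((H.continuous_dyson_integrand V m t v).intervalIntegrable _ _)
      ((H.continuous_dyson_integrand V m t w).intervalIntegrable _ _), neg_add]

theorem dysonFun_smul (m : ℕ) (t : ℝ) (c : ℂ) (v : 𝓗) :
    H.dysonFun V m t (c • v) = c • H.dysonFun V m t v := by
  induction m generalizing t with
  | zero => exact map_smul _ _ _
  | succ m ih =>
    simp only [dysonFun, ih, map_smul]
    rw [intervalIntegral.integral_smul, smul_neg]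

/-- The bound `e^{μt} (‖V‖ t)^m / m!` on the `m`-th Dyson term. -/
noncomputable def dysonBound (m : ℕ) (t : ℝ) : ℝ :=
  Real.exp (H.μ * max t 0) * ((‖V‖ * max t 0) ^ m / m.factorial)

theorem dysonBound_nonneg (m : ℕ) (t : ℝ) : 0 ≤ H.dysonBound V m t := by
  have := le_max_right t 0
  unfold dysonBound
  positivity

theorem norm_dysonFun_le (m : ℕ) (t : ℝ) (v : 𝓗) :
    ‖H.dysonFun V m t v‖ ≤ H.dysonBound V m t * ‖v‖ := by
  induction m generalizing t with
  | zero => simpa [dysonBound, dysonFun] using H.norm_T_apply_le t v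
  | succ m ih =>
    rw [dysonFun, norm_neg]
    set t' := max t 0 with ht'
    have ht0 : 0 ≤ t' := le_max_right t 0
    have hb : ∀ s ∈ Set.Ioc 0 t', ‖H.T (t - s) (V (H.dysonFun V m s v))‖ ≤
        Real.exp (H.μ * t') * ‖V‖ ^ (m + 1) * ‖v‖ / m.factorial * s ^ m := by
      intro s hs
      have hs0 : 0 ≤ s := hs.1.le
      have htt : t' = t := by
        rcases le_total 0 t with h | h
        · exact max_eq_left h
        · exact absurd (hs.1.trans_le hs.2) (by rw [ht', max_eq_right h]; exact lt_irrefl _)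
      have e1 : Real.exp (H.μ * (t - s)) * Real.exp (H.μ * s) = Real.exp (H.μ * t') := by
        rw [← Real.exp_add, htt]; ring_nf
      calc _ ≤ Real.exp (H.μ * (t - s)) * (‖V‖ * (H.dysonBound V m s * ‖v‖)) := by
            refine (H.norm_T_apply_le _ _).trans ?_
            rw [max_eq_left (by linarith [hs.2] : 0 ≤ t - s)]
            exact mul_le_mul_of_nonneg_left ((V.le_opNorm _).trans
              (mul_le_mul_of_nonneg_left (ih s) (norm_nonneg _))) (Real.exp_pos _).le
        _ = (Real.exp (H.μ * (t - s)) * Real.exp (H.μ * s)) * ‖V‖ ^ (m + 1) * ‖v‖ /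
              m.factorial * s ^ m := by
            rw [dysonBound, max_eq_left hs0, mul_pow]
            ring
        _ = _ := by rw [e1]
    refine (intervalIntegral.norm_integral_le_of_norm_le ht0 (Eventually.of_forall hb)
      (Continuous.intervalIntegrable (by fun_prop) _ _)).trans (le_of_eq ?_)
    rw [intervalIntegral.integral_const_mul, integral_pow, dysonBound, ← ht', Nat.factorial_succ]
    have h1 : (m.factorial : ℝ) ≠ 0 := by exact_mod_cast m.factorial_ne_zero
    have h2 : (m : ℝ) + 1 ≠ 0 := by positivity
    push_cast
    rw [mul_pow]
    field_simp
    simp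

/-- The `m`-th term of the Dyson series of `e^{-t(H+V)}`. -/
noncomputable def dyson (m : ℕ) (t : ℝ) : 𝓗 →L[ℂ] 𝓗 :=
  LinearMap.mkContinuous
    { toFun := H.dysonFun V m t
      map_add' := H.dysonFun_add V m t
      map_smul' := H.dysonFun_smul V m t } (H.dysonBound V m t) (H.norm_dysonFun_le V m t)

theorem dyson_zero (t : ℝ) : H.dyson V 0 t = H.T t := rfl

theorem dyson_succ {t : ℝ} (ht : 0 ≤ t) (m : ℕ) (v : 𝓗) :
    H.dyson V (m + 1) t v = -∫ s in (0 : ℝ)..t, H.T (t - s) (V (H.dyson V m s v)) := by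
  change -∫ s in (0 : ℝ)..max t 0, _ = _
  rw [max_eq_left ht]
  rfl

theorem norm_dyson_le (m : ℕ) (t : ℝ) : ‖H.dyson V m t‖ ≤ H.dysonBound V m t :=
  LinearMap.mkContinuous_norm_le _ (H.dysonBound_nonneg V m t) _

theorem continuous_dyson_apply (m : ℕ) (v : 𝓗) : Continuous fun t => H.dyson V m t v :=
  H.continuous_dysonFun V m v

theorem continuous_T_dyson (m : ℕ) (t : ℝ) (v : 𝓗) :
    Continuous fun s => H.T (t - s) (V (H.dyson V m s v)) :=
  H.continuous_dyson_integrand V m t v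

theorem dyson_smul (c : ℂ) (m : ℕ) {t : ℝ} (ht : 0 ≤ t) :
    H.dyson (c • V) m t = c ^ m • H.dyson V m t := by
  ext v
  induction m generalizing t with
  | zero => simp [dyson_zero]
  | succ m ih =>
    rw [_root_.smul_apply, H.dyson_succ _ ht, H.dyson_succ _ ht, smul_neg,
      ← intervalIntegral.integral_smul]
    congr 1
    refine intervalIntegral.integral_congr fun s hs => ?_
    rw [Set.uIcc_of_le ht] at hs
    simp only [ih hs.1, _root_.smul_apply, map_smul, smul_smul, pow_succ]

theorem summable_dysonBound (t : ℝ) : Summable fun m => H.dysonBound V m t :=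
  (Real.summable_pow_div_factorial _).mul_left _

theorem summable_norm_dyson (t : ℝ) : Summable fun m => ‖H.dyson V m t‖ :=
  Summable.of_nonneg_of_le (fun _ => norm_nonneg _) (fun m => H.norm_dyson_le V m t)
    (H.summable_dysonBound V t)

/-- The perturbed semigroup `e^{-t(H+V)}`, as the sum of its Dyson series. -/
noncomputable def Q (t : ℝ) : 𝓗 →L[ℂ] 𝓗 := ∑' m, H.dyson V m t

theorem hasSum_Q (t : ℝ) : HasSum (fun m => H.dyson V m t) (H.Q V t) :=
  (H.summable_norm_dyson V t).of_norm.hasSum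

theorem hasSum_Q_apply (t : ℝ) (v : 𝓗) : HasSum (fun m => H.dyson V m t v) (H.Q V t v) :=
  (H.hasSum_Q V t).mapL (ContinuousLinearMap.apply ℂ 𝓗 v)

theorem dyson_succ_zero (m : ℕ) : H.dyson V (m + 1) 0 = 0 := by
  ext v
  rw [H.dyson_succ V le_rfl]
  simp

theorem Q_zero : H.Q V 0 = 1 := by
  refine (H.hasSum_Q V 0).unique ?_
  convert hasSum_single (f := fun m => H.dyson V m 0) 0 ?_ using 1
  · rw [dyson_zero, T_zero]
  · rintro (_ | m) hm
    · exact absurd rfl hm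
    · exact H.dyson_succ_zero V m

/-- The semigroup law, order by order: the time-ordered integral over `[0, t + s]` is split at the
time `s`. -/
theorem dyson_add (m : ℕ) {s t : ℝ} (hs : 0 ≤ s) (ht : 0 ≤ t) (v : 𝓗) :
    H.dyson V m (t + s) v =
      ∑ p ∈ Finset.HasAntidiagonal.antidiagonal m, H.dyson V p.1 t (H.dyson V p.2 s v) := by
  induction m generalizing t with
  | zero => simp [dyson_zero, H.T_add ht hs]
  | succ m ih =>
    rw [Finset.Nat.sum_antidiagonal_succ, H.dyson_succ V (add_nonneg ht hs), dyson_zero,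
      H.dyson_succ V hs, map_neg, ← ContinuousLinearMap.intervalIntegral_comp_comm _
      ((H.continuous_T_dyson V m s v).intervalIntegrable _ _)]
    have hi : ∀ a b, IntervalIntegrable
        (fun r => H.T (t + s - r) (V (H.dyson V m r v))) volume a b := fun a b =>
      (H.continuous_T_dyson V m (t + s) v).intervalIntegrable _ _
    rw [← intervalIntegral.integral_add_adjacent_intervals (hi 0 s) (hi s (t + s)), neg_add]
    congr 1
    · congr 1
      refine intervalIntegral.integral_congr fun r hr => ?_
      rw [Set.uIcc_of_le hs] at hr
      rw [← H.T_add ht (by linarith [hr.2]), add_sub_assoc]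
    · have e := intervalIntegral.integral_comp_add_right (a := 0) (b := t)
        (fun r => H.T (t + s - r) (V (H.dyson V m r v))) s
      rw [zero_add] at e
      simp only [H.dyson_succ V ht]
      rw [← e, Finset.sum_neg_distrib, ← intervalIntegral.integral_finsetSum]
      · congr 1
        refine intervalIntegral.integral_congr fun r hr => ?_
        rw [Set.uIcc_of_le ht] at hr
        rw [ih hr.1, map_sum, map_sum, show t + s - (r + s) = t - r by ring]
      · exact fun p _ => (H.continuous_T_dyson V p.1 t _).intervalIntegrable _ _

theorem Q_add {s t : ℝ} (hs : 0 ≤ s) (ht : 0 ≤ t) : H.Q V (t + s) = H.Q V t * H.Q V s := by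
  rw [Q, Q, Q, tsum_mul_tsum_eq_tsum_sum_antidiagonal_of_summable_norm
    (H.summable_norm_dyson V t) (H.summable_norm_dyson V s)]
  refine tsum_congr fun m => ?_
  ext v
  rw [H.dyson_add V m hs ht, _root_.sum_apply]
  rfl

theorem dysonBound_mono (m : ℕ) {s t : ℝ} (h : s ≤ t) :
    H.dysonBound V m s ≤ H.dysonBound V m t := by
  have h1 : max s 0 ≤ max t 0 := max_le_max_right 0 h
  have h2 := le_max_right s 0
  have h3 := H.μ_nonneg
  unfold dysonBound
  gcongr

theorem continuous_Q_apply (v : 𝓗) : Continuous fun t => H.Q V t v := by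
  rw [continuous_iff_continuousAt]
  intro t₀
  have h : ContinuousOn (fun t => H.Q V t v) (Set.Iic (t₀ + 1)) := by
    simp only [← (H.hasSum_Q_apply V _ v).tsum_eq]
    refine continuousOn_tsum (fun m => (H.continuous_dyson_apply V m v).continuousOn)
      ((H.summable_dysonBound V (t₀ + 1)).mul_right ‖v‖) fun m t ht => ?_
    refine (H.norm_dysonFun_le V m t v).trans ?_
    exact mul_le_mul_of_nonneg_right (H.dysonBound_mono V m ht) (norm_nonneg _)
  exact h.continuousAt (Iic_mem_nhds (lt_add_one t₀))

theorem continuous_T_Q (v : 𝓗) : Continuous fun p : ℝ × ℝ => H.T (p.1 - p.2) (V (H.Q V p.2 v)) :=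
  H.continuous_T_comp (by fun_prop)
    (V.continuous.comp ((H.continuous_Q_apply V v).comp continuous_snd))

/-- Duhamel's formula. -/
theorem Q_eq_sub_integral {t : ℝ} (ht : 0 ≤ t) (v : 𝓗) :
    H.Q V t v = H.T t v - ∫ s in (0 : ℝ)..t, H.T (t - s) (V (H.Q V s v)) := by
  have h1 : HasSum (fun m => ∫ s in (0 : ℝ)..t, H.T (t - s) (V (H.dyson V m s v)))
      (∫ s in (0 : ℝ)..t, H.T (t - s) (V (H.Q V s v))) := by
    refine intervalIntegral.hasSum_integral_of_dominated_convergence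
      (fun m _ => Real.exp (H.μ * t) * (‖V‖ * (H.dysonBound V m t * ‖v‖)))
      (fun m => (H.continuous_T_dyson V m t v).aestronglyMeasurable) (fun m => ?_) ?_ ?_ ?_
    · refine Eventually.of_forall fun s hs => ?_
      rw [Set.uIoc_of_le ht] at hs
      refine (H.norm_T_apply_le _ _).trans ?_
      have h2 : Real.exp (H.μ * max (t - s) 0) ≤ Real.exp (H.μ * t) :=
        Real.exp_le_exp.2 (mul_le_mul_of_nonneg_left (max_le (by linarith [hs.1]) ht) H.μ_nonneg)
      have h3 : ‖V (H.dyson V m s v)‖ ≤ ‖V‖ * (H.dysonBound V m t * ‖v‖) :=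
        (V.le_opNorm _).trans (mul_le_mul_of_nonneg_left ((H.norm_dysonFun_le V m s v).trans
          (mul_le_mul_of_nonneg_right (H.dysonBound_mono V m hs.2) (norm_nonneg _)))
          (norm_nonneg _))
      exact mul_le_mul h2 h3 (norm_nonneg _) (Real.exp_pos _).le
    · exact Eventually.of_forall fun s _ =>
        (((H.summable_dysonBound V t).mul_right _).mul_left _).mul_left _
    · exact intervalIntegrable_const
    · exact Eventually.of_forall fun s _ =>
        ((H.hasSum_Q_apply V s v).mapL V).mapL (H.T (t - s))
  have h2 := (hasSum_nat_add_iff' 1).2 (H.hasSum_Q_apply V t v)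
  simp only [H.dyson_succ V ht, Finset.range_one, Finset.sum_singleton, dyson_zero] at h2
  have h3 := h2.unique h1.neg
  rw [sub_eq_iff_eq_add] at h3
  rw [h3]
  abel

end DiagHam

/-! ### Uniqueness and self-adjointness of the perturbed semigroup -/

/-- The derivative at `0` of an integral whose upper limit and integrand both depend on the
parameter; only the limit contributes. -/
theorem hasDerivAt_integral_diag {F : Type*} [NormedAddCommGroup F] [NormedSpace ℝ F]
    [CompleteSpace F] {f : ℝ × ℝ → F} (hf : Continuous f) :
    HasDerivAt (fun t => ∫ s in (0 : ℝ)..t, f (t, s)) (f (0, 0)) 0 := by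
  rw [hasDerivAt_iff_isLittleO, Asymptotics.isLittleO_iff]
  intro ε hε
  have h0 := Metric.continuousAt_iff.1 (hf.continuousAt (x := (0, 0))) ε hε
  obtain ⟨δ, hδ, h⟩ := h0
  filter_upwards [Metric.ball_mem_nhds (0 : ℝ) hδ] with t ht
  have ht' : |t| < δ := by simpa using ht
  have hi : ∀ a b, IntervalIntegrable (fun s => f (t, s)) volume a b := fun a b =>
    (hf.comp (by fun_prop : Continuous fun s : ℝ => (t, s))).intervalIntegrable a b
  have e : (∫ s in (0 : ℝ)..t, f (t, s)) - (∫ s in (0 : ℝ)..0, f (0, s)) - (t - 0) • f (0, 0) =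
      ∫ s in (0 : ℝ)..t, (f (t, s) - f (0, 0)) := by
    rw [intervalIntegral.integral_sub (hi 0 t) intervalIntegrable_const,
      intervalIntegral.integral_const, intervalIntegral.integral_same, sub_zero]
  rw [e]
  refine intervalIntegral.norm_integral_le_of_norm_le_const fun s hs => ?_
  have hs' : |s| ≤ |t| := by
    rcases Set.mem_uIoc.1 hs with hs | hs
    · rw [abs_of_pos hs.1, abs_of_pos (hs.1.trans_le hs.2)]; exact hs.2
    · rw [abs_of_nonpos hs.2, abs_of_neg (hs.1.trans_le hs.2)]; linarith [hs.1]
  have := h (x := (t, s)) (by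
    rw [Prod.dist_eq, max_lt_iff]
    simpa using ⟨ht', hs'.trans_lt ht'⟩)
  rw [dist_eq_norm] at this
  exact this.le

theorem intervalIntegral_inner_right {𝓗 : Type*} [NormedAddCommGroup 𝓗] [InnerProductSpace ℂ 𝓗]
    [CompleteSpace 𝓗] {a b : ℝ} {f : ℝ → 𝓗} (hf : IntervalIntegrable f volume a b) (u : 𝓗) :
    ⟪u, ∫ s in a..b, f s⟫_ℂ = ∫ s in a..b, ⟪u, f s⟫_ℂ := by
  have := ContinuousLinearMap.intervalIntegral_comp_comm (innerSL ℂ u) hf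
  simpa only [innerSL_apply_apply] using this.symm

theorem intervalIntegral_inner_left {𝓗 : Type*} [NormedAddCommGroup 𝓗] [InnerProductSpace ℂ 𝓗]
    [CompleteSpace 𝓗] {a b : ℝ} {f : ℝ → 𝓗} (hf : IntervalIntegrable f volume a b) (u : 𝓗) :
    ⟪∫ s in a..b, f s, u⟫_ℂ = ∫ s in a..b, ⟪f s, u⟫_ℂ := by
  rw [← inner_conj_symm, intervalIntegral_inner_right hf]
  simp only [intervalIntegral, map_sub, ← integral_conj, inner_conj_symm]

namespace DiagHam

variable {X 𝓗 : Type*} [NormedAddCommGroup 𝓗] [InnerProductSpace ℂ 𝓗] [CompleteSpace 𝓗]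
  (H : DiagHam X 𝓗) (V : 𝓗 →L[ℂ] 𝓗)

/-- `P` is a strongly continuous one-parameter semigroup with generator `-(H + V)` on the
eigenvectors of `H`. -/
structure IsSemigroup (P : ℝ → 𝓗 →L[ℂ] 𝓗) : Prop where
  zero : P 0 = 1
  add : ∀ s t, 0 ≤ s → 0 ≤ t → P (s + t) = P s * P t
  cont : ∀ v, ContinuousOn (fun t => P t v) (Set.Ici 0)
  deriv : ∀ x, HasDerivWithinAt (fun t => P t (H.b x)) (-((H.E x : ℂ) • H.b x + V (H.b x)))
    (Set.Ici 0) 0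

theorem hasDerivWithinAt_T (x : X) :
    HasDerivWithinAt (fun t => H.T t (H.b x)) (-((H.E x : ℂ) • H.b x)) (Set.Ici 0) 0 := by
  have h : HasDerivAt (fun t : ℝ => (Real.exp (-t * H.E x) : ℂ) • H.b x)
      (-((H.E x : ℂ) • H.b x)) 0 := by
    have h1 : HasDerivAt (fun t : ℝ => Real.exp (-t * H.E x)) (-H.E x) 0 := by
      have := ((hasDerivAt_id (0 : ℝ)).neg.mul_const (H.E x)).exp
      refine this.congr_deriv ?_
      simp
    refine (h1.ofReal_comp.smul_const (H.b x)).congr_deriv ?_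
    simp
  refine h.hasDerivWithinAt.congr (fun t ht => H.T_b ht x) (H.T_b le_rfl x)

/-- The Dyson series solves the evolution equation, by Duhamel's formula. -/
theorem isSemigroup_Q : H.IsSemigroup V (H.Q V) where
  zero := H.Q_zero V
  add s t hs ht := H.Q_add V ht hs
  cont v := (H.continuous_Q_apply V v).continuousOn
  deriv x := by
    have h1 := hasDerivAt_integral_diag (H.continuous_T_Q V (H.b x))
    have h2 := (H.hasDerivWithinAt_T x).sub h1.hasDerivWithinAt
    refine (h2.congr_deriv ?_).congr (fun t ht => H.Q_eq_sub_integral V ht _)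
      (H.Q_eq_sub_integral V le_rfl _)
    simp only [sub_zero, Q_zero, T_zero, one_apply_eq_self]
    abel

variable {V} {P : ℝ → 𝓗 →L[ℂ] 𝓗}

/-- A strongly continuous semigroup is bounded on compact time intervals, by the uniform boundedness
principle. -/
theorem IsSemigroup.exists_norm_le {H : DiagHam X 𝓗} (h : H.IsSemigroup V P) (t₀ : ℝ) :
    ∃ M, 0 ≤ M ∧ ∀ t ∈ Set.Icc 0 t₀, ‖P t‖ ≤ M := by
  obtain ⟨M, hM⟩ := banach_steinhaus (g := fun t : Set.Icc (0 : ℝ) t₀ => P t) fun v => by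
    obtain ⟨C, hC⟩ := isCompact_Icc.exists_bound_of_continuousOn
      ((h.cont v).mono (Set.Icc_subset_Ici_self : Set.Icc 0 t₀ ⊆ _))
    exact ⟨C, fun t => hC t t.2⟩
  exact ⟨max M 0, le_max_right _ _, fun t ht => (hM ⟨t, ht⟩).trans (le_max_left _ _)⟩

theorem IsSemigroup.continuousOn_comp {H : DiagHam X 𝓗} (h : H.IsSemigroup V P) {t₀ : ℝ}
    {g : ℝ → 𝓗} (hg : Continuous g) :
    ContinuousOn (fun r => P r (g r)) (Set.Icc 0 t₀) := by
  obtain ⟨M, hM0, hM⟩ := h.exists_norm_le t₀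
  intro r hr
  rw [ContinuousWithinAt, tendsto_iff_norm_sub_tendsto_zero]
  have h1 : Tendsto (fun s => M * ‖g s - g r‖ + ‖P s (g r) - P r (g r)‖)
      (𝓝[Set.Icc 0 t₀] r) (𝓝 0) := by
    have a : Tendsto (fun s => M * ‖g s - g r‖) (𝓝[Set.Icc 0 t₀] r) (𝓝 0) := by
      have : Continuous fun s => M * ‖g s - g r‖ := by fun_prop
      simpa using (this.tendsto r).mono_left nhdsWithin_le_nhds
    have b := tendsto_iff_norm_sub_tendsto_zero.1
      (((h.cont (g r)) r hr.1).mono (Set.Icc_subset_Ici_self : Set.Icc 0 t₀ ⊆ _))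
    simpa using a.add b
  refine squeeze_zero' (Eventually.of_forall fun _ => norm_nonneg _) ?_ h1
  filter_upwards [self_mem_nhdsWithin] with s hs
  calc ‖P s (g s) - P r (g r)‖ = ‖P s (g s - g r) + (P s (g r) - P r (g r))‖ := by
        rw [map_sub]; congr 1; abel
    _ ≤ _ := (norm_add_le _ _).trans (add_le_add_left ((P s).le_of_opNorm_le (hM s hs) _) _)

/-- The semigroup law transports the derivative from time zero to every time. -/
theorem IsSemigroup.hasDerivWithinAt {H : DiagHam X 𝓗} (h : H.IsSemigroup V P) (x : X) {r : ℝ}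
    (hr : 0 ≤ r) :
    HasDerivWithinAt (fun t => P t (H.b x)) (-(P r ((H.E x : ℂ) • H.b x + V (H.b x))))
      (Set.Ici r) r := by
  have h1 : HasDerivWithinAt (fun t => P (t - r) (H.b x))
      (-((H.E x : ℂ) • H.b x + V (H.b x))) (Set.Ici r) r := by
    have h0 := h.deriv x
    rw [← sub_self r] at h0
    have := h0.scomp (x := r) (h := fun t => t - r) (s := Set.Ici r)
      (((hasDerivAt_id r).sub_const r).hasDerivWithinAt)
      (fun t ht => by
        simpa only [Set.mem_Ici, sub_self, sub_nonneg] using ht)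
    simpa [Function.comp_def] using this
  have h2 := ((P r).restrictScalars ℝ).hasFDerivAt.comp_hasDerivWithinAt r h1
  refine (h2.congr_deriv ?_).congr (fun t ht => ?_) ?_
  · simp
  · simp only [ContinuousLinearMap.coe_restrictScalars', Function.comp]
    rw [← mul_apply_eq_comp, ← h.add r (t - r) hr (by simpa using ht)]
    simp
  · simp only [ContinuousLinearMap.coe_restrictScalars', Function.comp]
    rw [sub_self, h.zero]; rfl

/-- The mild equation on an eigenvector of the free Hamiltonian: integrate the derivative of `r ↦
e^{rE} P(r) b`, in which the energy cancels. -/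
theorem IsSemigroup.apply_b {H : DiagHam X 𝓗} (h : H.IsSemigroup V P) (x : X) {t : ℝ}
    (ht : 0 ≤ t) :
    P t (H.b x) = H.T t (H.b x) - ∫ r in (0 : ℝ)..t, P r (V (H.T (t - r) (H.b x))) := by
  have hd : ∀ r ∈ Set.Ioo 0 t, HasDerivWithinAt
      (fun r => (Real.exp (r * H.E x) : ℂ) • P r (H.b x))
      (-((Real.exp (r * H.E x) : ℂ) • P r (V (H.b x)))) (Set.Ioi r) r := by
    intro r hr
    have h1 : HasDerivAt (fun r : ℝ => ((Real.exp (r * H.E x) : ℝ) : ℂ))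
        ((Real.exp (r * H.E x) * H.E x : ℝ) : ℂ) r := by
      have := (((hasDerivAt_id r).mul_const (H.E x)).exp).ofReal_comp
      simpa using this
    have h2 := h1.hasDerivWithinAt.smul (h.hasDerivWithinAt x hr.1.le)
    refine (h2.congr_deriv ?_).mono Set.Ioi_subset_Ici_self
    simp only [map_add, map_smul, smul_neg, smul_add, smul_smul, Complex.ofReal_mul]
    abel
  have hc : ContinuousOn (fun r => (Real.exp (r * H.E x) : ℂ) • P r (H.b x)) (Set.Icc 0 t) :=
    (by fun_prop : Continuous fun r : ℝ => (Real.exp (r * H.E x) : ℂ)).continuousOn.smul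
      (h.continuousOn_comp continuous_const)
  have hi : IntervalIntegrable (fun r => -((Real.exp (r * H.E x) : ℂ) • P r (V (H.b x))))
      volume 0 t := by
    refine ContinuousOn.intervalIntegrable ?_
    rw [Set.uIcc_of_le ht]
    exact ((by fun_prop : Continuous fun r : ℝ => (Real.exp (r * H.E x) : ℂ)).continuousOn.smul
      (h.continuousOn_comp continuous_const)).neg
  have key := intervalIntegral.integral_eq_sub_of_hasDeriv_right_of_le ht hc hd hi
  simp only [zero_mul, Real.exp_zero, Complex.ofReal_one, one_smul, h.zero,
    one_apply_eq_self, intervalIntegral.integral_neg] at key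
  have e : (∫ r in (0 : ℝ)..t, P r (V (H.T (t - r) (H.b x)))) = (Real.exp (-t * H.E x) : ℂ) •
      ∫ r in (0 : ℝ)..t, (Real.exp (r * H.E x) : ℂ) • P r (V (H.b x)) := by
    rw [← intervalIntegral.integral_smul]
    refine intervalIntegral.integral_congr fun r hr => ?_
    rw [Set.uIcc_of_le ht] at hr
    rw [H.T_b (by linarith [hr.2]), map_smul, map_smul, smul_smul, ← Complex.ofReal_mul,
      ← Real.exp_add]
    congr 3
    ring
  rw [neg_eq_iff_eq_neg] at key
  rw [e, H.T_b ht, ← smul_sub, key, sub_neg_eq_add, add_sub_cancel, smul_smul,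
    ← Complex.ofReal_mul, ← Real.exp_add]
  simp

/-- The mild (Duhamel) equation, in the form in which the perturbed semigroup acts last. -/
theorem IsSemigroup.eq_sub_integral {H : DiagHam X 𝓗} (h : H.IsSemigroup V P) {t : ℝ}
    (ht : 0 ≤ t) (v : 𝓗) :
    P t v = H.T t v - ∫ r in (0 : ℝ)..t, P r (V (H.T (t - r) v)) := by
  obtain ⟨M, hM0, hM⟩ := h.exists_norm_le t
  have hi : ∀ v, IntervalIntegrable (fun r => P r (V (H.T (t - r) v))) volume 0 t := by
    intro v
    refine ContinuousOn.intervalIntegrable ?_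
    rw [Set.uIcc_of_le ht]
    exact h.continuousOn_comp (V.continuous.comp
      (H.continuous_T_comp (by fun_prop) continuous_const))
  -- Both sides are bounded operators, and they agree on a total set.
  let R : 𝓗 →L[ℂ] 𝓗 := LinearMap.mkContinuous
    { toFun := fun v => ∫ r in (0 : ℝ)..t, P r (V (H.T (t - r) v))
      map_add' := fun v w => by
        simp only [map_add]
        exact intervalIntegral.integral_add (hi v) (hi w)
      map_smul' := fun c v => by
        simp only [map_smul]
        exact intervalIntegral.integral_smul c _ } (M * (‖V‖ * Real.exp (H.μ * t)) * t) fun v => by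
      change ‖∫ r in (0 : ℝ)..t, P r (V (H.T (t - r) v))‖ ≤ _
      have := intervalIntegral.norm_integral_le_of_norm_le_const (a := 0) (b := t)
        (f := fun r => P r (V (H.T (t - r) v))) (C := M * (‖V‖ * (Real.exp (H.μ * t) * ‖v‖)))
        fun r hr => ?_
      · refine this.trans (le_of_eq ?_)
        rw [sub_zero, abs_of_nonneg ht]
        ring
      · rw [Set.uIoc_of_le ht] at hr
        refine (P r).le_of_opNorm_le_of_le (hM r ⟨hr.1.le, hr.2⟩) (V.le_opNorm_of_le ?_)
        refine (H.norm_T_apply_le _ _).trans (mul_le_mul_of_nonneg_right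
          (Real.exp_le_exp.2 (mul_le_mul_of_nonneg_left (max_le (by linarith [hr.1]) ht)
            H.μ_nonneg)) (norm_nonneg _))
  have key : P t = H.T t - R := by
    refine ContinuousLinearMap.ext_on (s := Set.range H.b) ?_ ?_
    · exact Submodule.dense_iff_topologicalClosure_eq_top.2 H.b.dense_span
    · rintro _ ⟨x, rfl⟩
      exact h.apply_b x ht
  rw [key]
  rfl

/-- A Grönwall-type uniqueness principle for the mild equation. -/
theorem eq_zero_of_eq_integral {F : Type*} [NormedAddCommGroup F] [NormedSpace ℝ F]
    (G : ℝ → 𝓗 → F) {t₀ M : ℝ} (hM : ∀ t ∈ Set.Icc 0 t₀, ∀ v, ‖G t v‖ ≤ M * ‖v‖)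
    (hG : ∀ t ∈ Set.Icc 0 t₀, ∀ v, G t v = -∫ r in (0 : ℝ)..t, G r (V (H.T (t - r) v)))
    {t : ℝ} (ht : t ∈ Set.Icc 0 t₀) (v : 𝓗) : G t v = 0 := by
  set L := ‖V‖ * Real.exp (H.μ * t₀) with hL
  have hL0 : 0 ≤ L := by positivity
  -- Iterating the equation, the bound `M` improves to `M (L t)^m / m!`.
  have key : ∀ m : ℕ, ∀ t ∈ Set.Icc 0 t₀, ∀ v,
      ‖G t v‖ ≤ M * L ^ m / m.factorial * ‖v‖ * t ^ m := by
    intro m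
    induction m with
    | zero => simpa using hM
    | succ m ih =>
      intro t ht v
      rw [hG t ht v, norm_neg]
      refine (intervalIntegral.norm_integral_le_of_norm_le (g := fun r =>
        M * L ^ (m + 1) / m.factorial * ‖v‖ * r ^ m) ht.1 (Eventually.of_forall fun r hr => ?_)
        (Continuous.intervalIntegrable (by fun_prop) _ _)).trans (le_of_eq ?_)
      · have hr' : r ∈ Set.Icc 0 t₀ := ⟨hr.1.le, hr.2.trans ht.2⟩
        have h0 := ih r hr' (V (H.T (t - r) v))
        have h1 : ‖V (H.T (t - r) v)‖ ≤ L * ‖v‖ := by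
          rw [hL, mul_assoc]
          refine V.le_opNorm_of_le ((H.norm_T_apply_le _ _).trans (mul_le_mul_of_nonneg_right
            (Real.exp_le_exp.2 (mul_le_mul_of_nonneg_left (max_le ?_ (ht.1.trans ht.2))
              H.μ_nonneg)) (norm_nonneg _)))
          linarith [hr.1, ht.2]
        have hM0 : 0 ≤ M * L ^ m / m.factorial * r ^ m ∨ ‖V (H.T (t - r) v)‖ = 0 := by
          rcases (norm_nonneg (V (H.T (t - r) v))).eq_or_lt with h | h
          · exact Or.inr h.symm
          · left
            have := (norm_nonneg _).trans h0
            rw [mul_right_comm] at this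
            exact nonneg_of_mul_nonneg_left this h
        rcases hM0 with hM0 | hz
        · calc _ ≤ M * L ^ m / m.factorial * r ^ m * ‖V (H.T (t - r) v)‖ := by
                rw [mul_right_comm]; exact h0
            _ ≤ M * L ^ m / m.factorial * r ^ m * (L * ‖v‖) :=
                mul_le_mul_of_nonneg_left h1 hM0
            _ = _ := by ring
        · rw [hz, mul_zero, zero_mul] at h0
          refine h0.trans ?_
          rcases (norm_nonneg v).eq_or_lt with h | h
          · rw [← h]; simp
          · have hMp : 0 ≤ M := nonneg_of_mul_nonneg_left ((norm_nonneg _).trans (hM t ht v)) h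
            have := hr.1.le
            positivity
      · rw [intervalIntegral.integral_const_mul, integral_pow, Nat.factorial_succ]
        have h1 : (m.factorial : ℝ) ≠ 0 := by exact_mod_cast m.factorial_ne_zero
        have h2 : (m : ℝ) + 1 ≠ 0 := by positivity
        push_cast
        field_simp
        simp
  have hlim : Tendsto (fun m : ℕ => M * ‖v‖ * ((L * t) ^ m / m.factorial)) atTop (𝓝 0) := by
    simpa using (FloorSemiring.tendsto_pow_div_factorial_atTop (L * t)).const_mul (M * ‖v‖)
  have := ge_of_tendsto' hlim fun m => (key m t ht v).trans (le_of_eq (by rw [mul_pow]; ring))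
  exact norm_le_zero_iff.1 this

/-- The semigroup generated by `-(H + V)` is unique. -/
theorem IsSemigroup.eq_Q {H : DiagHam X 𝓗} (h : H.IsSemigroup V P) {t : ℝ} (ht : 0 ≤ t) :
    P t = H.Q V t := by
  obtain ⟨M, hM0, hM⟩ := h.exists_norm_le t
  obtain ⟨M', hM0', hM'⟩ := (H.isSemigroup_Q V).exists_norm_le t
  ext v
  rw [← sub_eq_zero]
  refine H.eq_zero_of_eq_integral (V := V) (fun r v => P r v - H.Q V r v) (t₀ := t) (M := M + M')
    (fun r hr w => ?_) (fun r hr w => ?_) ⟨ht, le_rfl⟩ v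
  · rw [add_mul]
    exact (norm_sub_le _ _).trans (add_le_add ((P r).le_of_opNorm_le (hM r hr) w)
      ((H.Q V r).le_of_opNorm_le (hM' r hr) w))
  · have hi : ∀ {P'}, H.IsSemigroup V P' →
        IntervalIntegrable (fun s => P' s (V (H.T (r - s) w))) volume 0 r := by
      intro P' h'
      refine ContinuousOn.intervalIntegrable ?_
      rw [Set.uIcc_of_le hr.1]
      exact h'.continuousOn_comp (V.continuous.comp
        (H.continuous_T_comp (by fun_prop) continuous_const))
    rw [intervalIntegral.integral_sub (hi h) (hi (H.isSemigroup_Q V)), h.eq_sub_integral hr.1 w,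
      (H.isSemigroup_Q V).eq_sub_integral hr.1 w]
    abel

/-- The perturbed semigroup is self-adjoint. The adjoint of the mild equation with `Q` acting last
is the one with `Q` acting first, so that the difference of the two sides satisfies the homogeneous
mild equation. -/
theorem inner_Q_symm (hV : IsSelfAdjoint V) {t : ℝ} (ht : 0 ≤ t) (v w : 𝓗) :
    ⟪v, H.Q V t w⟫_ℂ = ⟪H.Q V t v, w⟫_ℂ := by
  obtain ⟨M, hM0, hM⟩ := (H.isSemigroup_Q V).exists_norm_le t
  have hVs : ∀ v w, ⟪V v, w⟫_ℂ = ⟪v, V w⟫_ℂ := fun v w =>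
    (ContinuousLinearMap.isSelfAdjoint_iff_isSymmetric.1 hV) v w
  rw [eq_comm, ← sub_eq_zero]
  refine H.eq_zero_of_eq_integral (V := V) (F := ℂ)
    (fun r v => ⟪H.Q V r v, w⟫_ℂ - ⟪v, H.Q V r w⟫_ℂ) (t₀ := t) (M := 2 * M * ‖w‖)
    (fun r hr u => ?_) (fun r hr u => ?_) ⟨ht, le_rfl⟩ v
  · have h1 : ‖⟪H.Q V r u, w⟫_ℂ‖ ≤ M * ‖u‖ * ‖w‖ := (norm_inner_le_norm _ _).trans
      (mul_le_mul_of_nonneg_right ((H.Q V r).le_of_opNorm_le (hM r hr) u) (norm_nonneg _))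
    have h2 : ‖⟪u, H.Q V r w⟫_ℂ‖ ≤ ‖u‖ * (M * ‖w‖) := (norm_inner_le_norm _ _).trans
      (mul_le_mul_of_nonneg_left ((H.Q V r).le_of_opNorm_le (hM r hr) w) (norm_nonneg _))
    refine (norm_sub_le _ _).trans ((add_le_add h1 h2).trans (le_of_eq ?_))
    ring
  · have c1 : IntervalIntegrable (fun s => H.Q V s (V (H.T (r - s) u))) volume 0 r := by
      refine ContinuousOn.intervalIntegrable ?_
      rw [Set.uIcc_of_le hr.1]
      exact (H.isSemigroup_Q V).continuousOn_comp (V.continuous.comp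
        (H.continuous_T_comp (by fun_prop) continuous_const))
    have c0 : Continuous fun s => H.T (r - s) (V (H.Q V s w)) :=
      H.continuous_T_comp (by fun_prop) (V.continuous.comp (H.continuous_Q_apply V w))
    have c2 := c0.intervalIntegrable 0 r (μ := volume)
    have c3 : IntervalIntegrable (fun s => ⟪H.Q V s (V (H.T (r - s) u)), w⟫_ℂ) volume 0 r := by
      refine ContinuousOn.intervalIntegrable ?_
      rw [Set.uIcc_of_le hr.1]
      exact ((H.isSemigroup_Q V).continuousOn_comp (V.continuous.comp
        (H.continuous_T_comp (by fun_prop) continuous_const))).inner continuousOn_const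
    have c4 : IntervalIntegrable (fun s => ⟪u, H.T (r - s) (V (H.Q V s w))⟫_ℂ) volume 0 r :=
      Continuous.intervalIntegrable (by fun_prop) _ _
    have i1 := intervalIntegral_inner_left c1 w
    have i2 := intervalIntegral_inner_right c2 u
    have i3 : ∀ s, ⟪V (H.T (r - s) u), H.Q V s w⟫_ℂ = ⟪u, H.T (r - s) (V (H.Q V s w))⟫_ℂ :=
      fun s => by rw [H.inner_T_symm, hVs]
    simp only [i3]
    rw [intervalIntegral.integral_sub c3 c4, (H.isSemigroup_Q V).eq_sub_integral hr.1 u,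
      H.Q_eq_sub_integral V hr.1 w, inner_sub_left, inner_sub_right, i1, i2, H.inner_T_symm]
    ring

theorem inner_Q_self (hV : IsSelfAdjoint V) {t : ℝ} (ht : 0 ≤ t) (v w : 𝓗) :
    ⟪v, H.Q V (t + t) w⟫_ℂ = ⟪H.Q V t v, H.Q V t w⟫_ℂ := by
  rw [H.Q_add V ht ht, mul_apply_eq_comp, H.inner_Q_symm hV ht]

/-- The perturbed semigroup is injective: a vector in the kernel of `Q t` is in the kernel of
`Q (t / 2 ^ m)` for all `m`, and the semigroup is strongly continuous at `0`. -/
theorem Q_injective (hV : IsSelfAdjoint V) {t : ℝ} (ht : 0 ≤ t) {v : 𝓗} (h : H.Q V t v = 0) :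
    v = 0 := by
  have key : ∀ m : ℕ, H.Q V (t / 2 ^ m) v = 0 := by
    intro m
    induction m with
    | zero => simpa using h
    | succ m ih =>
      have e : t / 2 ^ m = t / 2 ^ (m + 1) + t / 2 ^ (m + 1) := by
        rw [pow_succ]; field_simp; norm_num
      have h1 := H.inner_Q_self hV (t := t / 2 ^ (m + 1)) (by positivity) v v
      rw [← e, ih, inner_zero_right] at h1
      exact inner_self_eq_zero.1 h1.symm
  have h1 : Tendsto (fun m : ℕ => t / 2 ^ m) atTop (𝓝 0) := by
    simpa [div_eq_mul_inv] using
      (tendsto_pow_atTop_nhds_zero_of_lt_one (r := (2 : ℝ)⁻¹) (by norm_num) (by norm_num)).const_mul t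
  have h2 := ((H.continuous_Q_apply V v).tendsto 0).comp h1
  simp only [Function.comp_def, key, Q_zero, one_apply_eq_self] at h2
  exact (tendsto_nhds_unique h2 tendsto_const_nhds)

end DiagHam

/-! ### Hilbert–Schmidt bounds on the Dyson series -/

open scoped ENNReal in
/-- The squared Hilbert–Schmidt norm `∑ₓ ‖M bₓ‖²` of `M`, as an extended nonnegative real. -/
noncomputable def HilbertBasis.hs {X 𝓗 : Type*} [NormedAddCommGroup 𝓗] [InnerProductSpace ℂ 𝓗]
    (b : HilbertBasis X ℂ 𝓗) (M : 𝓗 →L[ℂ] 𝓗) : ℝ≥0∞ := ∑' x, ‖M (b x)‖ₑ ^ 2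

section HilbertSchmidt

open scoped ENNReal

variable {X 𝓗 : Type*} [NormedAddCommGroup 𝓗] [InnerProductSpace ℂ 𝓗] [CompleteSpace 𝓗]

theorem HilbertBasis.tsum_sq_enorm_inner (b : HilbertBasis X ℂ 𝓗) (v : 𝓗) :
    ∑' x, ‖⟪b x, v⟫_ℂ‖ₑ ^ 2 = ‖v‖ₑ ^ 2 := by
  have h := b.hasSum_sq_norm_inner v
  have e : ∀ z : ℂ, ‖z‖ₑ ^ 2 = ENNReal.ofReal (‖z‖ ^ 2) := fun z => by
    rw [ENNReal.ofReal_pow (norm_nonneg _), ofReal_norm]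
  simp only [e]
  rw [← ENNReal.ofReal_tsum_of_nonneg (fun _ => by positivity) h.summable, h.tsum_eq,
    ENNReal.ofReal_pow (norm_nonneg _), ofReal_norm]

variable (b : HilbertBasis X ℂ 𝓗)

theorem HilbertBasis.hs_eq (M : 𝓗 →L[ℂ] 𝓗) :
    b.hs M = ∑' x, ∑' y, ‖⟪b y, M (b x)⟫_ℂ‖ₑ ^ 2 := by
  simp only [hs, b.tsum_sq_enorm_inner]

theorem HilbertBasis.hs_adjoint (M : 𝓗 →L[ℂ] 𝓗) : b.hs M.adjoint = b.hs M := by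
  rw [hs_eq, hs_eq, ENNReal.tsum_comm]
  refine tsum_congr fun x => tsum_congr fun y => ?_
  rw [ContinuousLinearMap.adjoint_inner_right, ← inner_conj_symm, RCLike.enorm_conj]

theorem HilbertBasis.hs_mul_left_le (W M : 𝓗 →L[ℂ] 𝓗) : b.hs (W * M) ≤ ‖W‖ₑ ^ 2 * b.hs M := by
  rw [hs, hs, ← ENNReal.tsum_mul_left]
  refine ENNReal.tsum_le_tsum fun x => ?_
  rw [← mul_pow]
  exact pow_le_pow_left' (W.le_opENorm (M (b x))) 2

theorem HilbertBasis.hs_mul_right_le (W M : 𝓗 →L[ℂ] 𝓗) : b.hs (M * W) ≤ ‖W‖ₑ ^ 2 * b.hs M := by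
  rw [← b.hs_adjoint (M * W), ← b.hs_adjoint M]
  have e : (M * W).adjoint = W.adjoint * M.adjoint := ContinuousLinearMap.adjoint_comp M W
  rw [e]
  refine (b.hs_mul_left_le _ _).trans (le_of_eq ?_)
  congr 2
  rw [← ofReal_norm, ← ofReal_norm, LinearIsometryEquiv.norm_map]

/-- The Cauchy–Schwarz inequality. -/
theorem sq_lintegral_le {α : Type*} [MeasurableSpace α] (ν : Measure α) {g : α → ℝ≥0∞}
    (hg : AEMeasurable g ν) : (∫⁻ s, g s ∂ν) ^ 2 ≤ ν Set.univ * ∫⁻ s, g s ^ 2 ∂ν := by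
  have h := ENNReal.lintegral_mul_le_Lp_mul_Lq ν (p := 2) (q := 2)
    ⟨by norm_num, by norm_num, by norm_num⟩ hg (aemeasurable_const (b := (1 : ℝ≥0∞)))
  simp only [Pi.mul_apply, mul_one, ENNReal.one_rpow, lintegral_const, one_mul] at h
  have h2 := pow_le_pow_left' h 2
  rw [mul_pow, ← ENNReal.rpow_natCast (_ ^ _), ← ENNReal.rpow_natCast (ν Set.univ ^ _),
    ← ENNReal.rpow_mul, ← ENNReal.rpow_mul] at h2
  norm_num at h2
  rwa [mul_comm]

theorem sq_enorm_intervalIntegral_le {F : Type*} [NormedAddCommGroup F] [NormedSpace ℝ F] {t : ℝ}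
    (ht : 0 ≤ t) {f : ℝ → F} (hf : AEStronglyMeasurable f) :
    ‖∫ s in (0 : ℝ)..t, f s‖ₑ ^ 2 ≤ ENNReal.ofReal t * ∫⁻ s in Set.Ioc 0 t, ‖f s‖ₑ ^ 2 := by
  rw [intervalIntegral.integral_of_le ht]
  refine (pow_le_pow_left' (enorm_integral_le_lintegral_enorm _) 2).trans
    ((sq_lintegral_le _ hf.restrict.enorm).trans (le_of_eq ?_))
  simp

end HilbertSchmidt

namespace DiagHam

open scoped ENNReal

variable {X 𝓗 : Type*} [NormedAddCommGroup 𝓗] [InnerProductSpace ℂ 𝓗] [CompleteSpace 𝓗]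
  (H : DiagHam X 𝓗) (V : 𝓗 →L[ℂ] 𝓗)

/-- Moving the Boltzmann factors on both sides of `M` to the side with the lower energy:
`e^{-2aE-2bE'} ≤ e^{-2(a+b)E} + e^{-2(a+b)E'}`. -/
theorem hs_T_mul_T_le {a c : ℝ} (ha : 0 ≤ a) (hc : 0 ≤ c) (M : 𝓗 →L[ℂ] 𝓗) :
    H.b.hs (H.T a * M * H.T c) ≤ H.b.hs (H.T (a + c) * M) + H.b.hs (M * H.T (a + c)) := by
  rw [HilbertBasis.hs_eq, HilbertBasis.hs_eq, HilbertBasis.hs_eq, ← ENNReal.tsum_add]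
  refine ENNReal.tsum_le_tsum fun x => ?_
  rw [← ENNReal.tsum_add]
  refine ENNReal.tsum_le_tsum fun y => ?_
  have hac := add_nonneg ha hc
  simp only [mul_apply_eq_comp, H.T_b hc, H.T_b hac, map_smul, inner_smul_right, H.inner_T ha,
    H.inner_T hac, enorm_mul, mul_pow, ← mul_assoc]
  rw [← add_mul]
  refine mul_le_mul_left ?_ _
  have e : ∀ r : ℝ, ‖((Real.exp r : ℝ) : ℂ)‖ₑ = ENNReal.ofReal (Real.exp r) := fun r => by
    rw [← ofReal_norm, Complex.norm_real, Real.norm_of_nonneg (Real.exp_pos _).le]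
  simp only [e]
  rw [← mul_pow, ← ENNReal.ofReal_mul (Real.exp_pos _).le, ← Real.exp_add]
  rcases le_total (H.E x) (H.E y) with h | h
  · refine le_trans ?_ le_add_self
    refine pow_le_pow_left' (ENNReal.ofReal_le_ofReal (Real.exp_le_exp.2 ?_)) 2
    nlinarith [mul_le_mul_of_nonneg_left h ha]
  · refine le_trans ?_ le_self_add
    refine pow_le_pow_left' (ENNReal.ofReal_le_ofReal (Real.exp_le_exp.2 ?_)) 2
    nlinarith [mul_le_mul_of_nonneg_left h hc]

/-- The product `T(a₁) W₁ T(a₂) W₂ ⋯ T(aₖ) Wₖ`. -/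
noncomputable def word (L : List (ℝ × (𝓗 →L[ℂ] 𝓗))) : 𝓗 →L[ℂ] 𝓗 :=
  (L.map fun p => H.T p.1 * p.2).prod

/-- A product of bounded operators with Boltzmann factors of total inverse temperature `τ` in
between has the Hilbert–Schmidt bound of `e^{-τH}`. The two outermost Boltzmann factors are merged,
on the left or on the right; then one bounded operator stands at an end of the product and can be
split off, and a shorter product is left. -/
theorem hs_word_le {Λ : ℝ≥0∞} {τ : ℝ} (k : ℕ) : ∀ (L : List (ℝ × (𝓗 →L[ℂ] 𝓗))) (c : ℝ),
    L.length = k → 0 ≤ c → (∀ p ∈ L, 0 ≤ p.1 ∧ ‖p.2‖ₑ ≤ Λ) → (L.map Prod.fst).sum + c = τ →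
    H.b.hs (H.word L * H.T c) ≤ (2 * Λ ^ 2) ^ k * H.b.hs (H.T τ) := by
  induction k with
  | zero =>
    intro L c hL hc hp hs
    rw [List.length_eq_zero_iff] at hL
    subst hL
    simp only [List.map_nil, List.sum_nil, zero_add] at hs
    simp [word, hs]
  | succ k ih =>
    intro L c hL hc hp hs
    obtain ⟨⟨a, W⟩, L', rfl⟩ := List.exists_cons_of_length_eq_add_one hL
    have ha : 0 ≤ a := (hp (a, W) (by simp)).1
    have hW : ‖W‖ₑ ≤ Λ := (hp (a, W) (by simp)).2
    have hac := add_nonneg ha hc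
    have two : ∀ z : ℝ≥0∞, Λ ^ 2 * ((2 * Λ ^ 2) ^ k * z) + Λ ^ 2 * ((2 * Λ ^ 2) ^ k * z) =
        (2 * Λ ^ 2) ^ (k + 1) * z := fun z => by ring
    rw [← two]
    rcases List.eq_nil_or_concat L' with rfl | ⟨L'', ⟨a', W'⟩, rfl⟩
    · obtain rfl : k = 0 := by simpa using hL.symm
      simp only [List.map_cons, List.map_nil, List.sum_cons, List.sum_nil, add_zero] at hs
      have e : H.word [(a, W)] * H.T c = H.T a * W * H.T c := by simp [word]
      rw [e]
      refine (H.hs_T_mul_T_le ha hc W).trans ?_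
      rw [hs, pow_zero, one_mul]
      exact add_le_add ((H.b.hs_mul_right_le _ _).trans
        (mul_le_mul_left (pow_le_pow_left' hW 2) _)) ((H.b.hs_mul_left_le _ _).trans
        (mul_le_mul_left (pow_le_pow_left' hW 2) _))
    · have hW' : ‖W'‖ₑ ≤ Λ := (hp (a', W') (by simp)).2
      have ha' : 0 ≤ a' := (hp (a', W') (by simp)).1
      have e : H.word ((a, W) :: L''.concat (a', W')) * H.T c =
          H.T a * (W * H.word L'' * H.T a' * W') * H.T c := by
        simp [word, mul_assoc]
      have e1 : H.T (a + c) * (W * H.word L'' * H.T a' * W') =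
          (H.word ((a + c, W) :: L'') * H.T a') * W' := by
        simp [word, mul_assoc]
      have e2 : (W * H.word L'' * H.T a' * W') * H.T (a + c) =
          W * (H.word (L''.concat (a', W')) * H.T (a + c)) := by
        simp [word, mul_assoc]
      simp only [List.length_cons, List.length_concat, Nat.add_right_cancel_iff] at hL
      simp only [List.map_cons, List.sum_cons, List.concat_eq_append, List.map_append,
        List.sum_append, List.map_nil, List.sum_nil, add_zero] at hs
      rw [e]
      refine (H.hs_T_mul_T_le ha hc _).trans ?_
      rw [e1, e2]
      refine add_le_add ((H.b.hs_mul_right_le _ _).trans (mul_le_mul'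
        (pow_le_pow_left' hW' 2) (ih _ a' ?_ ha' ?_ ?_))) ((H.b.hs_mul_left_le _ _).trans
        (mul_le_mul' (pow_le_pow_left' hW 2) (ih _ (a + c) ?_ hac ?_ ?_)))
      · simpa using hL
      · intro p hp'
        rcases List.mem_cons.1 hp' with rfl | hp'
        · exact ⟨hac, hW⟩
        · exact hp p (by simp [hp'])
      · simp only [List.map_cons, List.sum_cons]
        linarith
      · simpa using hL
      · intro p hp'
        exact hp p (List.mem_cons_of_mem _ hp')
      · simp only [List.concat_eq_append, List.map_append, List.map_cons, List.map_nil,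
          List.sum_append, List.sum_cons, List.sum_nil]
        linarith

/-- A Dyson term is a time-ordered integral of words. Keeping a word in front of it lets the
induction on the order absorb one more factor `T (t - s) V` under the integral. -/
theorem hs_word_mul_dyson_le {Λ : ℝ≥0∞} (hV : ‖V‖ₑ ≤ Λ) {τ : ℝ} (m : ℕ) :
    ∀ (L : List (ℝ × (𝓗 →L[ℂ] 𝓗))) (t : ℝ), 0 ≤ t →
    (∀ p ∈ L, 0 ≤ p.1 ∧ ‖p.2‖ₑ ≤ Λ) → (L.map Prod.fst).sum + t = τ →
    H.b.hs (H.word L * H.dyson V m t) ≤ (2 * Λ ^ 2) ^ (L.length + m) * H.b.hs (H.T τ) *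
      ENNReal.ofReal ((τ * t) ^ m / m.factorial) := by
  induction m with
  | zero =>
    intro L t ht hp hs
    simpa [dyson_zero] using H.hs_word_le _ L t rfl ht hp hs
  | succ m ih =>
    intro L t ht hp hs
    have hL0 : 0 ≤ (L.map Prod.fst).sum := List.sum_nonneg (by
      intro a ha
      obtain ⟨p, hp', rfl⟩ := List.mem_map.1 ha
      exact (hp p hp').1)
    have htτ : t ≤ τ := by linarith
    have hτ : 0 ≤ τ := ht.trans htτ
    set K : ℝ≥0∞ := (2 * Λ ^ 2) ^ (L.length + (m + 1)) * H.b.hs (H.T τ) with hK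
    have hb : ∀ s ∈ Set.Ioc 0 t, H.b.hs (H.word L * (H.T (t - s) * (V * H.dyson V m s))) ≤
        K * ENNReal.ofReal ((τ * s) ^ m / m.factorial) := by
      intro s hs'
      have h1 := ih (L.concat (t - s, V)) s hs'.1.le ?_ ?_
      · have e : H.word (L.concat (t - s, V)) * H.dyson V m s =
            H.word L * (H.T (t - s) * (V * H.dyson V m s)) := by simp [word, mul_assoc]
        rw [e, List.length_concat] at h1
        rwa [hK, show L.length + (m + 1) = L.length + 1 + m by ring]
      · intro p hp'
        rw [List.concat_eq_append, List.mem_append, List.mem_singleton] at hp'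
        rcases hp' with hp' | rfl
        · exact hp p hp'
        · exact ⟨sub_nonneg.2 hs'.2, hV⟩
      · simp only [List.concat_eq_append, List.map_append, List.map_cons, List.map_nil,
          List.sum_append, List.sum_cons, List.sum_nil]
        linarith
    have hc : ∀ x, Continuous fun s =>
        (H.word L * (H.T (t - s) * (V * H.dyson V m s))) (H.b x) := fun x =>
      (H.word L).continuous.comp (H.continuous_T_dyson V m t (H.b x))
    calc H.b.hs (H.word L * H.dyson V (m + 1) t)
        ≤ ∑' x, ENNReal.ofReal t * ∫⁻ s in Set.Ioc 0 t,
            ‖(H.word L * (H.T (t - s) * (V * H.dyson V m s))) (H.b x)‖ₑ ^ 2 := by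
          refine ENNReal.tsum_le_tsum fun x => ?_
          rw [mul_apply_eq_comp, H.dyson_succ V ht, map_neg, enorm_neg,
            ← ContinuousLinearMap.intervalIntegral_comp_comm _
              ((H.continuous_T_dyson V m t _).intervalIntegrable _ _)]
          exact sq_enorm_intervalIntegral_le ht (hc x).aestronglyMeasurable
      _ ≤ ENNReal.ofReal t * ∫⁻ s in Set.Ioc 0 t,
            H.b.hs (H.word L * (H.T (t - s) * (V * H.dyson V m s))) := by
          rw [ENNReal.tsum_mul_left]
          gcongr ENNReal.ofReal t * ?_
          rw [ENNReal.tsum_eq_iSup_sum]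
          refine iSup_le fun F => ?_
          rw [← lintegral_finsetSum' _ fun x _ => ((hc x).enorm.measurable.pow_const 2).aemeasurable]
          exact lintegral_mono fun s => ENNReal.sum_le_tsum F
      _ ≤ ENNReal.ofReal t * ∫⁻ s in Set.Ioc 0 t,
            K * ENNReal.ofReal ((τ * s) ^ m / m.factorial) := by
          gcongr ENNReal.ofReal t * ?_
          exact setLIntegral_mono' measurableSet_Ioc hb
      _ = K * ENNReal.ofReal (t * ∫ s in (0 : ℝ)..t, (τ * s) ^ m / m.factorial) := by
          rw [lintegral_const_mul _ (by fun_prop), ENNReal.ofReal_mul ht,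
            intervalIntegral.integral_of_le ht, ofReal_integral_eq_lintegral_ofReal]
          · ring
          · exact (Continuous.integrableOn_Icc (by fun_prop)).mono_set Set.Ioc_subset_Icc_self
          · filter_upwards [ae_restrict_mem measurableSet_Ioc] with s hs'
            have := hs'.1.le
            positivity
      _ ≤ _ := by
          gcongr K * ENNReal.ofReal ?_
          have h1 : (m.factorial : ℝ) ≠ 0 := by exact_mod_cast m.factorial_ne_zero
          have h2 : (m : ℝ) + 1 ≠ 0 := by positivity
          simp only [mul_pow, div_eq_mul_inv]
          rw [intervalIntegral.integral_mul_const, intervalIntegral.integral_const_mul,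
            integral_pow, Nat.factorial_succ]
          have e : t * (τ ^ m * ((t ^ (m + 1) - 0 ^ (m + 1)) / (m + 1)) * (m.factorial : ℝ)⁻¹) =
              τ ^ m * t ^ (m + 1) * (((m + 1 : ℕ) * m.factorial : ℕ) : ℝ)⁻¹ * t := by
            push_cast
            field_simp
            simp
          rw [e, pow_succ τ]
          have : 0 ≤ τ ^ m * t ^ (m + 1) * (((m + 1 : ℕ) * m.factorial : ℕ) : ℝ)⁻¹ := by positivity
          nlinarith [mul_le_mul_of_nonneg_left htτ this]

/-- The bound `√((2Λ²)^m Z (τ²)^m / m!)` on the Hilbert–Schmidt norm of the `m`-th Dyson term. -/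
noncomputable def hsBound (Λ τ Z : ℝ) (m : ℕ) : ℝ :=
  √((2 * Λ ^ 2) ^ m * Z * ((τ * τ) ^ m / m.factorial))

theorem summable_hsBound {Λ τ Z : ℝ} (hZ : 0 ≤ Z) {r : ℝ} (hr : 0 ≤ r) :
    Summable fun m => r ^ m * hsBound Λ τ Z m := by
  -- The terms are square roots. By the inequality of arithmetic and geometric means, `r^m √a ≤ 4^m
  -- r^{2m} a + 4^{-m}`.
  have h1 : Summable fun m : ℕ => Z * ((4 * r ^ 2 * (2 * Λ ^ 2) * (τ * τ)) ^ m /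
      m.factorial) + (1 / 4 : ℝ) ^ m :=
    ((Real.summable_pow_div_factorial _).mul_left _).add
      (summable_geometric_of_lt_one (by norm_num) (by norm_num))
  refine Summable.of_nonneg_of_le (fun m => by unfold hsBound; positivity) (fun m => ?_) h1
  set a := (2 * Λ ^ 2) ^ m * Z * ((τ * τ) ^ m / m.factorial) with ha
  have ha0 : 0 ≤ a := by
    have := mul_self_nonneg τ
    positivity
  have e : Z * ((4 * r ^ 2 * (2 * Λ ^ 2) * (τ * τ)) ^ m / m.factorial) =
      (2 ^ m * (r ^ m * √a)) ^ 2 := by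
    have e4 : ((2 : ℝ) ^ m) ^ 2 = 4 ^ m := by rw [← pow_mul, mul_comm, pow_mul]; norm_num
    have e5 : (2 ^ m * (r ^ m * √a)) ^ 2 = 4 ^ m * ((r ^ m) ^ 2 * a) := by
      rw [mul_pow, mul_pow, Real.sq_sqrt ha0, e4]
    rw [e5, ha, mul_pow, mul_pow, mul_pow, ← pow_mul r, ← pow_mul r,
      mul_comm m 2]
    ring
  have e2 : (1 / 4 : ℝ) ^ m = ((1 / 2) ^ m) ^ 2 := by
    rw [← pow_mul, mul_comm, pow_mul]; norm_num
  have e3 : r ^ m * √a = (2 ^ m * (r ^ m * √a)) * (1 / 2) ^ m := by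
    rw [one_div, inv_pow]
    field_simp
  rw [e, e2, hsBound, ← ha]
  nlinarith [two_mul_le_add_sq (2 ^ m * (r ^ m * √a)) ((1 / 2) ^ m),
    sq_nonneg (2 ^ m * (r ^ m * √a)), sq_nonneg ((1 / 2 : ℝ) ^ m)]

variable {H}

/-- The squared Hilbert–Schmidt norm of `e^{-τH}` is the partition function at inverse temperature
`2τ`. -/
theorem hs_T_eq {τ : ℝ} (hτ : 0 ≤ τ) (hZ : Summable fun x => Real.exp (-(τ + τ) * H.E x)) :
    H.b.hs (H.T τ) = ENNReal.ofReal (∑' x, Real.exp (-(τ + τ) * H.E x)) := by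
  rw [ENNReal.ofReal_tsum_of_nonneg (fun _ => (Real.exp_pos _).le) hZ]
  refine tsum_congr fun x => ?_
  rw [H.T_b hτ, enorm_smul, mul_pow, ← ofReal_norm (H.b x), H.b.orthonormal.1 x, ← ofReal_norm,
    Complex.norm_real, Real.norm_of_nonneg (Real.exp_pos _).le, ENNReal.ofReal_one, one_pow,
    mul_one, ← ENNReal.ofReal_pow (Real.exp_pos _).le, ← Real.exp_nat_mul]
  congr 2
  push_cast
  ring

theorem hs_dyson_le {τ : ℝ} (hτ : 0 ≤ τ) (hZ : Summable fun x => Real.exp (-(τ + τ) * H.E x))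
    (m : ℕ) : H.b.hs (H.dyson V m τ) ≤
      ENNReal.ofReal (hsBound ‖V‖ τ (∑' x, Real.exp (-(τ + τ) * H.E x)) m ^ 2) := by
  have hV : ‖V‖ₑ ≤ ENNReal.ofReal ‖V‖ := (ofReal_norm V).ge
  have h := H.hs_word_mul_dyson_le V hV (τ := τ) m [] τ hτ (by simp) (by simp)
  have hZ0 : 0 ≤ ∑' x, Real.exp (-(τ + τ) * H.E x) := tsum_nonneg fun _ => (Real.exp_pos _).le
  have e : H.word [] * H.dyson V m τ = H.dyson V m τ := by simp [word]
  rw [e, hs_T_eq hτ hZ] at h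
  refine h.trans (le_of_eq ?_)
  have hττ := mul_self_nonneg τ
  rw [hsBound, Real.sq_sqrt (by positivity), ENNReal.ofReal_mul (by positivity),
    ENNReal.ofReal_mul (by positivity), ENNReal.ofReal_pow (by positivity),
    ENNReal.ofReal_mul (by norm_num), ENNReal.ofReal_pow (norm_nonneg _), List.length_nil, zero_add]
  norm_num

theorem sum_sq_norm_le_of_hs_le {κ : Type*} (b : HilbertBasis X ℂ 𝓗) {M : 𝓗 →L[ℂ] 𝓗} {r : ℝ}
    (hr : 0 ≤ r) (h : b.hs M ≤ ENNReal.ofReal r) {x : κ → X} (hx : Function.Injective x)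
    (F : Finset κ) : ∑ k ∈ F, ‖M (b (x k))‖ ^ 2 ≤ r := by
  rw [← ENNReal.ofReal_le_ofReal_iff hr, ENNReal.ofReal_sum_of_nonneg fun _ _ => by positivity]
  refine le_trans ?_ h
  refine le_trans (le_of_eq ?_) ((ENNReal.sum_le_tsum (f := fun k => ‖M (b (x k))‖ₑ ^ 2) F).trans
    (ENNReal.tsum_comp_le_tsum_of_injective hx fun x => ‖M (b x)‖ₑ ^ 2))
  refine Finset.sum_congr rfl fun k _ => ?_
  rw [ENNReal.ofReal_pow (norm_nonneg _), ofReal_norm]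

/-- Matrix elements `⟨b_{x(k)}, D_N b_{y(k)}⟩` of the Dyson terms are jointly summable: write each
`D_N(2τ)` as `∑_{m+n=N} D_m(τ) D_n(τ)` and use that the factors are Hilbert–Schmidt. -/
theorem summable_inner_dyson {κ : Type*} {τ : ℝ} (hτ : 0 ≤ τ)
    (hZ : Summable fun x => Real.exp (-(τ + τ) * H.E x)) {x y : κ → X}
    (hx : Function.Injective x) (hy : Function.Injective y) {r : ℝ} (hr : 0 ≤ r) :
    Summable fun p : ℕ × κ =>
      r ^ p.1 * ‖⟪H.b (x p.2), H.dyson V p.1 (τ + τ) (H.b (y p.2))⟫_ℂ‖ := by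
  set Z := ∑' x, Real.exp (-(τ + τ) * H.E x) with hZdef
  have hZ0 : 0 ≤ Z := tsum_nonneg fun _ => (Real.exp_pos _).le
  set η := hsBound ‖V‖ τ Z with hη
  have hη0 : ∀ m, 0 ≤ η m := fun m => Real.sqrt_nonneg _
  have h1 : ∀ m F, ∑ k ∈ F, ‖(H.dyson V m τ).adjoint (H.b (x k))‖ ^ 2 ≤ η m ^ 2 := fun m F =>
    sum_sq_norm_le_of_hs_le H.b (sq_nonneg _)
      ((H.b.hs_adjoint _).le.trans (hs_dyson_le V hτ hZ m)) hx F
  have h2 : ∀ m F, ∑ k ∈ F, ‖H.dyson V m τ (H.b (y k))‖ ^ 2 ≤ η m ^ 2 := fun m F =>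
    sum_sq_norm_le_of_hs_le H.b (sq_nonneg _) (hs_dyson_le V hτ hZ m) hy F
  have h3 : ∀ m n F, ∑ k ∈ F, ‖(H.dyson V m τ).adjoint (H.b (x k))‖ *
      ‖H.dyson V n τ (H.b (y k))‖ ≤ η m * η n := fun m n F =>
    (Real.sum_mul_le_sqrt_mul_sqrt F _ _).trans (mul_le_mul
      (Real.sqrt_le_iff.2 ⟨hη0 m, h1 m F⟩) (Real.sqrt_le_iff.2 ⟨hη0 n, h2 n F⟩)
      (Real.sqrt_nonneg _) (hη0 m))
  -- Cauchy–Schwarz, for the product of two Hilbert–Schmidt operators.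
  have h4 : ∀ N (F : Finset κ), ∑ k ∈ F,
      r ^ N * ‖⟪H.b (x k), H.dyson V N (τ + τ) (H.b (y k))⟫_ℂ‖ ≤
      ∑ p ∈ Finset.HasAntidiagonal.antidiagonal N, (r ^ p.1 * η p.1) * (r ^ p.2 * η p.2) := by
    intro N F
    calc _ ≤ ∑ k ∈ F, ∑ p ∈ Finset.HasAntidiagonal.antidiagonal N, (r ^ p.1 * r ^ p.2) *
          (‖(H.dyson V p.1 τ).adjoint (H.b (x k))‖ * ‖H.dyson V p.2 τ (H.b (y k))‖) := by
          refine Finset.sum_le_sum fun k _ => ?_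
          rw [H.dyson_add V N hτ hτ, inner_sum]
          refine (mul_le_mul_of_nonneg_left (norm_sum_le _ _) (pow_nonneg hr _)).trans ?_
          rw [Finset.mul_sum]
          refine Finset.sum_le_sum fun p hp => ?_
          rw [← Finset.HasAntidiagonal.mem_antidiagonal.1 hp, pow_add, ← ContinuousLinearMap.adjoint_inner_left]
          exact mul_le_mul_of_nonneg_left (norm_inner_le_norm _ _) (by positivity)
      _ ≤ _ := by
          rw [Finset.sum_comm]
          refine Finset.sum_le_sum fun p _ => ?_
          rw [← Finset.mul_sum]
          calc _ ≤ (r ^ p.1 * r ^ p.2) * (η p.1 * η p.2) :=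
                mul_le_mul_of_nonneg_left (h3 _ _ F) (by positivity)
            _ = _ := by ring
  have hsum : Summable fun m => ‖r ^ m * η m‖ := by
    simpa [Real.norm_of_nonneg (mul_nonneg (pow_nonneg hr _) (hη0 _))] using
      summable_hsBound (Λ := ‖V‖) (τ := τ) hZ0 hr
  have h5 := (summable_norm_sum_mul_antidiagonal_of_summable_norm hsum hsum).of_norm
  refine (summable_prod_of_nonneg fun p => by positivity).2 ⟨fun N => ?_, ?_⟩
  · exact summable_of_sum_le (fun k => by positivity) (h4 N)
  · exact Summable.of_nonneg_of_le (fun N => tsum_nonneg fun k => by positivity)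
      (fun N => Real.tsum_le_of_sum_le (fun k => by positivity) (h4 N)) h5

end DiagHam

/-! ### Operators on `ℂⁿ ⊗ K` as matrices of operators -/

section JointSpace

variable {n K : Type*} [Fintype n] [DecidableEq n] [NormedAddCommGroup K] [InnerProductSpace ℂ K]

/-- The Hilbert space `ℂⁿ ⊗ K`, as the `ℓ²`-sum of copies of `K`. -/
abbrev JointSpace (n K : Type*) := PiLp 2 (fun _ : n => K)

/-- `v ↦ u_j ⊗ v`. -/
noncomputable def inc (j : n) : K →L[ℂ] JointSpace n K :=
  ((PiLp.continuousLinearEquiv 2 ℂ fun _ : n => K).symm : (n → K) →L[ℂ] JointSpace n K) ∘L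
    ContinuousLinearMap.single ℂ (fun _ : n => K) j

theorem inc_apply (j : n) (v : K) (i : n) : (inc j v : JointSpace n K) i = if i = j then v else 0 := by
  change (Pi.single j v : n → K) i = _
  rw [Pi.single_apply]

theorem inner_inc_left (i : n) (v : K) (w : JointSpace n K) : ⟪inc i v, w⟫_ℂ = ⟪v, w i⟫_ℂ := by
  rw [PiLp.inner_apply, Finset.sum_eq_single i]
  · rw [inc_apply, if_pos rfl]
  · intro j _ hj
    rw [inc_apply, if_neg hj, inner_zero_left]
  · simp

/-- The operator on `ℂⁿ ⊗ K` with matrix `P`. -/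
noncomputable def toOp (P : Matrix n n (K →L[ℂ] K)) : JointSpace n K →L[ℂ] JointSpace n K :=
  ∑ i, ∑ j, inc i ∘L P i j ∘L PiLp.proj 2 (𝕜 := ℂ) (fun _ : n => K) j

theorem toOp_eq (P : Matrix n n (K →L[ℂ] K)) (w : JointSpace n K) :
    toOp P w = ∑ i, ∑ j, inc i (P i j (w j)) := by
  simp [toOp, sum_apply]

theorem toOp_apply (P : Matrix n n (K →L[ℂ] K)) (w : JointSpace n K) (i : n) :
    toOp P w i = ∑ j, P i j (w j) := by
  rw [toOp_eq]
  simp [inc_apply, Finset.sum_ite_eq]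

/-- The matrix of an operator on `ℂⁿ ⊗ K`. -/
noncomputable def ofOp (Q : JointSpace n K →L[ℂ] JointSpace n K) : Matrix n n (K →L[ℂ] K) :=
  fun i j => PiLp.proj 2 (𝕜 := ℂ) (fun _ : n => K) i ∘L Q ∘L inc j

theorem ofOp_apply (Q : JointSpace n K →L[ℂ] JointSpace n K) (i j : n) (v : K) :
    ofOp Q i j v = Q (inc j v) i := rfl

theorem sum_inc (w : JointSpace n K) : ∑ j, inc j (w j) = w := by
  ext i
  simp [inc_apply]

theorem toOp_ofOp (Q : JointSpace n K →L[ℂ] JointSpace n K) : toOp (ofOp Q) = Q := by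
  ext w i
  rw [toOp_apply]
  conv_rhs => rw [← sum_inc w, map_sum]
  simp [ofOp_apply]

theorem ofOp_toOp (P : Matrix n n (K →L[ℂ] K)) : ofOp (toOp P) = P := by
  ext i j v
  rw [ofOp_apply, toOp_apply, Finset.sum_eq_single j]
  · rw [inc_apply, if_pos rfl]
  · intro l _ hl
    rw [inc_apply, if_neg hl, map_zero]
  · simp

theorem toOp_mul (P P' : Matrix n n (K →L[ℂ] K)) : toOp (P * P') = toOp P * toOp P' := by
  ext w i
  rw [mul_apply_eq_comp, toOp_apply, toOp_apply]
  simp only [toOp_apply, Matrix.mul_apply, sum_apply, mul_apply_eq_comp, map_sum]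
  exact Finset.sum_comm

theorem toOp_one : toOp (1 : Matrix n n (K →L[ℂ] K)) = 1 := by
  ext w i
  rw [toOp_apply, Finset.sum_eq_single i]
  · simp
  · intro j _ hj
    simp [Matrix.one_apply_ne hj.symm]
  · simp

theorem ofOp_mul (Q Q' : JointSpace n K →L[ℂ] JointSpace n K) :
    ofOp (Q * Q') = ofOp Q * ofOp Q' := by
  rw [← ofOp_toOp (ofOp Q * ofOp Q'), toOp_mul, toOp_ofOp, toOp_ofOp]

theorem ofOp_one : ofOp (1 : JointSpace n K →L[ℂ] JointSpace n K) = 1 := by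
  rw [← toOp_one, ofOp_toOp]

end JointSpace

/-! ### The eigenbasis of the uncoupled Hamiltonian -/

namespace OpenSystem

variable {ι n : Type*} [Fintype n] [DecidableEq n] (S : OpenSystem ι n)

/-- The unitary matrix whose columns are eigenvectors of `H0`. -/
noncomputable def eigenU : Matrix n n ℂ := S.H0_hermitian.eigenvectorUnitary

/-- The eigenvalues of `H0`, in the order of the columns of `eigenU`. -/
noncomputable def energy : n → ℝ := S.H0_hermitian.eigenvalues

theorem conjTranspose_eigenU_mul : S.eigenUᴴ * S.eigenU = 1 :=
  Unitary.coe_star_mul_self S.H0_hermitian.eigenvectorUnitary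

theorem eigenU_mul_conjTranspose : S.eigenU * S.eigenUᴴ = 1 :=
  Unitary.coe_mul_star_self S.H0_hermitian.eigenvectorUnitary

theorem H0_eq : S.H0 = S.eigenU * Matrix.diagonal (fun p => (S.energy p : ℂ)) * S.eigenUᴴ :=
  S.H0_hermitian.spectral_theorem

theorem H0_mul_eigenU : S.H0 * S.eigenU = S.eigenU * Matrix.diagonal (fun p => (S.energy p : ℂ)) := by
  conv_lhs => rw [H0_eq, Matrix.mul_assoc, conjTranspose_eigenU_mul, Matrix.mul_one]

theorem sum_H0_mul_eigenU (i q : n) :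
    ∑ j, S.H0 i j * S.eigenU j q = S.energy q * S.eigenU i q := by
  have := congrFun (congrFun S.H0_mul_eigenU i) q
  rw [Matrix.mul_apply, Matrix.mul_diagonal] at this
  rw [this, mul_comm]

theorem sum_conj_eigenU_mul (p q : n) :
    ∑ i, (starRingEnd ℂ) (S.eigenU i p) * S.eigenU i q = if p = q then 1 else 0 := by
  have := congrFun (congrFun S.conjTranspose_eigenU_mul p) q
  rwa [Matrix.mul_apply, Matrix.one_apply] at this

theorem sum_eigenU_mul_conj (i j : n) :
    ∑ p, S.eigenU i p * (starRingEnd ℂ) (S.eigenU j p) = if i = j then 1 else 0 := by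
  have := congrFun (congrFun S.eigenU_mul_conjTranspose i) j
  rwa [Matrix.mul_apply, Matrix.one_apply] at this

/-- The matrix elements of `A a` in the eigenbasis of `H0`. -/
noncomputable def eigenA (a : ι) : Matrix n n ℂ := S.eigenUᴴ * S.A a * S.eigenU

end OpenSystem

section Joint

variable {ι n κ K : Type*} [Fintype n] [DecidableEq n]
  [NormedAddCommGroup K] [InnerProductSpace ℂ K] [CompleteSpace K]
  (S : OpenSystem ι n) (B : Bath ι κ K)

/-- The vector `v_p ⊗ e_k`, where `v_p` is the `p`-th eigenvector of `H0`. -/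
noncomputable def jointVec (p : n × κ) : JointSpace n K :=
  WithLp.toLp 2 fun i => S.eigenU i p.1 • B.e p.2

theorem jointVec_apply (p : n × κ) (i : n) : jointVec S B p i = S.eigenU i p.1 • B.e p.2 := rfl

theorem orthonormal_jointVec : Orthonormal ℂ (jointVec S B) := by
  classical
  rw [orthonormal_iff_ite]
  rintro ⟨p, k⟩ ⟨q, l⟩
  rw [PiLp.inner_apply]
  have e : ∀ i, ⟪jointVec S B (p, k) i, jointVec S B (q, l) i⟫_ℂ =
      (starRingEnd ℂ) (S.eigenU i p) * S.eigenU i q * if k = l then 1 else 0 := fun i => by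
    rw [jointVec_apply, jointVec_apply, inner_smul_left, inner_smul_right,
      orthonormal_iff_ite.1 B.e.orthonormal k l]
    ring
  simp only [e]
  rw [← Finset.sum_mul, S.sum_conj_eigenU_mul]
  simp only [Prod.mk.injEq]
  split_ifs <;> simp_all

theorem eq_zero_of_inner_jointVec {w : JointSpace n K} (h : ∀ p, ⟪jointVec S B p, w⟫_ℂ = 0) :
    w = 0 := by
  ext j
  refine B.e.ext_inner fun k => ?_
  have h1 : ∀ p, ∑ i, (starRingEnd ℂ) (S.eigenU i p) * ⟪B.e k, w i⟫_ℂ = 0 := fun p => by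
    have := h (p, k)
    rw [PiLp.inner_apply] at this
    simpa only [jointVec_apply, inner_smul_left] using this
  have h2 : ∑ p, S.eigenU j p * ∑ i, (starRingEnd ℂ) (S.eigenU i p) * ⟪B.e k, w i⟫_ℂ = 0 := by
    simp [h1]
  simp only [Finset.mul_sum, ← mul_assoc] at h2
  rw [Finset.sum_comm] at h2
  simp only [← Finset.sum_mul, S.sum_eigenU_mul_conj] at h2
  simpa using h2

/-- The Hilbert basis of `ℂⁿ ⊗ K` that consists of the vectors `v_p ⊗ e_k`. -/
noncomputable def jointBasis : HilbertBasis (n × κ) ℂ (JointSpace n K) :=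
  HilbertBasis.mkOfOrthogonalEqBot (orthonormal_jointVec S B) (by
    rw [Submodule.eq_bot_iff]
    intro w hw
    refine eq_zero_of_inner_jointVec S B fun p => ?_
    exact (Submodule.mem_orthogonal _ _).1 hw _ (Submodule.subset_span ⟨p, rfl⟩))

theorem jointBasis_eq (p : n × κ) : jointBasis S B p = jointVec S B p := by
  rw [jointBasis, HilbertBasis.coe_mkOfOrthogonalEqBot]

theorem jointBasis_apply (q : n) (k : κ) (i : n) :
    jointBasis S B (q, k) i = S.eigenU i q • B.e k := by
  rw [jointBasis_eq]; rfl

theorem inc_e (j : n) (k : κ) :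
    inc j (B.e k) = ∑ p, (starRingEnd ℂ) (S.eigenU j p) • jointBasis S B (p, k) := by
  ext i
  simp only [WithLp.ofLp_sum, Finset.sum_apply, PiLp.smul_apply, jointBasis_apply, smul_smul,
    ← Finset.sum_smul]
  rw [inc_apply]
  have := S.sum_eigenU_mul_conj i j
  simp only [mul_comm] at this ⊢
  rw [this]
  split_ifs <;> simp

variable {B} {β : ℝ}

/-- Each Boltzmann factor is at most `Z`, so that the energies of a bath with a Gibbs state are
bounded below. -/
theorem Bath.IsThermal.neg_le_E (hB : B.IsThermal β) (hβ : 0 < β) (k : κ) :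
    -(|Real.log (B.Z β)| / β) ≤ B.E k := by
  have h1 : Real.exp (-β * B.E k) ≤ B.Z β := hB.le_tsum k fun _ _ => (Real.exp_pos _).le
  have h2 := Real.log_le_log (Real.exp_pos _) h1
  rw [Real.log_exp] at h2
  rw [neg_le, le_div_iff₀ hβ]
  linarith [le_abs_self (Real.log (B.Z β))]

/-- The uncoupled Hamiltonian `H_0 + H_R`. -/
noncomputable def freeHam (hB : B.IsThermal β) (hβ : 0 < β) : DiagHam (n × κ) (JointSpace n K) where
  b := jointBasis S B
  E p := S.energy p.1 + B.E p.2
  μ := ∑ p, |S.energy p| + |Real.log (B.Z β)| / β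
  μ_nonneg := by positivity
  neg_μ_le p := by
    have h1 := hB.neg_le_E hβ p.2
    have h2 : |S.energy p.1| ≤ ∑ p, |S.energy p| :=
      Finset.single_le_sum (f := fun p => |S.energy p|) (fun _ _ => abs_nonneg _)
        (Finset.mem_univ _)
    linarith [neg_abs_le (S.energy p.1)]

theorem summable_freeHam (hB : B.IsThermal β) (hβ : 0 < β) :
    Summable fun x => Real.exp (-(β / 2 + β / 2) * (freeHam S hB hβ).E x) := by
  have h : Summable fun p : n => Real.exp (-β * S.energy p) := Summable.of_finite
  refine (h.mul_of_nonneg hB (fun _ => (Real.exp_pos _).le) fun _ => (Real.exp_pos _).le).congr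
    fun p => ?_
  rw [← Real.exp_add]
  congr 1
  change _ = -(β / 2 + β / 2) * (S.energy p.1 + B.E p.2)
  ring

variable (B) [Fintype ι]

/-- The interaction `∑ₐ A_a ⊗ R_a`. -/
noncomputable def interaction : JointSpace n K →L[ℂ] JointSpace n K :=
  toOp (Matrix.of fun i j => ∑ a, S.A a i j • B.R a)

theorem interaction_apply (w : JointSpace n K) (i : n) :
    interaction S B w i = ∑ j, ∑ a, S.A a i j • B.R a (w j) := by
  rw [interaction, toOp_apply]
  simp [sum_apply]

theorem isSelfAdjoint_interaction : IsSelfAdjoint (interaction S B) := by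
  rw [ContinuousLinearMap.isSelfAdjoint_iff_isSymmetric]
  intro v w
  change ⟪interaction S B v, w⟫_ℂ = ⟪v, interaction S B w⟫_ℂ
  rw [PiLp.inner_apply, PiLp.inner_apply]
  simp only [interaction_apply, sum_inner, inner_sum, inner_smul_left, inner_smul_right]
  rw [Finset.sum_comm]
  refine Finset.sum_congr rfl fun i _ => Finset.sum_congr rfl fun j _ =>
    Finset.sum_congr rfl fun a _ => ?_
  rw [B.inner_R_symm]
  congr 1
  exact (S.A_hermitian a).apply i j

/-- The matrix elements `⟨v_p ⊗ e_k, V (v_q ⊗ e_l)⟩ = ∑ₐ (A_a)_{pq} ⟨e_k, R_a e_l⟩`. -/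
theorem inner_interaction (p q : n) (k l : κ) :
    ⟪jointBasis S B (p, k), interaction S B (jointBasis S B (q, l))⟫_ℂ =
      ∑ a, S.eigenA a p q * ⟪B.e k, B.R a (B.e l)⟫_ℂ := by
  rw [PiLp.inner_apply]
  simp only [interaction_apply, jointBasis_apply, inner_sum, inner_smul_left, inner_smul_right,
    map_smul]
  have e : ∀ a, S.eigenA a p q = ∑ i, ∑ j, (starRingEnd ℂ) (S.eigenU i p) * S.A a i j *
      S.eigenU j q := fun a => by
    simp only [OpenSystem.eigenA, Matrix.mul_apply, Finset.sum_mul, Matrix.conjTranspose_apply]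
    rw [Finset.sum_comm]
    rfl
  simp only [e, Finset.sum_mul]
  rw [Finset.sum_congr rfl fun i _ => Finset.sum_comm, Finset.sum_comm]
  refine Finset.sum_congr rfl fun a _ => Finset.sum_congr rfl fun i _ =>
    Finset.sum_congr rfl fun j _ => ?_
  ring

/-- The total Hamiltonian on the vectors `v_q ⊗ e_k`, where the free part is diagonal. -/
theorem sum_eigenU_smul_totalHamiltonian (hB : B.IsThermal β) (hβ : 0 < β) (c : ℝ) (i q : n)
    (k : κ) : ∑ j, S.eigenU j q • totalHamiltonian S B c i j k =
      ((((freeHam S hB hβ).E (q, k) : ℂ) • (freeHam S hB hβ).b (q, k) +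
        ((c : ℂ) • interaction S B) ((freeHam S hB hβ).b (q, k))) : JointSpace n K) i := by
  change _ = ((((S.energy q + B.E k : ℝ) : ℂ) • jointBasis S B (q, k) +
        (c : ℂ) • interaction S B (jointBasis S B (q, k))) : JointSpace n K) i
  rw [PiLp.add_apply, PiLp.smul_apply, PiLp.smul_apply, interaction_apply, jointBasis_apply]
  simp only [totalHamiltonian, smul_add, Finset.sum_add_distrib, jointBasis_apply, map_smul]
  congr 1
  · simp only [smul_smul, smul_ite, smul_zero, Finset.sum_ite_eq, Finset.mem_univ, if_true,
      ← Finset.sum_smul, Complex.ofReal_add, add_mul, add_smul]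
    congr 2
    · rw [← S.sum_H0_mul_eigenU]
      exact Finset.sum_congr rfl fun j _ => mul_comm _ _
    · rw [mul_comm]
  · rw [Finset.smul_sum]
    refine Finset.sum_congr rfl fun j _ => ?_
    rw [smul_comm]
    congr 1
    rw [Finset.smul_sum]
    exact Finset.sum_congr rfl fun a _ => smul_comm _ _ _

/-- The converse change of basis. -/
theorem totalHamiltonian_eq_sum (hB : B.IsThermal β) (hβ : 0 < β) (c : ℝ) (i j : n) (k : κ) :
    totalHamiltonian S B c i j k = ∑ q, (starRingEnd ℂ) (S.eigenU j q) •
      ((((freeHam S hB hβ).E (q, k) : ℂ) • (freeHam S hB hβ).b (q, k) +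
        ((c : ℂ) • interaction S B) ((freeHam S hB hβ).b (q, k))) : JointSpace n K) i := by
  simp only [← sum_eigenU_smul_totalHamiltonian, Finset.smul_sum, smul_smul]
  rw [Finset.sum_comm]
  simp only [← Finset.sum_smul]
  have h : ∀ l, ∑ q, (starRingEnd ℂ) (S.eigenU j q) * S.eigenU l q = if l = j then 1 else 0 :=
    fun l => by
      rw [← S.sum_eigenU_mul_conj]
      exact Finset.sum_congr rfl fun _ _ => mul_comm _ _
  simp [h]

/-- A Boltzmann semigroup is a semigroup generated by the negative of `H_0 + H_R + c V`. -/
theorem isBoltzmannSemigroup_iff (hB : B.IsThermal β) (hβ : 0 < β) (c : ℝ)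
    (P : ℝ → Matrix n n (K →L[ℂ] K)) :
    IsBoltzmannSemigroup S B c P ↔
      (freeHam S hB hβ).IsSemigroup ((c : ℂ) • interaction S B) fun t => toOp (P t) := by
  constructor
  · intro h
    refine ⟨?_, fun s t hs ht => ?_, fun w => ?_, ?_⟩
    · simp only [h.zero, toOp_one]
    · simp only [h.add s t hs ht, toOp_mul]
    · simp only [toOp_eq]
      exact continuousOn_finsetSum _ fun i _ => continuousOn_finsetSum _ fun j _ =>
        (inc i).continuous.comp_continuousOn (h.cont i j (w j))
    · rintro ⟨q, k⟩
      have h1 : HasDerivWithinAt (fun t => ∑ i, ∑ j, (inc i (S.eigenU j q • P t i j (B.e k)) :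
          JointSpace n K)) (∑ i, ∑ j, inc i (S.eigenU j q • -totalHamiltonian S B c i j k))
          (Set.Ici 0) 0 := by
        refine HasDerivWithinAt.fun_sum fun i _ => HasDerivWithinAt.fun_sum fun j _ => ?_
        exact ((inc i).restrictScalars ℝ).hasFDerivAt.comp_hasDerivWithinAt (0 : ℝ)
          ((h.deriv i j k).const_smul (S.eigenU j q))
      refine (h1.congr_deriv ?_).congr (fun t _ => ?_) ?_
      · rw [← sum_inc (-_)]
        refine Finset.sum_congr rfl fun i _ => ?_
        rw [← map_sum, PiLp.neg_apply, ← sum_eigenU_smul_totalHamiltonian]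
        simp
      all_goals
        change toOp _ (jointBasis S B (q, k)) = _
        rw [toOp_eq]
        simp only [jointBasis_apply, map_smul]
  · intro h
    have e : ∀ t i j v, P t i j v = toOp (P t) (inc j v) i := fun t i j v => by
      rw [← ofOp_apply, ofOp_toOp]
    refine ⟨?_, fun s t hs ht => ?_, fun i j v => ?_, fun i j k => ?_⟩
    · rw [← ofOp_toOp (P 0), h.zero, ofOp_one]
    · rw [← ofOp_toOp (P (s + t)), h.add s t hs ht, ofOp_mul, ofOp_toOp, ofOp_toOp]
    · simp only [e]
      exact (PiLp.proj 2 (𝕜 := ℂ) (fun _ : n => K) i).continuous.comp_continuousOn (h.cont _)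
    · have h1 : HasDerivWithinAt (fun t => ∑ q, (starRingEnd ℂ) (S.eigenU j q) •
          (toOp (P t) ((freeHam S hB hβ).b (q, k))) i) (∑ q, (starRingEnd ℂ) (S.eigenU j q) •
          (-(((freeHam S hB hβ).E (q, k) : ℂ) • (freeHam S hB hβ).b (q, k) +
        ((c : ℂ) • interaction S B) ((freeHam S hB hβ).b (q, k))) : JointSpace n K) i)
          (Set.Ici 0) 0 := by
        refine HasDerivWithinAt.fun_sum fun q _ => ?_
        exact ((((PiLp.proj 2 (𝕜 := ℂ) (fun _ : n => K) i).restrictScalars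
          ℝ).hasFDerivAt.comp_hasDerivWithinAt (0 : ℝ) (h.deriv (q, k)))).const_smul
            ((starRingEnd ℂ) (S.eigenU j q))
      refine (h1.congr_deriv ?_).congr (fun t _ => ?_) ?_
      · rw [totalHamiltonian_eq_sum S B hB hβ, ← Finset.sum_neg_distrib]
        refine Finset.sum_congr rfl fun q _ => ?_
        rw [PiLp.neg_apply, smul_neg]
      all_goals
        rw [e, inc_e S B, map_sum]
        simp only [map_smul, WithLp.ofLp_sum, Finset.sum_apply, PiLp.smul_apply]
        rfl

end Joint

/-! ### The Dyson terms of first and second order -/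

/-- `∫₀^β e^{-(β-s)x - sy} ds = (e^{-βy} - e^{-βx}) / (x - y)`. -/
noncomputable def expMean (β x y : ℝ) : ℝ := Real.exp (-β * x) * expQuot β (x - y)

theorem expMean_eq_integral (β x y : ℝ) :
    expMean β x y = ∫ s in (0 : ℝ)..β, Real.exp (-(β - s) * x) * Real.exp (-s * y) := by
  rw [expMean, expQuot_eq_integral, ← intervalIntegral.integral_const_mul]
  refine intervalIntegral.integral_congr fun s _ => ?_
  rw [← Real.exp_add, ← Real.exp_add]
  congr 1
  ring

/-- A common shift of the energies factors out. Applied to a bath energy, it separates the system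
from the bath in the Dyson terms. -/
theorem expMean_add_add (β x y z : ℝ) :
    expMean β (x + z) (y + z) = Real.exp (-β * z) * expMean β x y := by
  rw [expMean, expMean, add_sub_add_right_eq_sub, mul_add, Real.exp_add]
  ring

namespace DiagHam

variable {X 𝓗 : Type*} [NormedAddCommGroup 𝓗] [InnerProductSpace ℂ 𝓗] [CompleteSpace 𝓗]
  (H : DiagHam X 𝓗) (V : 𝓗 →L[ℂ] 𝓗)

theorem inner_dyson_succ (m : ℕ) {t : ℝ} (ht : 0 ≤ t) (x : X) (v : 𝓗) :
    ⟪H.b x, H.dyson V (m + 1) t v⟫_ℂ = -∫ s in (0 : ℝ)..t,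
      (Real.exp (-(t - s) * H.E x) : ℂ) * ⟪H.b x, V (H.dyson V m s v)⟫_ℂ := by
  rw [H.dyson_succ V ht, inner_neg_right, intervalIntegral_inner_right
    ((H.continuous_T_dyson V m t v).intervalIntegrable _ _)]
  congr 1
  refine intervalIntegral.integral_congr fun s hs => ?_
  rw [Set.uIcc_of_le ht] at hs
  exact H.inner_T (by linarith [hs.2]) _ _

theorem inner_dyson_one {t : ℝ} (ht : 0 ≤ t) (x y : X) :
    ⟪H.b x, H.dyson V 1 t (H.b y)⟫_ℂ =
      -((expMean t (H.E x) (H.E y) : ℂ) * ⟪H.b x, V (H.b y)⟫_ℂ) := by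
  rw [H.inner_dyson_succ V 0 ht, expMean_eq_integral, ← intervalIntegral.integral_ofReal,
    ← intervalIntegral.integral_mul_const]
  congr 1
  refine intervalIntegral.integral_congr fun s hs => ?_
  rw [Set.uIcc_of_le ht] at hs
  simp only [dyson_zero, H.T_b hs.1, map_smul, inner_smul_right]
  push_cast
  ring

theorem exp_mul_expMean_le {t s : ℝ} (hs : s ∈ Set.Icc 0 t) (x y z : X) :
    Real.exp (-(t - s) * H.E x) * expMean s (H.E y) (H.E z) ≤ t * Real.exp (H.μ * t) := by
  rw [expMean_eq_integral, ← intervalIntegral.integral_const_mul]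
  have h : ∀ u ∈ Set.Icc 0 s, Real.exp (-(t - s) * H.E x) *
      (Real.exp (-(s - u) * H.E y) * Real.exp (-u * H.E z)) ≤ Real.exp (H.μ * t) := by
    intro u hu
    rw [← Real.exp_add, ← Real.exp_add, Real.exp_le_exp]
    nlinarith [H.neg_μ_le x, H.neg_μ_le y, H.neg_μ_le z, hs.1, hs.2, hu.1, hu.2]
  calc _ ≤ ∫ _ in (0 : ℝ)..s, Real.exp (H.μ * t) :=
        intervalIntegral.integral_mono_on hs.1 (Continuous.intervalIntegrable (by fun_prop) _ _)
          (by simp) h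
    _ = s * Real.exp (H.μ * t) := by simp
    _ ≤ _ := mul_le_mul_of_nonneg_right hs.2 (Real.exp_pos _).le

theorem expMean_nonneg {t : ℝ} (ht : 0 ≤ t) (x y : ℝ) : 0 ≤ expMean t x y := by
  rw [expMean_eq_integral]
  exact intervalIntegral.integral_nonneg ht fun s _ => by positivity

/-- The double time-ordered integral of the second-order term is a second divided difference of
`e^{-t ·}`. -/
theorem exp_mul_expDivDiff_eq (t x y z : ℝ) :
    Real.exp (-t * x) * expDivDiff t (x - y) (x - z) =
      ∫ s in (0 : ℝ)..t, Real.exp (-(t - s) * x) * expMean s y z := by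
  rw [expDivDiff, ← intervalIntegral.integral_const_mul]
  refine intervalIntegral.integral_congr fun s _ => ?_
  rw [expMean_eq_integral, ← intervalIntegral.integral_const_mul,
    ← intervalIntegral.integral_const_mul]
  refine intervalIntegral.integral_congr fun u _ => ?_
  rw [← Real.exp_add, ← Real.exp_add, ← Real.exp_add]
  congr 1
  ring

theorem continuous_expMean (y z : ℝ) : Continuous fun s => expMean s y z := by
  simp only [expMean_eq_integral]
  exact intervalIntegral.continuous_parametric_intervalIntegral_of_continuous
    (f := fun t s => Real.exp (-(t - s) * y) * Real.exp (-s * z)) (by fun_prop) continuous_id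

/-- The matrix elements of the second-order Dyson term, as a sum over intermediate states. -/
theorem hasSum_inner_dyson_two [Countable X] (hV : IsSelfAdjoint V) {t : ℝ} (ht : 0 ≤ t)
    (x z : X) :
    HasSum (fun y => ((Real.exp (-t * H.E x) * expDivDiff t (H.E x - H.E y) (H.E x - H.E z) : ℝ) :
        ℂ) * (⟪H.b x, V (H.b y)⟫_ℂ * ⟪H.b y, V (H.b z)⟫_ℂ))
      ⟪H.b x, H.dyson V 2 t (H.b z)⟫_ℂ := by
  have hVs : ∀ v w, ⟪V v, w⟫_ℂ = ⟪v, V w⟫_ℂ := fun v w =>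
    (ContinuousLinearMap.isSelfAdjoint_iff_isSymmetric.1 hV) v w
  have hsum := (H.b.summable_inner_mul_inner (V (H.b x)) (V (H.b z))).norm
  simp only [hVs] at hsum
  have key : HasSum (fun y => ∫ s in (0 : ℝ)..t, ((Real.exp (-(t - s) * H.E x) *
        expMean s (H.E y) (H.E z) : ℝ) : ℂ) * (⟪H.b x, V (H.b y)⟫_ℂ * ⟪H.b y, V (H.b z)⟫_ℂ))
      (∫ s in (0 : ℝ)..t, -((Real.exp (-(t - s) * H.E x) : ℂ) *
        ⟪H.b x, V (H.dyson V 1 s (H.b z))⟫_ℂ)) := by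
    refine intervalIntegral.hasSum_integral_of_dominated_convergence (fun y _ =>
      t * Real.exp (H.μ * t) * ‖⟪H.b x, V (H.b y)⟫_ℂ * ⟪H.b y, V (H.b z)⟫_ℂ‖) (fun y => ?_)
      (fun y => ?_) ?_ ?_ ?_
    · have := continuous_expMean (H.E y) (H.E z)
      exact Continuous.aestronglyMeasurable (by fun_prop)
    · refine Eventually.of_forall fun s hs => ?_
      rw [Set.uIoc_of_le ht] at hs
      rw [norm_mul, Complex.norm_real, Real.norm_of_nonneg
        (mul_nonneg (Real.exp_pos _).le (expMean_nonneg hs.1.le _ _))]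
      exact mul_le_mul_of_nonneg_right (H.exp_mul_expMean_le ⟨hs.1.le, hs.2⟩ x y z)
        (norm_nonneg _)
    · exact Eventually.of_forall fun s _ => hsum.mul_left _
    · exact intervalIntegrable_const
    · refine Eventually.of_forall fun s hs => ?_
      rw [Set.uIoc_of_le ht] at hs
      have h1 := (H.b.hasSum_inner_mul_inner (V (H.b x)) (H.dyson V 1 s (H.b z))).mul_left
        (-(Real.exp (-(t - s) * H.E x) : ℂ))
      simp only [hVs, H.inner_dyson_one V hs.1.le] at h1
      rw [← neg_mul]
      refine h1.congr_fun fun y => ?_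
      push_cast
      ring
  rw [H.inner_dyson_succ V 1 ht, ← intervalIntegral.integral_neg]
  refine key.congr_fun fun y => ?_
  rw [exp_mul_expDivDiff_eq, intervalIntegral.integral_mul_const, intervalIntegral.integral_ofReal]

end DiagHam

/-! ### Expansion of the partial trace -/

section PartialTrace

variable {ι n κ K : Type*} [Fintype n] [DecidableEq n]
  [NormedAddCommGroup K] [InnerProductSpace ℂ K] [CompleteSpace K]
  (S : OpenSystem ι n) {B : Bath ι κ K} {β : ℝ} [Fintype ι]

/-- The matrix elements of `Tr_R[D_m(β)]` in the eigenbasis of `H0`, where `D_m` is the `m`-th term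
of the Dyson series. -/
noncomputable def traceCoeff (hB : B.IsThermal β) (hβ : 0 < β) (m : ℕ) (p q : n) : ℂ :=
  ∑' k, ⟪jointBasis S B (p, k), (freeHam S hB hβ).dyson (interaction S B) m β
    (jointBasis S B (q, k))⟫_ℂ

/-- The matrix elements of `Tr_R[e^{-βH}]` in the eigenbasis of `H0`. -/
noncomputable def partialTrace (hB : B.IsThermal β) (hβ : 0 < β) (c : ℝ) (p q : n) : ℂ :=
  ∑' k, ⟪jointBasis S B (p, k), (freeHam S hB hβ).Q ((c : ℂ) • interaction S B) β
    (jointBasis S B (q, k))⟫_ℂ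

/-- The Dyson terms of `e^{-βH}` are jointly trace class, because `e^{-βH_R/2}` is Hilbert–Schmidt.
-/
theorem summable_traceTerm (hB : B.IsThermal β) (hβ : 0 < β) (p q : n) {r : ℝ} (hr : 0 ≤ r) :
    Summable fun x : ℕ × κ => r ^ x.1 * ‖⟪jointBasis S B (p, x.2),
      (freeHam S hB hβ).dyson (interaction S B) x.1 β (jointBasis S B (q, x.2))⟫_ℂ‖ := by
  have h := DiagHam.summable_inner_dyson (interaction S B) (H := freeHam S hB hβ)
    (by positivity : 0 ≤ β / 2) (summable_freeHam S hB hβ) (x := fun k => (p, k))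
    (y := fun k => (q, k)) (Prod.mk_right_injective p) (Prod.mk_right_injective q) hr
  rw [add_halves] at h
  exact h

theorem summable_trace_pow (hB : B.IsThermal β) (hβ : 0 < β) (p q : n) (c : ℝ) :
    Summable fun x : ℕ × κ => (c : ℂ) ^ x.1 * ⟪jointBasis S B (p, x.2),
      (freeHam S hB hβ).dyson (interaction S B) x.1 β (jointBasis S B (q, x.2))⟫_ℂ := by
  refine Summable.of_norm ((summable_traceTerm S hB hβ p q (abs_nonneg c)).congr fun x => ?_)
  rw [norm_mul, norm_pow, Complex.norm_real, Real.norm_eq_abs]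

theorem hasSum_dyson_pow (hB : B.IsThermal β) (hβ : 0 < β) (c : ℝ) (v w : JointSpace n K) :
    HasSum (fun m => (c : ℂ) ^ m * ⟪v, (freeHam S hB hβ).dyson (interaction S B) m β w⟫_ℂ)
      ⟪v, (freeHam S hB hβ).Q ((c : ℂ) • interaction S B) β w⟫_ℂ := by
  have := ((freeHam S hB hβ).hasSum_Q_apply ((c : ℂ) • interaction S B) β w).mapL (innerSL ℂ v)
  simpa only [DiagHam.dyson_smul _ _ _ _ hβ.le, smul_apply, innerSL_apply_apply,
    inner_smul_right] using this

/-- Interchange of the trace over the bath with the expansion in the coupling. -/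
theorem hasSum_tsum_of_summable_pow {c : ℂ} {f : ℕ → κ → ℂ} {g : κ → ℂ}
    (hs : Summable fun x : ℕ × κ => c ^ x.1 * f x.1 x.2) (hf : ∀ m, Summable (f m))
    (hg : ∀ k, HasSum (fun m => c ^ m * f m k) (g k)) :
    HasSum g (∑' k, g k) ∧ HasSum (fun m => c ^ m * ∑' k, f m k) (∑' k, g k) := by
  have h1 : HasSum (fun x : κ × ℕ => c ^ x.2 * f x.2 x.1) (∑' x : ℕ × κ, c ^ x.1 * f x.1 x.2) :=
    (Equiv.prodComm κ ℕ).hasSum_iff.2 hs.hasSum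
  have h2 : HasSum g (∑' x : ℕ × κ, c ^ x.1 * f x.1 x.2) := h1.prod_fiberwise hg
  rw [h2.tsum_eq]
  have h3 : ∀ m, HasSum (fun k => c ^ m * f m k) (c ^ m * ∑' k, f m k) := fun m =>
    (hf m).hasSum.mul_left _
  exact ⟨h2, hs.hasSum.prod_fiberwise h3⟩

/-- The partial trace is a power series in the coupling that converges for every coupling. -/
theorem hasSum_partialTrace (hB : B.IsThermal β) (hβ : 0 < β) (c : ℝ) (p q : n) :
    HasSum (fun k => ⟪jointBasis S B (p, k), (freeHam S hB hβ).Q ((c : ℂ) • interaction S B) β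
      (jointBasis S B (q, k))⟫_ℂ) (partialTrace S hB hβ c p q) ∧
    HasSum (fun m => (c : ℂ) ^ m * traceCoeff S hB hβ m p q) (partialTrace S hB hβ c p q) := by
  refine hasSum_tsum_of_summable_pow (summable_trace_pow S hB hβ p q c) (fun m => ?_)
    fun k => hasSum_dyson_pow S hB hβ c _ _
  have := (summable_trace_pow S hB hβ p q 1).prod_factor m
  simpa using this

theorem traceCoeff_zero (hB : B.IsThermal β) (hβ : 0 < β) (p q : n) :
    traceCoeff S hB hβ 0 p q = if p = q then ((Real.exp (-β * S.energy p) * B.Z β : ℝ) : ℂ) else 0 := by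
  have e : ∀ k, ⟪jointBasis S B (p, k), (freeHam S hB hβ).dyson (interaction S B) 0 β
      (jointBasis S B (q, k))⟫_ℂ =
      if p = q then ((Real.exp (-β * S.energy p) * Real.exp (-β * B.E k) : ℝ) : ℂ) else 0 := by
    intro k
    classical
    rw [DiagHam.dyson_zero]
    have := (freeHam S hB hβ).T_b hβ.le (q, k)
    change (freeHam S hB hβ).T β (jointBasis S B (q, k)) = (Real.exp (-β * (S.energy q + B.E k)) :
      ℂ) • jointBasis S B (q, k) at this
    rw [this, inner_smul_right, orthonormal_iff_ite.1 (jointBasis S B).orthonormal]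
    by_cases h : p = q
    · subst h
      simp [← Complex.exp_add, mul_add]
    · simp [h]
  rw [traceCoeff, tsum_congr e]
  split_ifs
  · rw [← Complex.ofReal_tsum, tsum_mul_left, Bath.Z]
  · simp

/-- The term of first order is the Gibbs expectation of the bath operators. -/
theorem traceCoeff_one (hB : B.IsThermal β) (hβ : 0 < β) [Nonempty κ] (hc : B.Centred β) (p q : n) :
    traceCoeff S hB hβ 1 p q = 0 := by
  have e : ∀ k, ⟪jointBasis S B (p, k), (freeHam S hB hβ).dyson (interaction S B) 1 β
      (jointBasis S B (q, k))⟫_ℂ = ∑ a, -((expMean β (S.energy p) (S.energy q) * B.Z β : ℝ) : ℂ) *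
      S.eigenA a p q * (((Real.exp (-β * B.E k) / B.Z β : ℝ) : ℂ) * ⟪B.e k, B.R a (B.e k)⟫_ℂ) := by
    intro k
    have := (freeHam S hB hβ).inner_dyson_one (interaction S B) hβ.le (p, k) (q, k)
    change ⟪jointBasis S B (p, k), (freeHam S hB hβ).dyson (interaction S B) 1 β
      (jointBasis S B (q, k))⟫_ℂ = -((expMean β (S.energy p + B.E k) (S.energy q + B.E k) : ℂ) *
        ⟪jointBasis S B (p, k), interaction S B (jointBasis S B (q, k))⟫_ℂ) at this
    rw [this, inner_interaction, expMean_add_add, Finset.mul_sum, ← Finset.sum_neg_distrib]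
    refine Finset.sum_congr rfl fun a _ => ?_
    have hZ : (B.Z β : ℂ) ≠ 0 := by exact_mod_cast hB.Z_pos.ne'
    push_cast
    field_simp
  have hs : ∀ a, Summable fun k => ((Real.exp (-β * B.E k) / B.Z β : ℝ) : ℂ) *
      ⟪B.e k, B.R a (B.e k)⟫_ℂ := fun a => by
    refine Summable.of_norm_bounded (g := fun k => Real.exp (-β * B.E k) / B.Z β * ‖B.R a‖)
      ((hB.div_const _).mul_right _) fun k => ?_
    rw [norm_mul, Complex.norm_real, Real.norm_of_nonneg (div_nonneg (Real.exp_pos _).le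
      hB.Z_pos.le)]
    refine mul_le_mul_of_nonneg_left ?_ (div_nonneg (Real.exp_pos _).le hB.Z_pos.le)
    refine (norm_inner_le_norm _ _).trans ?_
    rw [B.e.orthonormal.1, one_mul]
    simpa [B.e.orthonormal.1] using (B.R a).le_opNorm (B.e k)
  rw [traceCoeff, tsum_congr e, Summable.tsum_finsetSum fun a _ => (hs a).mul_left _]
  refine Finset.sum_eq_zero fun a _ => ?_
  rw [tsum_mul_left]
  have : (∑' k, ((Real.exp (-β * B.E k) / B.Z β : ℝ) : ℂ) * ⟪B.e k, B.R a (B.e k)⟫_ℂ) = 0 := hc a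
  rw [this, mul_zero]

/-- The matrix elements, in the eigenbasis of `H0`, of the second-order mean-force correction. -/
noncomputable def correctionCoeff (B : Bath ι κ K) (β : ℝ) (p q : n) : ℂ :=
  ∑ r, ∑ a, ∑ b, B.spectralSum β a b (fun Ω => (kernelD β (S.energy p - S.energy r)
    (S.energy q - S.energy r) Ω : ℂ)) * (S.eigenA a p r * S.eigenA b r q)

/-- The term of second order. The bath energy factors out of the second divided difference, and what
is left is a divided difference at the two Bohr frequencies and the energy transfer to the bath,
that is, the kernel `D`. -/
theorem traceCoeff_two (hB : B.IsThermal β) (hβ : 0 < β) [Nonempty κ] (p q : n) :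
    traceCoeff S hB hβ 2 p q = -((B.Z β * expMean β (S.energy p) (S.energy q) : ℝ) : ℂ) *
      correctionCoeff S B β p q := by
  have := hB.countable
  set w : ℂ := -((B.Z β * expMean β (S.energy p) (S.energy q) : ℝ) : ℂ) with hw
  have hZ : (B.Z β : ℂ) ≠ 0 := by exact_mod_cast hB.Z_pos.ne'
  set D : n → ℝ → ℂ := fun r Ω => (kernelD β (S.energy p - S.energy r)
    (S.energy q - S.energy r) Ω : ℂ) with hD
  -- `r` and `l` label the intermediate states of the system and of the bath; the two Bohr
  -- frequencies are taken relative to `r`, and the energy transferred is `E_l - E_k`.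
  have hk : ∀ r k l, Real.exp (-β * (S.energy p + B.E k)) * expDivDiff β
      ((S.energy p + B.E k) - (S.energy r + B.E l)) ((S.energy p + B.E k) - (S.energy q + B.E k)) =
      -(expMean β (S.energy p) (S.energy q)) * Real.exp (-β * B.E k) *
      kernelD β (S.energy p - S.energy r) (S.energy q - S.energy r) (B.E l - B.E k) := by
    intro r k l
    rw [kernelD_eq, expMean, expDivDiff_comm, mul_add, Real.exp_add]
    have e1 : S.energy p - S.energy r - (S.energy q - S.energy r) = S.energy p - S.energy q := by
      ring
    have e2 : S.energy p - S.energy r - (B.E l - B.E k) =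
      S.energy p + B.E k - (S.energy r + B.E l) := by ring
    rw [e1, e2, add_sub_add_right_eq_sub]
    have := (expQuot_pos hβ (S.energy p - S.energy q)).ne'
    field_simp
  have h1 : ∀ k, HasSum (fun l => ∑ r, ∑ a, ∑ b, w * (S.eigenA a p r * S.eigenA b r q) *
      B.spectralTerm β a b (D r) (k, l)) ⟪jointBasis S B (p, k),
      (freeHam S hB hβ).dyson (interaction S B) 2 β (jointBasis S B (q, k))⟫_ℂ := by
    intro k
    have h := (freeHam S hB hβ).hasSum_inner_dyson_two (interaction S B)
      (isSelfAdjoint_interaction S B) hβ.le (p, k) (q, k)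
    have h' := ((Equiv.prodComm κ n).hasSum_iff.2 h).prod_fiberwise fun l => hasSum_fintype _
    refine h'.congr_fun fun l => Finset.sum_congr rfl fun r _ => ?_
    change _ = ((Real.exp (-β * (S.energy p + B.E k)) * expDivDiff β
      ((S.energy p + B.E k) - (S.energy r + B.E l)) ((S.energy p + B.E k) - (S.energy q + B.E k)) :
      ℝ) : ℂ) * (⟪jointBasis S B (p, k), interaction S B (jointBasis S B (r, l))⟫_ℂ *
        ⟪jointBasis S B (r, l), interaction S B (jointBasis S B (q, k))⟫_ℂ)
    rw [hk, inner_interaction, inner_interaction, Finset.sum_mul_sum, Finset.mul_sum]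
    refine Finset.sum_congr rfl fun a _ => ?_
    rw [Finset.mul_sum]
    refine Finset.sum_congr rfl fun b _ => ?_
    simp only [Bath.spectralTerm, hD, hw]
    push_cast
    field_simp
  have h2 : HasSum (fun x : κ × κ => ∑ r, ∑ a, ∑ b, w * (S.eigenA a p r * S.eigenA b r q) *
      B.spectralTerm β a b (D r) x) (∑ r, ∑ a, ∑ b, w * (S.eigenA a p r * S.eigenA b r q) *
      B.spectralSum β a b (D r)) :=
    hasSum_sum fun r _ => hasSum_sum fun a _ => hasSum_sum fun b _ =>
      (hB.summable_kernelD hβ a b _ _).hasSum.mul_left _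
  have h3 := h2.prod_fiberwise h1
  rw [traceCoeff, h3.tsum_eq, correctionCoeff]
  simp only [Finset.mul_sum]
  refine Finset.sum_congr rfl fun r _ => Finset.sum_congr rfl fun a _ =>
    Finset.sum_congr rfl fun b _ => ?_
  ring

/-- The Taylor remainder of a power series that converges absolutely at `1`. -/
theorem norm_tsum_sub_three_le {f : ℕ → ℂ} {s : ℂ} {c : ℝ} (hc : |c| ≤ 1)
    (hs : HasSum (fun m => (c : ℂ) ^ m * f m) s) (hf : Summable fun m => ‖f m‖) :
    ‖s - (f 0 + c * f 1 + c ^ 2 * f 2)‖ ≤ (∑' m, ‖f m‖) * |c| ^ 3 := by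
  have h := (hasSum_nat_add_iff' 3).2 hs
  simp only [Finset.sum_range_succ, Finset.sum_range_zero, zero_add, pow_zero, one_mul,
    pow_one] at h
  have h2 : Summable fun m => ‖f (m + 3)‖ := (summable_nat_add_iff 3).2 hf
  rw [← h.tsum_eq, mul_comm]
  have hb : ∀ m, ‖(c : ℂ) ^ (m + 3) * f (m + 3)‖ ≤ |c| ^ 3 * ‖f (m + 3)‖ := fun m => by
    rw [norm_mul, norm_pow, Complex.norm_real, Real.norm_eq_abs]
    exact mul_le_mul_of_nonneg_right (pow_le_pow_of_le_one (abs_nonneg c) hc (by omega))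
      (norm_nonneg _)
  refine (tsum_of_norm_bounded (h2.mul_left (|c| ^ 3)).hasSum hb).trans ?_
  rw [tsum_mul_left]
  refine mul_le_mul_of_nonneg_left ?_ (by positivity)
  rw [← hf.sum_add_tsum_nat_add 3]
  exact le_add_of_nonneg_left (Finset.sum_nonneg fun _ _ => norm_nonneg _)

theorem exists_norm_partialTrace_sub_le (hB : B.IsThermal β) (hβ : 0 < β) [Nonempty κ]
    (hc : B.Centred β) : ∃ C, 0 ≤ C ∧ ∀ c : ℝ, |c| ≤ 1 → ∀ p q, ‖partialTrace S hB hβ c p q -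
      ((if p = q then ((Real.exp (-β * S.energy p) * B.Z β : ℝ) : ℂ) else 0) -
      (c : ℂ) ^ 2 * (((B.Z β * expMean β (S.energy p) (S.energy q) : ℝ) : ℂ) *
        correctionCoeff S B β p q))‖ ≤ C * |c| ^ 3 := by
  have hs : ∀ p q, Summable fun m => ‖traceCoeff S hB hβ m p q‖ := fun p q => by
    have := (hasSum_partialTrace S hB hβ 1 p q).2.summable.norm
    simpa using this
  refine ⟨∑ p, ∑ q, ∑' m, ‖traceCoeff S hB hβ m p q‖, Finset.sum_nonneg fun p _ =>
    Finset.sum_nonneg fun q _ => tsum_nonneg fun _ => norm_nonneg _, fun c hc1 p q => ?_⟩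
  have h := norm_tsum_sub_three_le hc1 (hasSum_partialTrace S hB hβ c p q).2 (hs p q)
  rw [traceCoeff_zero, traceCoeff_one S hB hβ hc, traceCoeff_two, mul_zero, add_zero,
    neg_mul (Complex.ofReal _), mul_neg, ← sub_eq_add_neg] at h
  refine h.trans (mul_le_mul_of_nonneg_right ?_ (by positivity))
  have h1 : ∀ p q, 0 ≤ ∑' m, ‖traceCoeff S hB hβ m p q‖ := fun p q =>
    tsum_nonneg fun _ => norm_nonneg _
  exact (Finset.single_le_sum (f := fun q => ∑' m, ‖traceCoeff S hB hβ m p q‖) (fun q _ => h1 p q)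
    (Finset.mem_univ q)).trans (Finset.single_le_sum (f := fun p => ∑ q, ∑' m,
      ‖traceCoeff S hB hβ m p q‖) (fun p _ => Finset.sum_nonneg fun q _ => h1 p q)
      (Finset.mem_univ p))

end PartialTrace

/-! ### Logarithms of matrices close to a diagonal matrix -/

/-- `expMean` is a divided difference of `e^{-β ·}`: it is the symbol of the derivative of `h ↦
e^{-βh}` at a diagonal matrix, up to sign. -/
theorem sub_mul_expMean (β x y : ℝ) :
    (x - y) * expMean β x y = Real.exp (-β * y) - Real.exp (-β * x) := by
  by_cases h : x = y
  · simp [h]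
  · rw [expMean, expQuot_of_ne β (sub_ne_zero.2 h), mul_left_comm,
      mul_div_cancel₀ _ (sub_ne_zero.2 h), mul_sub, ← Real.exp_add, mul_one]
    congr 2
    ring

theorem expMean_pos {β : ℝ} (hβ : 0 < β) (x y : ℝ) : 0 < expMean β x y :=
  mul_pos (Real.exp_pos _) (expQuot_pos hβ _)

theorem le_expMean {β m x y : ℝ} (hβ : 0 ≤ β) (hx : x ≤ m) (hy : y ≤ m) :
    β * Real.exp (-β * m) ≤ expMean β x y := by
  rw [expMean_eq_integral]
  calc β * Real.exp (-β * m) = ∫ _ in (0 : ℝ)..β, Real.exp (-β * m) := by simp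
    _ ≤ _ := by
      refine intervalIntegral.integral_mono_on hβ (by simp)
        (Continuous.intervalIntegrable (by fun_prop) _ _) fun s hs => ?_
      rw [← Real.exp_add, Real.exp_le_exp]
      nlinarith [hs.1, hs.2]

theorem abs_exp_sub_exp_le {a b M : ℝ} (ha : a ≤ M) (hb : b ≤ M) :
    |Real.exp a - Real.exp b| ≤ Real.exp M * |a - b| := by
  wlog h : b ≤ a generalizing a b
  · rw [abs_sub_comm, abs_sub_comm a]
    exact this hb ha (le_of_not_ge h)
  rw [abs_of_nonneg (sub_nonneg.2 (Real.exp_le_exp.2 h)), abs_of_nonneg (sub_nonneg.2 h)]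
  have h1 : Real.exp b = Real.exp a * Real.exp (b - a) := by rw [← Real.exp_add]; congr 1; ring
  have h2 := Real.add_one_le_exp (b - a)
  have h3 := Real.exp_le_exp.2 ha
  rw [h1]
  nlinarith [Real.exp_pos a]

theorem abs_expMean_sub_le {β m x x' y : ℝ} (hβ : 0 ≤ β) (hx : |x| ≤ m) (hx' : |x'| ≤ m)
    (hy : |y| ≤ m) : |expMean β x y - expMean β x' y| ≤
      β * (β * Real.exp (β * m) * Real.exp (β * m)) * |x - x'| := by
  rw [expMean_eq_integral, expMean_eq_integral, ← intervalIntegral.integral_sub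
    (Continuous.intervalIntegrable (by fun_prop) _ _)
    (Continuous.intervalIntegrable (by fun_prop) _ _), ← Real.norm_eq_abs]
  refine (intervalIntegral.norm_integral_le_of_norm_le_const
    (C := β * Real.exp (β * m) * Real.exp (β * m) * |x - x'|) fun s hs => ?_).trans (le_of_eq ?_)
  · rw [Set.uIoc_of_le hβ] at hs
    have hm : 0 ≤ m := (abs_nonneg x).trans hx
    have hb : ∀ r z, 0 ≤ r → r ≤ β → |z| ≤ m → -r * z ≤ β * m := fun r z h0 h1 hz => by
      nlinarith [neg_abs_le z, abs_nonneg z, mul_le_mul h1 hz (abs_nonneg z) hβ]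
    rw [← sub_mul, Real.norm_eq_abs, abs_mul, Real.abs_exp]
    have h1 := abs_exp_sub_exp_le (hb (β - s) x (by linarith [hs.2]) (by linarith [hs.1]) hx)
      (hb (β - s) x' (by linarith [hs.2]) (by linarith [hs.1]) hx')
    have h2 := Real.exp_le_exp.2 (hb s y hs.1.le hs.2 hy)
    have h3 : |(-(β - s) * x - -(β - s) * x')| ≤ β * |x - x'| := by
      rw [← mul_sub, abs_mul, abs_neg, abs_of_nonneg (by linarith [hs.2])]
      exact mul_le_mul_of_nonneg_right (by linarith [hs.1]) (abs_nonneg _)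
    calc _ ≤ (Real.exp (β * m) * (β * |x - x'|)) * Real.exp (β * m) := by
          refine mul_le_mul (h1.trans (mul_le_mul_of_nonneg_left h3 (Real.exp_pos _).le)) h2
            (Real.exp_pos _).le (by positivity)
      _ = _ := by ring
  · rw [sub_zero, abs_of_nonneg hβ]; ring

section Matrix

variable {n : Type*} [Fintype n] [DecidableEq n]

theorem exp_unitary_conj {W : Matrix n n ℂ} (hW : W * Wᴴ = 1) (A : Matrix n n ℂ) :
    NormedSpace.exp (W * A * Wᴴ) = W * NormedSpace.exp A * Wᴴ := by
  have h := Matrix.inv_eq_right_inv hW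
  rw [← h]
  exact Matrix.exp_conj W A (IsUnit.of_mul_eq_one _ hW)

theorem exp_smul_unitary_conj {W : Matrix n n ℂ} (hW : W * Wᴴ = 1) (c : ℂ) (A : Matrix n n ℂ) :
    NormedSpace.exp (c • (W * A * Wᴴ)) = W * NormedSpace.exp (c • A) * Wᴴ := by
  rw [← exp_unitary_conj hW, Matrix.mul_smul, Matrix.smul_mul]

theorem exp_smul_diagonal (β : ℝ) (η : n → ℝ) :
    NormedSpace.exp (((-β : ℝ) : ℂ) • Matrix.diagonal fun a => (η a : ℂ)) =
      Matrix.diagonal fun a => ((Real.exp (-β * η a) : ℝ) : ℂ) := by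
  rw [← Matrix.diagonal_smul, Matrix.exp_diagonal]
  congr 1
  ext a
  rw [Pi.coe_exp, ← Complex.exp_eq_exp_ℂ]
  simp

theorem Matrix.IsHermitian.exists_unitary {h : Matrix n n ℂ} (hh : h.IsHermitian) :
    ∃ W : Matrix n n ℂ, W * Wᴴ = 1 ∧ Wᴴ * W = 1 ∧
      h = W * Matrix.diagonal (fun a => (hh.eigenvalues a : ℂ)) * Wᴴ :=
  ⟨hh.eigenvectorUnitary, Unitary.coe_mul_star_self hh.eigenvectorUnitary,
    Unitary.coe_star_mul_self hh.eigenvectorUnitary, hh.spectral_theorem⟩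

theorem unitary_diagonal_apply (W : Matrix n n ℂ) (d : n → ℂ) (p q : n) :
    (W * Matrix.diagonal d * Wᴴ) p q = ∑ a, W p a * (starRingEnd ℂ) (W q a) * d a := by
  rw [Matrix.mul_apply]
  refine Finset.sum_congr rfl fun a _ => ?_
  rw [Matrix.mul_diagonal]
  change W p a * d a * (starRingEnd ℂ) (W q a) = _
  ring

theorem sum_sq_norm_col {W : Matrix n n ℂ} (hW : Wᴴ * W = 1) (a : n) :
    ∑ p, ‖W p a‖ ^ 2 = 1 := by
  have h := congrFun (congrFun hW a) a
  rw [Matrix.mul_apply, Matrix.one_apply_eq] at h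
  have e : ∀ p, Wᴴ a p * W p a = ((‖W p a‖ ^ 2 : ℝ) : ℂ) := fun p => by
    rw [Matrix.conjTranspose_apply, Complex.ofReal_pow]
    exact Complex.conj_mul' _
  simp only [e] at h
  exact_mod_cast h

theorem norm_unitary_le {W : Matrix n n ℂ} (hW : Wᴴ * W = 1) (p a : n) : ‖W p a‖ ≤ 1 := by
  have h := Finset.single_le_sum (f := fun p => ‖W p a‖ ^ 2) (fun _ _ => by positivity)
    (Finset.mem_univ p)
  simp only [sum_sq_norm_col hW a] at h
  exact (sq_le_one_iff₀ (norm_nonneg _)).1 h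

/-- First-order expansion of the logarithm at a diagonal matrix: if `e^{-βh}` is within `δ` of the
diagonal matrix with entries `e^{-βε_p}`, then `h` is, up to `O(δ²)`, what the linearization of
`h ↦ e^{-βh}` predicts. With `W` an eigenvector matrix of `h` and `η` its eigenvalues, both sides
are sums over `a` of `W_{pa} W̄_{qa}` times a function of `η_a`, and `|W_{qa}| |η_a - ε_q| = O(δ)`. -/
theorem exists_norm_log_sub_le {β : ℝ} (hβ : 0 < β) (ε : n → ℝ) : ∃ C, 0 ≤ C ∧ ∃ δ₀ > 0,
    ∀ h : Matrix n n ℂ, h.IsHermitian → ∀ δ, 0 ≤ δ → δ ≤ δ₀ →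
    (∀ p q, ‖NormedSpace.exp (((-β : ℝ) : ℂ) • h) p q -
      (if p = q then ((Real.exp (-β * ε p) : ℝ) : ℂ) else 0)‖ ≤ δ) →
    ∀ p q, ‖(h p q - if p = q then (ε p : ℂ) else 0) * expMean β (ε p) (ε q) +
      (NormedSpace.exp (((-β : ℝ) : ℂ) • h) p q -
        if p = q then ((Real.exp (-β * ε p) : ℝ) : ℂ) else 0)‖ ≤ C * δ ^ 2 := by
  set N : ℝ := ((Fintype.card n : ℕ) : ℝ) with hN
  have hN0 : 0 ≤ N := Nat.cast_nonneg _
  set M₀ : ℝ := ∑ p, |ε p| with hM₀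
  have hε : ∀ p, |ε p| ≤ M₀ := fun p =>
    Finset.single_le_sum (f := fun p => |ε p|) (fun _ _ => abs_nonneg _) (Finset.mem_univ p)
  set m : ℝ := M₀ + 1 / β with hm
  have hmM : M₀ ≤ m := by have : 0 < 1 / β := by positivity
                          linarith
  set L : ℝ := N / (β * Real.exp (-β * m)) with hL
  have hL0 : 0 ≤ L := by positivity
  set K : ℝ := β * (β * Real.exp (β * m) * Real.exp (β * m)) with hK
  have hK0 : 0 ≤ K := by positivity
  refine ⟨N * (K * L ^ 2), by positivity, Real.exp (-β * M₀) / (4 * (N ^ 2 + 1)), by positivity,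
    fun h hh δ hδ0 hδ hR p q => ?_⟩
  obtain ⟨W, hW1, hW2, hW⟩ := hh.exists_unitary
  set η := hh.eigenvalues with hη
  have hρ : ∀ p q, NormedSpace.exp (((-β : ℝ) : ℂ) • h) p q = ∑ a, W p a *
      (starRingEnd ℂ) (W q a) * ((Real.exp (-β * η a) : ℝ) : ℂ) := fun p q => by
    rw [← unitary_diagonal_apply, ← exp_smul_diagonal, ← exp_smul_unitary_conj hW1, ← hW]
  have hrow : ∀ (f : n → ℂ) p q, (if p = q then f p else 0) =
      ∑ a, W p a * (starRingEnd ℂ) (W q a) * f q := fun f p q => by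
    have h1 := congrFun (congrFun hW1 p) q
    rw [Matrix.mul_apply, Matrix.one_apply] at h1
    rw [← Finset.sum_mul]
    change _ = (∑ a, W p a * Wᴴ a q) * f q
    rw [h1]
    split_ifs with e
    · rw [e, one_mul]
    · rw [zero_mul]
  have hcol : ∀ a b, ∑ p, (starRingEnd ℂ) (W p a) * W p b = if a = b then 1 else 0 := fun a b => by
    have h1 := congrFun (congrFun hW2 a) b
    rwa [Matrix.mul_apply, Matrix.one_apply] at h1
  have hRs : ∀ p q, NormedSpace.exp (((-β : ℝ) : ℂ) • h) p q -
      (if p = q then ((Real.exp (-β * ε p) : ℝ) : ℂ) else 0) = ∑ a, W p a *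
      (starRingEnd ℂ) (W q a) * ((Real.exp (-β * η a) - Real.exp (-β * ε q) : ℝ) : ℂ) :=
    fun p q => by
      rw [hρ, hrow (fun p => ((Real.exp (-β * ε p) : ℝ) : ℂ)), ← Finset.sum_sub_distrib]
      refine Finset.sum_congr rfl fun a _ => ?_
      push_cast
      ring
  -- The matrix elements of `e^{-βh} - e^{-βε}` between eigenvectors of the two matrices.
  have hmix : ∀ a q, ‖W q a‖ * |Real.exp (-β * η a) - Real.exp (-β * ε q)| ≤ N * δ := by
    intro a q
    have e : (starRingEnd ℂ) (W q a) * ((Real.exp (-β * η a) - Real.exp (-β * ε q) : ℝ) : ℂ) =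
        ∑ p, (starRingEnd ℂ) (W p a) * (NormedSpace.exp (((-β : ℝ) : ℂ) • h) p q -
      (if p = q then ((Real.exp (-β * ε p) : ℝ) : ℂ) else 0)) := by
      simp only [hRs, Finset.mul_sum]
      rw [Finset.sum_comm]
      simp only [← mul_assoc, ← Finset.sum_mul, hcol]
      simp
    rw [← Real.norm_eq_abs, ← Complex.norm_real, ← RCLike.norm_conj (W q a), ← norm_mul, e]
    refine (norm_sum_le _ _).trans ?_
    calc _ ≤ ∑ _p : n, δ := by
          refine Finset.sum_le_sum fun p _ => ?_
          rw [norm_mul, RCLike.norm_conj]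
          calc _ ≤ 1 * δ := mul_le_mul (norm_unitary_le hW2 p a) (hR p q) (norm_nonneg _)
                zero_le_one
            _ = δ := one_mul δ
      _ = N * δ := by simp [hN]
  -- An eigenvalue of `h` outside `[-m, m]` would keep `e^{-βη_a}` away from all `e^{-βε_q}`,
  -- whereas the column `a` of `W` has norm one.
  have hηm : ∀ a, |η a| ≤ m := by
    intro a
    by_contra hcon
    rw [not_le] at hcon
    have hlow : ∀ q, Real.exp (-β * M₀) / 2 ≤ |Real.exp (-β * η a) - Real.exp (-β * ε q)| := by
      intro q
      have h1 := abs_le.1 (hε q)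
      have h2 : Real.exp (-β * M₀) ≤ Real.exp (-β * ε q) := Real.exp_le_exp.2 (by nlinarith [h1.2])
      have h3 : (2 : ℝ) ≤ Real.exp 1 := by have := Real.add_one_le_exp (1 : ℝ); linarith
      have hβm : β * m = β * M₀ + 1 := by rw [hm]; field_simp
      rcases lt_abs.1 hcon with h | h
      · have h4 : Real.exp (-β * η a) * Real.exp 1 ≤ Real.exp (-β * ε q) := by
          rw [← Real.exp_add, Real.exp_le_exp]
          nlinarith [h1.2, mul_lt_mul_of_pos_left h hβ]
        rw [abs_sub_comm]
        refine le_trans ?_ (le_abs_self _)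
        nlinarith [Real.exp_pos (-β * η a)]
      · have h4 : Real.exp (-β * ε q) * Real.exp 1 ≤ Real.exp (-β * η a) := by
          rw [← Real.exp_add, Real.exp_le_exp]
          nlinarith [h1.1, mul_lt_mul_of_pos_left h hβ]
        refine le_trans ?_ (le_abs_self _)
        nlinarith [Real.exp_pos (-β * ε q), Real.exp_pos (-β * M₀)]
    have h1 : Real.exp (-β * M₀) / 2 ≤ N ^ 2 * δ := by
      calc Real.exp (-β * M₀) / 2 = ∑ q, ‖W q a‖ ^ 2 * (Real.exp (-β * M₀) / 2) := by
            rw [← Finset.sum_mul, sum_sq_norm_col hW2, one_mul]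
        _ ≤ ∑ _q : n, N * δ := by
            refine Finset.sum_le_sum fun q _ => ?_
            refine le_trans ?_ (hmix a q)
            have h0 : ‖W q a‖ ^ 2 ≤ ‖W q a‖ := by
              nlinarith [norm_unitary_le hW2 q a, norm_nonneg (W q a)]
            exact mul_le_mul h0 (hlow q) (by positivity) (norm_nonneg _)
        _ = N ^ 2 * δ := by simp [hN]; ring
    have h2 : N ^ 2 * δ ≤ (N ^ 2 + 1) * (Real.exp (-β * M₀) / (4 * (N ^ 2 + 1))) :=
      mul_le_mul (by linarith) hδ hδ0 (by positivity)
    have h3 : (N ^ 2 + 1) * (Real.exp (-β * M₀) / (4 * (N ^ 2 + 1))) = Real.exp (-β * M₀) / 4 := by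
      field_simp
    linarith [Real.exp_pos (-β * M₀)]
  -- On `[-m, m]`, differences of eigenvalues are controlled by differences of exponentials.
  have hdiff : ∀ a q, ‖W q a‖ * |η a - ε q| ≤ L * δ := by
    intro a q
    have h1 := hmix a q
    rw [abs_sub_comm, ← sub_mul_expMean, abs_mul, abs_of_pos (expMean_pos hβ _ _), ← mul_assoc] at h1
    have h2 := le_expMean hβ.le ((le_abs_self _).trans (hηm a))
      ((le_abs_self _).trans ((hε q).trans hmM))
    have h3 : ‖W q a‖ * |η a - ε q| * (β * Real.exp (-β * m)) ≤ N * δ :=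
      (mul_le_mul_of_nonneg_left h2 (by positivity)).trans h1
    rw [hL, div_mul_eq_mul_div, le_div_iff₀ (by positivity)]
    exact h3
  -- The deviation from the linearization is of second order in the differences of eigenvalues.
  have hsum : (h p q - if p = q then (ε p : ℂ) else 0) * expMean β (ε p) (ε q) +
      (NormedSpace.exp (((-β : ℝ) : ℂ) • h) p q -
        if p = q then ((Real.exp (-β * ε p) : ℝ) : ℂ) else 0) = ∑ a, W p a *
      (starRingEnd ℂ) (W q a) * (((η a - ε q) * (expMean β (ε p) (ε q) - expMean β (η a) (ε q)) :
        ℝ) : ℂ) := by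
    have hΔ : (h p q - if p = q then (ε p : ℂ) else 0) =
        ∑ a, W p a * (starRingEnd ℂ) (W q a) * ((η a - ε q : ℝ) : ℂ) := by
      rw [hrow (fun p => (ε p : ℂ))]
      conv_lhs => rw [hW]
      rw [unitary_diagonal_apply, ← Finset.sum_sub_distrib]
      refine Finset.sum_congr rfl fun a _ => ?_
      push_cast
      ring
    rw [hRs, hΔ, Finset.sum_mul, ← Finset.sum_add_distrib]
    refine Finset.sum_congr rfl fun a _ => ?_
    rw [mul_sub, sub_mul_expMean]
    push_cast
    ring
  rw [hsum]
  refine (norm_sum_le _ _).trans ?_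
  calc _ ≤ ∑ _a : n, K * L ^ 2 * δ ^ 2 := by
        refine Finset.sum_le_sum fun a _ => ?_
        rw [norm_mul, norm_mul, RCLike.norm_conj, Complex.norm_real, Real.norm_eq_abs, abs_mul]
        have h1 := abs_expMean_sub_le hβ.le ((hε p).trans hmM) (hηm a) ((hε q).trans hmM)
        rw [← hK, abs_sub_comm (ε p)] at h1
        calc _ ≤ ‖W p a‖ * ‖W q a‖ * (|η a - ε q| * (K * |η a - ε p|)) := by gcongr
          _ = K * ((‖W p a‖ * |η a - ε p|) * (‖W q a‖ * |η a - ε q|)) := by ring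
          _ ≤ K * ((L * δ) * (L * δ)) := by
              refine mul_le_mul_of_nonneg_left ?_ hK0
              exact mul_le_mul (hdiff a p) (hdiff a q) (by positivity) (by positivity)
          _ = _ := by ring
    _ = _ := by simp [hN]; ring

open scoped ComplexOrder in
theorem Matrix.PosDef.exists_log {G : Matrix n n ℂ} (hG : G.PosDef) {β : ℝ} (hβ : β ≠ 0) :
    ∃ h : Matrix n n ℂ, h.IsHermitian ∧ NormedSpace.exp (((-β : ℝ) : ℂ) • h) = G := by
  obtain ⟨W, hW1, hW2, hW⟩ := hG.isHermitian.exists_unitary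
  refine ⟨W * Matrix.diagonal (fun a => ((-Real.log (hG.isHermitian.eigenvalues a) / β : ℝ) : ℂ)) *
    Wᴴ, ?_, ?_⟩
  · refine Matrix.isHermitian_mul_mul_conjTranspose _ ?_
    rw [Matrix.isHermitian_diagonal_iff]
    intro a
    exact Complex.conj_ofReal _
  · rw [exp_smul_unitary_conj hW1, exp_smul_diagonal]
    conv_rhs => rw [hW]
    congr 3
    ext a
    have := hG.eigenvalues_pos a
    rw [neg_mul, neg_div, mul_neg, neg_neg, mul_div_cancel₀ _ hβ, Real.exp_log this]

end Matrix

/-! ### The jump operators in the eigenbasis -/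

namespace OpenSystem

variable {ι n : Type*} [Fintype n] [DecidableEq n] (S : OpenSystem ι n)

theorem proj_eq (e : ℝ) : S.proj e = S.eigenU *
    Matrix.diagonal (fun p => if S.energy p = e then (1 : ℂ) else 0) * S.eigenUᴴ := rfl

theorem conj_proj_mul_proj (a : ι) (e e' : ℝ) :
    S.eigenUᴴ * (S.proj e * S.A a * S.proj e') * S.eigenU =
      Matrix.diagonal (fun p => if S.energy p = e then (1 : ℂ) else 0) * S.eigenA a *
      Matrix.diagonal (fun p => if S.energy p = e' then (1 : ℂ) else 0) := by
  rw [proj_eq, proj_eq, eigenA]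
  calc _ = (S.eigenUᴴ * S.eigenU) *
      Matrix.diagonal (fun p => if S.energy p = e then (1 : ℂ) else 0) * (S.eigenUᴴ * S.A a *
      S.eigenU) * Matrix.diagonal (fun p => if S.energy p = e' then (1 : ℂ) else 0) *
      (S.eigenUᴴ * S.eigenU) := by simp only [Matrix.mul_assoc]
    _ = _ := by rw [conjTranspose_eigenU_mul, Matrix.one_mul, Matrix.mul_one]

theorem energy_mem (p : n) : S.energy p ∈ S.energies :=
  Finset.mem_image_of_mem _ (Finset.mem_univ p)

theorem sub_mem_bohr (p r : n) : S.energy p - S.energy r ∈ S.bohr :=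
  Finset.mem_image.2 ⟨(S.energy r, S.energy p), Finset.mem_product.2 ⟨S.energy_mem r,
    S.energy_mem p⟩, rfl⟩

theorem conj_jump_apply (a : ι) (ω : ℝ) (p q : n) :
    (S.eigenUᴴ * S.jump a ω * S.eigenU) p q =
      if S.energy q - S.energy p = ω then S.eigenA a p q else 0 := by
  rw [jump, Matrix.mul_sum, Matrix.sum_mul, Matrix.sum_apply]
  simp only [conj_proj_mul_proj, Matrix.diagonal_mul, Matrix.mul_diagonal]
  split_ifs with h
  · rw [Finset.sum_eq_single (S.energy p, S.energy q)]
    · simp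
    · rintro ⟨e, e'⟩ _ hne
      by_cases h1 : S.energy p = e
      · by_cases h2 : S.energy q = e'
        · exact absurd (by rw [h1, h2]) hne
        · simp [h2]
      · simp [h1]
    · intro hmem
      exact absurd (Finset.mem_filter.2 ⟨Finset.mem_product.2 ⟨S.energy_mem p, S.energy_mem q⟩, h⟩)
        hmem
  · refine Finset.sum_eq_zero ?_
    rintro ⟨e, e'⟩ hmem
    have h3 := (Finset.mem_filter.1 hmem).2
    by_cases h1 : S.energy p = e
    · by_cases h2 : S.energy q = e'
      · exact absurd (by rw [h1, h2]; exact h3) h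
      · simp [h2]
    · simp [h1]

theorem eigenA_conj (a : ι) (p q : n) : (starRingEnd ℂ) (S.eigenA a p q) = S.eigenA a q p := by
  have h : (S.eigenA a).IsHermitian :=
    Matrix.isHermitian_conjTranspose_mul_mul _ (S.A_hermitian a)
  exact h.apply q p

/-- Between eigenvectors of `H0`, only the jumps through a common intermediate level `r` contribute:
`A_a(ω)†` maps `v_r` to `v_p` with `ω = ε_p - ε_r`, and `A_b(ω')` maps `v_q` to `v_r` with `ω' = ε_q
- ε_r`. -/
theorem conj_ofCoefficients_apply [Fintype ι] (Υ : ι → ι → ℝ → ℝ → ℂ) (p q : n) :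
    (S.eigenUᴴ * S.ofCoefficients Υ * S.eigenU) p q = ∑ r, ∑ a, ∑ b,
      Υ a b (S.energy p - S.energy r) (S.energy q - S.energy r) *
        (S.eigenA a p r * S.eigenA b r q) := by
  have e : ∀ a b ω ω', (S.eigenUᴴ * ((S.jump a ω)ᴴ * S.jump b ω') * S.eigenU) p q =
      ∑ r, (if S.energy p - S.energy r = ω then S.eigenA a p r else 0) *
        (if S.energy q - S.energy r = ω' then S.eigenA b r q else 0) := by
    intro a b ω ω'
    have h1 : S.eigenUᴴ * ((S.jump a ω)ᴴ * S.jump b ω') * S.eigenU =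
        (S.eigenUᴴ * S.jump a ω * S.eigenU)ᴴ * (S.eigenUᴴ * S.jump b ω' * S.eigenU) := by
      rw [Matrix.conjTranspose_mul, Matrix.conjTranspose_mul, Matrix.conjTranspose_conjTranspose]
      calc _ = S.eigenUᴴ * ((S.jump a ω)ᴴ * (1 * (S.jump b ω' * S.eigenU))) := by
            rw [Matrix.one_mul]; simp only [Matrix.mul_assoc]
        _ = _ := by rw [← S.eigenU_mul_conjTranspose]; simp only [Matrix.mul_assoc]
    rw [h1, Matrix.mul_apply]
    refine Finset.sum_congr rfl fun r _ => ?_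
    rw [Matrix.conjTranspose_apply, conj_jump_apply, conj_jump_apply, apply_ite star, star_zero]
    congr 2
    exact S.eigenA_conj a r p
  simp only [ofCoefficients, Matrix.mul_sum, Matrix.sum_mul, Matrix.sum_apply, Matrix.mul_smul,
    Matrix.smul_mul, Matrix.smul_apply, e, smul_eq_mul]
  have e2 : ∀ ω ω', (∑ a, ∑ b, Υ a b ω ω' * ∑ r,
      (if S.energy p - S.energy r = ω then S.eigenA a p r else 0) *
        (if S.energy q - S.energy r = ω' then S.eigenA b r q else 0)) =
      ∑ r, if S.energy p - S.energy r = ω then (if S.energy q - S.energy r = ω' then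
        ∑ a, ∑ b, Υ a b ω ω' * (S.eigenA a p r * S.eigenA b r q) else 0) else 0 := by
    intro ω ω'
    simp only [Finset.mul_sum]
    rw [Finset.sum_congr rfl fun a _ => Finset.sum_comm, Finset.sum_comm]
    refine Finset.sum_congr rfl fun r _ => ?_
    split_ifs <;> simp
  simp only [e2]
  rw [Finset.sum_congr rfl fun ω _ => Finset.sum_comm, Finset.sum_comm]
  refine Finset.sum_congr rfl fun r _ => ?_
  rw [Finset.sum_eq_single (S.energy p - S.energy r)]
  · simp only [if_true]
    rw [Finset.sum_ite_eq, if_pos (S.sub_mem_bohr q r)]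
  · intro ω _ hω
    simp [hω.symm]
  · intro h
    exact absurd (S.sub_mem_bohr p r) h

end OpenSystem

/-! ### The mean-force Hamiltonian -/

section MeanForceHamiltonian

variable {ι n κ K : Type*} [Fintype n] [DecidableEq n]
  [NormedAddCommGroup K] [InnerProductSpace ℂ K] [CompleteSpace K]
  (S : OpenSystem ι n) {B : Bath ι κ K} {β : ℝ} [Fintype ι]

/-- `Z_R⁻¹ Tr_R[e^{-βH}]`, in the eigenbasis of `H0`. -/
noncomputable def reducedState (hB : B.IsThermal β) (hβ : 0 < β) (c : ℝ) : Matrix n n ℂ :=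
  Matrix.of fun p q => (B.Z β : ℂ)⁻¹ * partialTrace S hB hβ c p q

theorem reducedState_apply (hB : B.IsThermal β) (hβ : 0 < β) (c : ℝ) (p q : n) :
    reducedState S hB hβ c p q = (B.Z β : ℂ)⁻¹ * partialTrace S hB hβ c p q := rfl

/-- The partial trace in the standard basis of `ℂⁿ`, as it enters the definition of the mean-force
Hamiltonian. -/
theorem hasSum_inner_inc [Nonempty κ] (hB : B.IsThermal β) (hβ : 0 < β) (c : ℝ) (i j : n) :
    HasSum (fun k => ⟪inc i (B.e k), (freeHam S hB hβ).Q ((c : ℂ) • interaction S B) β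
      (inc j (B.e k))⟫_ℂ)
      ((B.Z β : ℂ) * (S.eigenU * reducedState S hB hβ c * S.eigenUᴴ) i j) := by
  have e : (B.Z β : ℂ) * (S.eigenU * reducedState S hB hβ c * S.eigenUᴴ) i j =
      ∑ q, ∑ p, S.eigenU i p * (starRingEnd ℂ) (S.eigenU j q) * partialTrace S hB hβ c p q := by
    have hZ : (B.Z β : ℂ) ≠ 0 := by exact_mod_cast hB.Z_pos.ne'
    rw [Matrix.mul_apply, Finset.mul_sum]
    refine Finset.sum_congr rfl fun q _ => ?_
    rw [Matrix.mul_apply, Finset.sum_mul, Finset.mul_sum]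
    refine Finset.sum_congr rfl fun p _ => ?_
    rw [reducedState_apply, Matrix.conjTranspose_apply]
    change _ * (_ * _ * (starRingEnd ℂ) (S.eigenU j q)) = _
    field_simp
  rw [e]
  have h := hasSum_sum (s := Finset.univ) fun q (_ : q ∈ Finset.univ) =>
    hasSum_sum (s := Finset.univ) fun p (_ : p ∈ Finset.univ) =>
      (hasSum_partialTrace S hB hβ c p q).1.mul_left
        (S.eigenU i p * (starRingEnd ℂ) (S.eigenU j q))
  refine h.congr_fun fun k => ?_
  rw [inc_e S B i, inc_e S B j, map_sum, inner_sum]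
  refine Finset.sum_congr rfl fun q _ => ?_
  rw [sum_inner]
  refine Finset.sum_congr rfl fun p _ => ?_
  rw [map_smul, inner_smul_left, inner_smul_right, RingHomCompTriple.comp_apply, RingHom.id_apply]
  ring

theorem isSelfAdjoint_smul_interaction (c : ℝ) : IsSelfAdjoint ((c : ℂ) • interaction S B) :=
  IsSelfAdjoint.smul (Complex.conj_ofReal c) (isSelfAdjoint_interaction S B)

/-- The mean-force Hamiltonian is `-β⁻¹` times a logarithm of the reduced state: the Boltzmann
semigroup exists and is unique. -/
theorem isMeanForce_iff [Nonempty κ] (hB : B.IsThermal β) (hβ : 0 < β) (c : ℝ)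
    (h : Matrix n n ℂ) : IsMeanForce S B β c h ↔ h.IsHermitian ∧
      NormedSpace.exp (((-β : ℝ) : ℂ) • h) = S.eigenU * reducedState S hB hβ c * S.eigenUᴴ := by
  have hZ : (B.Z β : ℂ) ≠ 0 := by exact_mod_cast hB.Z_pos.ne'
  refine and_congr_right fun hh => ⟨?_, fun he => ?_⟩
  · rintro ⟨P, hP, hs⟩
    have hQ := ((isBoltzmannSemigroup_iff S B hB hβ c P).1 hP).eq_Q hβ.le
    ext i j
    have h1 := hasSum_inner_inc S hB hβ c i j
    rw [← hQ] at h1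
    have h2 := (hs i j).unique (h1.congr_fun fun k => by
      rw [inner_inc_left, ← ofOp_apply, ofOp_toOp])
    exact mul_left_cancel₀ hZ h2
  · refine ⟨fun t => ofOp ((freeHam S hB hβ).Q ((c : ℂ) • interaction S B) t), ?_, fun i j => ?_⟩
    · rw [isBoltzmannSemigroup_iff S B hB hβ]
      simp only [toOp_ofOp]
      exact (freeHam S hB hβ).isSemigroup_Q _
    · rw [he]
      refine (hasSum_inner_inc S hB hβ c i j).congr_fun fun k => ?_
      rw [inner_inc_left, ofOp_apply]

theorem reducedState_isHermitian (hB : B.IsThermal β) (hβ : 0 < β) (c : ℝ) :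
    (reducedState S hB hβ c).IsHermitian := by
  refine Matrix.IsHermitian.ext fun p q => ?_
  rw [reducedState_apply, reducedState_apply]
  change (starRingEnd ℂ) _ = _
  rw [map_mul, map_inv₀, Complex.conj_ofReal, partialTrace, partialTrace, Complex.conj_tsum]
  congr 1
  refine tsum_congr fun k => ?_
  rw [inner_conj_symm, DiagHam.inner_Q_symm _ (isSelfAdjoint_smul_interaction S c) hβ.le]

open scoped ComplexOrder in
/-- The reduced state is a Gram matrix of vectors `e^{-βH/2} (v_p ⊗ e_k)`, and `e^{-βH/2}` is
injective. -/
theorem reducedState_posDef [Nonempty κ] (hB : B.IsThermal β) (hβ : 0 < β) (c : ℝ) :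
    (reducedState S hB hβ c).PosDef := by
  refine Matrix.PosDef.of_dotProduct_mulVec_pos (reducedState_isHermitian S hB hβ c) fun x hx => ?_
  have hV := isSelfAdjoint_smul_interaction S (B := B) c
  set H := freeHam S hB hβ with hH
  set V := (c : ℂ) • interaction S B with hVdef
  have h0 : (0 : ℝ) ≤ β / 2 := by positivity
  set y : κ → JointSpace n K := fun k => H.Q V (β / 2) (∑ p, x p • jointBasis S B (p, k)) with hy
  have hin : ∀ k, (‖y k‖ ^ 2 : ℂ) = ∑ p, ∑ q, star (x p) * x q * ⟪jointBasis S B (p, k),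
      H.Q V β (jointBasis S B (q, k))⟫_ℂ := fun k => by
    rw [← Complex.ofReal_pow]
    have := inner_self_eq_norm_sq_to_K (𝕜 := ℂ) (y k)
    rw [Complex.ofReal_pow]
    refine this.symm.trans ?_
    rw [hy, ← DiagHam.inner_Q_self H hV h0, add_halves, map_sum, sum_inner]
    refine Finset.sum_congr rfl fun p _ => ?_
    rw [inner_sum]
    refine Finset.sum_congr rfl fun q _ => ?_
    rw [map_smul, inner_smul_left, inner_smul_right, mul_assoc]
    rfl
  have hsum : HasSum (fun k => (‖y k‖ ^ 2 : ℂ)) (∑ p, ∑ q, star (x p) * x q *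
      partialTrace S hB hβ c p q) := by
    simp only [hin]
    exact hasSum_sum fun p _ => hasSum_sum fun q _ =>
      (hasSum_partialTrace S hB hβ c p q).1.mul_left _
  have hquad : star x ⬝ᵥ (reducedState S hB hβ c) *ᵥ x = (B.Z β : ℂ)⁻¹ *
      ∑ p, ∑ q, star (x p) * x q * partialTrace S hB hβ c p q := by
    simp only [dotProduct, Matrix.mulVec, Finset.mul_sum, reducedState_apply, Pi.star_apply]
    refine Finset.sum_congr rfl fun p _ => Finset.sum_congr rfl fun q _ => ?_
    ring
  have hre : HasSum (fun k => ‖y k‖ ^ 2) (∑ p, ∑ q, star (x p) * x q *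
      partialTrace S hB hβ c p q).re := by
    refine (Complex.hasSum_re hsum).congr_fun fun k => ?_
    rw [← Complex.ofReal_pow, Complex.ofReal_re]
  have hval : (∑ p, ∑ q, star (x p) * x q * partialTrace S hB hβ c p q) =
      ((∑ p, ∑ q, star (x p) * x q * partialTrace S hB hβ c p q).re : ℂ) := by
    refine hsum.unique ((Complex.hasSum_ofReal.2 hre).congr_fun fun k => ?_)
    rw [Complex.ofReal_pow]
  rw [hquad, hval, ← Complex.ofReal_inv, ← Complex.ofReal_mul, Complex.zero_lt_real]
  refine mul_pos (inv_pos.2 hB.Z_pos) ?_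
  obtain ⟨k⟩ := ‹Nonempty κ›
  have hyk : y k ≠ 0 := by
    intro h
    have h1 := DiagHam.Q_injective H hV h0 h
    obtain ⟨p, hp⟩ := Function.ne_iff.1 hx
    have h2 : ⟪jointBasis S B (p, k), ∑ q, x q • jointBasis S B (q, k)⟫_ℂ = x p := by
      classical
      simp only [inner_sum, inner_smul_right,
        orthonormal_iff_ite.1 (jointBasis S B).orthonormal, Prod.mk.injEq, and_true]
      simp
    rw [h1, inner_zero_right] at h2
    exact hp h2.symm
  exact (pow_pos (norm_pos_iff.2 hyk) 2).trans_le (le_hasSum hre k fun _ _ => by positivity)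

/-- A positive definite matrix has a Hermitian logarithm. -/
theorem exists_isMeanForce [Nonempty κ] (hB : B.IsThermal β) (hβ : 0 < β) (c : ℝ) :
    ∃ h, IsMeanForce S B β c h := by
  obtain ⟨h, hh, he⟩ := (reducedState_posDef S hB hβ c).exists_log hβ.ne'
  refine ⟨S.eigenU * h * S.eigenUᴴ, (isMeanForce_iff S hB hβ c _).2
    ⟨Matrix.isHermitian_mul_mul_conjTranspose _ hh, ?_⟩⟩
  rw [exp_smul_unitary_conj S.eigenU_mul_conjTranspose, he]

/-- The second-order mean-force correction, as the operator with coefficients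
`(2π)⁻¹ ∫ D(ω,ω',Ω) γ_{ab}(dΩ)`. -/
noncomputable def meanForceCorrection (B : Bath ι κ K) (β : ℝ) : Matrix n n ℂ :=
  S.ofCoefficients fun a b ω ω' => B.spectralSum β a b fun Ω => (kernelD β ω ω' Ω : ℂ)

theorem conj_meanForceCorrection_apply (B : Bath ι κ K) (p q : n) :
    (S.eigenUᴴ * meanForceCorrection S B β * S.eigenU) p q = correctionCoeff S B β p q :=
  S.conj_ofCoefficients_apply _ p q

/-- The mean-force Hamiltonian in the eigenbasis of `H0`, up to third order. -/
theorem exists_norm_meanForce_sub_le [Nonempty κ] (hB : B.IsThermal β) (hβ : 0 < β)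
    (hc : B.Centred β) : ∃ C, ∃ c₀ > 0, ∀ c : ℝ, |c| ≤ c₀ → ∀ h, h.IsHermitian →
      NormedSpace.exp (((-β : ℝ) : ℂ) • h) = reducedState S hB hβ c → ∀ p q,
      ‖h p q - (if p = q then (S.energy p : ℂ) else 0) - (c : ℂ) ^ 2 * correctionCoeff S B β p q‖ ≤
        C * |c| ^ 3 := by
  obtain ⟨C₁, hC₁, h₁⟩ := exists_norm_partialTrace_sub_le S hB hβ hc
  obtain ⟨C₂, hC₂, δ₀, hδ₀, h₂⟩ := exists_norm_log_sub_le hβ S.energy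
  have hZ := hB.Z_pos
  have hZ' : (B.Z β : ℂ) ≠ 0 := by exact_mod_cast hZ.ne'
  set R : ℝ → n → n → ℂ := fun c p q => reducedState S hB hβ c p q -
    (if p = q then ((Real.exp (-β * S.energy p) : ℝ) : ℂ) else 0) with hRdef
  -- `R c` is the deviation of the reduced state from the Gibbs state of `H0`, up to normalization.
  -- It is of second order, so that the error of the linearized logarithm is of fourth order.
  have hR1 : ∀ c : ℝ, |c| ≤ 1 → ∀ p q, ‖R c p q + (c : ℂ) ^ 2 *
      ((expMean β (S.energy p) (S.energy q) : ℂ) * correctionCoeff S B β p q)‖ ≤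
      C₁ / B.Z β * |c| ^ 3 := by
    intro c hc1 p q
    have e : R c p q + (c : ℂ) ^ 2 *
        ((expMean β (S.energy p) (S.energy q) : ℂ) * correctionCoeff S B β p q) =
        (B.Z β : ℂ)⁻¹ * (partialTrace S hB hβ c p q -
      ((if p = q then ((Real.exp (-β * S.energy p) * B.Z β : ℝ) : ℂ) else 0) -
      (c : ℂ) ^ 2 * (((B.Z β * expMean β (S.energy p) (S.energy q) : ℝ) : ℂ) *
        correctionCoeff S B β p q))) := by
      simp only [hRdef, reducedState_apply]
      split_ifs
      · push_cast
        field_simp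
        ring
      · push_cast
        field_simp
        ring
    rw [e, norm_mul, norm_inv, Complex.norm_real, Real.norm_of_nonneg hZ.le, div_eq_inv_mul,
      mul_assoc]
    exact mul_le_mul_of_nonneg_left (h₁ c hc1 p q) (inv_pos.2 hZ).le
  set M : ℝ := C₁ / B.Z β + ∑ p, ∑ q, ‖(expMean β (S.energy p) (S.energy q) : ℂ) *
    correctionCoeff S B β p q‖ with hM
  have hM0 : 0 ≤ M := by positivity
  have hR2 : ∀ c : ℝ, |c| ≤ 1 → ∀ p q, ‖R c p q‖ ≤ M * |c| ^ 2 := by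
    intro c hc1 p q
    set a := (expMean β (S.energy p) (S.energy q) : ℂ) * correctionCoeff S B β p q with ha
    have ha' : ‖a‖ ≤ ∑ p, ∑ q, ‖(expMean β (S.energy p) (S.energy q) : ℂ) *
        correctionCoeff S B β p q‖ :=
      (Finset.single_le_sum (f := fun q => ‖(expMean β (S.energy p) (S.energy q) : ℂ) *
        correctionCoeff S B β p q‖) (fun _ _ => norm_nonneg _) (Finset.mem_univ q)).trans
      (Finset.single_le_sum (f := fun p => ∑ q, ‖(expMean β (S.energy p) (S.energy q) : ℂ) *
        correctionCoeff S B β p q‖) (fun _ _ => Finset.sum_nonneg fun _ _ => norm_nonneg _)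
        (Finset.mem_univ p))
    have e : R c p q = (R c p q + (c : ℂ) ^ 2 * a) - (c : ℂ) ^ 2 * a := by ring
    rw [e]
    refine (norm_sub_le _ _).trans ?_
    rw [norm_mul, norm_pow, Complex.norm_real, Real.norm_eq_abs, hM, add_mul]
    refine add_le_add ((hR1 c hc1 p q).trans ?_) ?_
    · exact mul_le_mul_of_nonneg_left (pow_le_pow_of_le_one (abs_nonneg c) hc1 (by norm_num))
        (by positivity)
    · rw [mul_comm]
      exact mul_le_mul_of_nonneg_right ha' (by positivity)
  set m : ℝ := ∑ p, |S.energy p| with hm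
  have hEm : ∀ p, S.energy p ≤ m := fun p => (le_abs_self _).trans
    (Finset.single_le_sum (f := fun p => |S.energy p|) (fun _ _ => abs_nonneg _)
      (Finset.mem_univ p))
  refine ⟨(C₂ * M ^ 2 + C₁ / B.Z β) / (β * Real.exp (-β * m)), min 1 (δ₀ / (M + 1)),
    by positivity, fun c hcc h hh he p q => ?_⟩
  have hc1 : |c| ≤ 1 := hcc.trans (min_le_left _ _)
  have hδ : M * |c| ^ 2 ≤ δ₀ := by
    have h1 : |c| ≤ δ₀ / (M + 1) := hcc.trans (min_le_right _ _)
    rw [le_div_iff₀ (by positivity)] at h1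
    nlinarith [abs_nonneg c, mul_nonneg hM0 (abs_nonneg c)]
  have h3 := h₂ h hh (M * |c| ^ 2) (by positivity) hδ (fun p q => by
    rw [he]; exact hR2 c hc1 p q) p q
  rw [he] at h3
  have h4 := hR1 c hc1 p q
  set w := expMean β (S.energy p) (S.energy q) with hw
  have hwpos : 0 < w := expMean_pos hβ _ _
  set X := correctionCoeff S B β p q
  set Δ := h p q - (if p = q then (S.energy p : ℂ) else 0) with hΔ
  have h5 : ‖(Δ - (c : ℂ) ^ 2 * X) * w‖ ≤ (C₂ * M ^ 2 + C₁ / B.Z β) * |c| ^ 3 := by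
    have e : (Δ - (c : ℂ) ^ 2 * X) * w = (Δ * w + R c p q) - (R c p q + (c : ℂ) ^ 2 * (w * X)) := by
      ring
    rw [e]
    refine (norm_sub_le _ _).trans ?_
    rw [add_mul]
    refine add_le_add (h3.trans ?_) h4
    rw [mul_pow, ← mul_assoc, ← pow_mul]
    exact mul_le_mul_of_nonneg_left (pow_le_pow_of_le_one (abs_nonneg c) hc1 (by norm_num))
      (by positivity)
  rw [norm_mul, Complex.norm_real, Real.norm_of_nonneg hwpos.le] at h5
  rw [div_mul_eq_mul_div, le_div_iff₀ (by positivity)]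
  exact (mul_le_mul_of_nonneg_left (le_expMean hβ.le (hEm p) (hEm q)) (norm_nonneg _)).trans h5

/-- Change of basis back to the standard basis of `ℂⁿ`. -/
theorem isLittleO_meanForce [Nonempty κ] (hB : B.IsThermal β) (hβ : 0 < β) (hc : B.Centred β)
    {Hmf : ℝ → Matrix n n ℂ} (h : ∀ c, IsMeanForce S B β c (Hmf c)) (i j : n) :
    (fun c : ℝ => Hmf c i j - S.H0 i j - (c : ℂ) ^ 2 * meanForceCorrection S B β i j)
      =o[𝓝 0] fun c : ℝ => c ^ 2 := by
  obtain ⟨C, c₀, hc₀, hC⟩ := exists_norm_meanForce_sub_le S hB hβ hc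
  set Y : ℝ → Matrix n n ℂ := fun c => S.eigenUᴴ * (Hmf c - S.H0 - (c : ℂ) ^ 2 •
    meanForceCorrection S B β) * S.eigenU with hY
  have hb : ∀ c : ℝ, |c| ≤ c₀ → ∀ p q, ‖Y c p q‖ ≤ C * |c| ^ 3 := by
    intro c hcc p q
    have hH := (isMeanForce_iff S hB hβ c _).1 (h c)
    have hh : (S.eigenUᴴ * Hmf c * S.eigenU).IsHermitian :=
      Matrix.isHermitian_conjTranspose_mul_mul _ hH.1
    have he : NormedSpace.exp (((-β : ℝ) : ℂ) • (S.eigenUᴴ * Hmf c * S.eigenU)) =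
        reducedState S hB hβ c := by
      have h1 := exp_smul_unitary_conj (W := S.eigenUᴴ)
        (by rw [Matrix.conjTranspose_conjTranspose]; exact S.conjTranspose_eigenU_mul)
        ((-β : ℝ) : ℂ) (Hmf c)
      rw [Matrix.conjTranspose_conjTranspose, hH.2] at h1
      rw [h1]
      calc _ = (S.eigenUᴴ * S.eigenU) * reducedState S hB hβ c * (S.eigenUᴴ * S.eigenU) := by
            simp only [Matrix.mul_assoc]
        _ = _ := by rw [S.conjTranspose_eigenU_mul, Matrix.one_mul, Matrix.mul_one]
    have h2 := hC c hcc _ hh he p q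
    refine le_trans (le_of_eq ?_) h2
    congr 1
    have h3 : S.eigenUᴴ * S.H0 * S.eigenU = Matrix.diagonal fun p => (S.energy p : ℂ) := by
      rw [Matrix.mul_assoc, S.H0_mul_eigenU, ← Matrix.mul_assoc, S.conjTranspose_eigenU_mul,
        Matrix.one_mul]
    rw [hY]
    simp only [Matrix.mul_sub, Matrix.sub_mul, Matrix.mul_smul, Matrix.smul_mul, h3,
      Matrix.sub_apply, Matrix.smul_apply, conj_meanForceCorrection_apply, smul_eq_mul,
      Matrix.diagonal_apply]
  have hO : ∀ p q, (fun c : ℝ => Y c p q) =o[𝓝 0] fun c : ℝ => c ^ 2 := by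
    intro p q
    have h1 : (fun c : ℝ => Y c p q) =O[𝓝 0] fun c : ℝ => c ^ 3 := by
      refine Asymptotics.IsBigO.of_bound C ?_
      filter_upwards [Metric.closedBall_mem_nhds (0 : ℝ) hc₀] with c hcc
      rw [norm_pow, Real.norm_eq_abs]
      exact hb c (by simpa using hcc) p q
    exact h1.trans_isLittleO (Asymptotics.isLittleO_pow_pow (by norm_num))
  have e : ∀ c : ℝ, Hmf c i j - S.H0 i j - (c : ℂ) ^ 2 * meanForceCorrection S B β i j =
      ∑ q, ∑ p, S.eigenU i p * (starRingEnd ℂ) (S.eigenU j q) * Y c p q := by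
    intro c
    have h1 : Hmf c - S.H0 - (c : ℂ) ^ 2 • meanForceCorrection S B β =
        S.eigenU * Y c * S.eigenUᴴ := by
      rw [hY]
      symm
      calc _ = (S.eigenU * S.eigenUᴴ) * (Hmf c - S.H0 - (c : ℂ) ^ 2 • meanForceCorrection S B β) *
            (S.eigenU * S.eigenUᴴ) := by simp only [Matrix.mul_assoc]
        _ = _ := by rw [S.eigenU_mul_conjTranspose, Matrix.one_mul, Matrix.mul_one]
    have h2 := congrFun (congrFun h1 i) j
    simp only [Matrix.sub_apply, Matrix.smul_apply, smul_eq_mul] at h2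
    rw [h2, Matrix.mul_apply]
    refine Finset.sum_congr rfl fun q _ => ?_
    rw [Matrix.mul_apply, Finset.sum_mul]
    refine Finset.sum_congr rfl fun p _ => ?_
    rw [Matrix.conjTranspose_apply]
    change _ * _ * (starRingEnd ℂ) (S.eigenU j q) = _
    ring
  simp only [e]
  exact Asymptotics.IsLittleO.fun_sum fun q _ => Asymptotics.IsLittleO.fun_sum fun p _ =>
    (hO p q).const_mul_left _

/-- The second-order mean-force correction exists, and it is unique. -/
theorem isMeanForceCorrection_iff [Nonempty κ] (hB : B.IsThermal β) (hβ : 0 < β)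
    (hc : B.Centred β) (X : Matrix n n ℂ) :
    IsMeanForceCorrection S B β X ↔ X = meanForceCorrection S B β := by
  constructor
  · rintro ⟨Hmf, h, hX⟩
    ext i j
    have h1 := (isLittleO_meanForce S hB hβ hc h i j).sub (hX i j)
    have h2 : (fun c : ℝ => (c : ℂ) ^ 2 * (X i j - meanForceCorrection S B β i j))
        =o[𝓝 0] fun c : ℝ => c ^ 2 := by
      refine h1.congr_left fun c => ?_
      ring
    rw [← sub_eq_zero, ← norm_le_zero_iff]
    refine le_of_forall_pos_le_add fun r hr => ?_
    obtain ⟨c, hc1, hc2⟩ := (((Asymptotics.isLittleO_iff.1 h2 hr).filter_mono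
      nhdsWithin_le_nhds).and (self_mem_nhdsWithin (s := ({0}ᶜ : Set ℝ)))).exists
    rw [norm_mul, norm_pow, norm_pow, Complex.norm_real, mul_comm r] at hc1
    rw [zero_add]
    exact le_of_mul_le_mul_left hc1 (pow_pos (norm_pos_iff.2 hc2) 2)
  · rintro rfl
    choose Hmf h using exists_isMeanForce S hB hβ
    exact ⟨Hmf, h, isLittleO_meanForce S hB hβ hc h⟩

end MeanForceHamiltonian

/-! ### Gibbs baths and their limits -/

theorem theorem1 {ι n : Type*} [Fintype ι] [Fintype n] [DecidableEq n]
    (S : OpenSystem ι n) (β : ℝ) (hβ : 0 < β) :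
    -- the kernel is given by the explicit formula, and it has no poles
    ((∀ ω ω' Ω : ℝ, ω ≠ ω' → Ω ≠ ω → Ω ≠ ω' →
        kernelD β ω ω' Ω = 1 / (ω' - Ω) - ((ω - ω') * (Real.exp (β * (ω - Ω)) - 1)) /
          ((ω - Ω) * (ω' - Ω) * (Real.exp (β * (ω - ω')) - 1))) ∧
      Continuous (fun p : ℝ × ℝ × ℝ => kernelD β p.1 p.2.1 p.2.2)) ∧
    -- every bath with a Gibbs state
    (∀ {κ K : Type*} [Nonempty κ] [NormedAddCommGroup K] [InnerProductSpace ℂ K] [CompleteSpace K]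
        (B : Bath ι κ K), B.IsThermal β → B.Centred β →
      (∀ a b (t : ℝ), HasSum
        (B.spectralTerm β a b (fun Ω => Complex.exp (-(Complex.I * Ω * t)))) (B.corr β a b t)) ∧
      (∀ a b ω ω', Summable (B.spectralTerm β a b (fun Ω => (kernelD β ω ω' Ω : ℂ)))) ∧
      (∀ X : Matrix n n ℂ, IsMeanForceCorrection S B β X ↔
        X = S.ofCoefficients
          (fun a b ω ω' => B.spectralSum β a b (fun Ω => (kernelD β ω ω' Ω : ℂ)))) ∧
      (∀ a b (ω ω' : ℝ) (s₁ s₂ s₃ s₄ : ℂ), ω ≠ ω' →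
        B.NoAtom β a b ω → B.NoAtom β a b ω' →
        B.HasLambShift β a b ω' s₁ → B.HasLambShift β a b ω s₂ →
        B.HasLambShift β b a (-ω') s₃ → B.HasLambShift β b a (-ω) s₄ →
        B.spectralSum β a b (fun Ω => (kernelD β ω ω' Ω : ℂ)) =
          lambCombination β ω ω' s₁ s₂ s₃ s₄)) ∧
    -- every reservoir that is a limit of such baths and has integrable autocorrelation functions
    (∀ {κ K : ℕ → Type*} [∀ N, Nonempty (κ N)] [∀ N, NormedAddCommGroup (K N)]
        [∀ N, InnerProductSpace ℂ (K N)] [∀ N, CompleteSpace (K N)]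
        (B : ∀ N, Bath ι (κ N) (K N)) (C : ι → ι → ℝ → ℂ),
      (∀ N, (B N).IsThermal β) → (∀ N, (B N).Centred β) →
      (∀ a b t, Tendsto (fun N => (B N).corr β a b t) atTop (𝓝 (C a b t))) →
      (∀ a b, Continuous (C a b)) → (∀ a b, Integrable (C a b)) →
      (∀ a b ω ω', Integrable (fun Ω : ℝ => (kernelD β ω ω' Ω : ℂ) * specDensity C a b Ω)) ∧
      (∀ X : ℕ → Matrix n n ℂ, (∀ N, IsMeanForceCorrection S (B N) β (X N)) →
        Tendsto X atTop (𝓝 (S.ofCoefficients (mfCoefficient C β)))) ∧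
      (∀ a b ω ω', ω ≠ ω' → mfCoefficient C β a b ω ω' =
        lambCombination β ω ω' (lambShift C a b ω') (lambShift C a b ω)
          (lambShift C b a (-ω')) (lambShift C b a (-ω))) ∧
      (∀ a b ω, Tendsto (fun ω' => lambCombination β ω ω' (lambShift C a b ω') (lambShift C a b ω)
          (lambShift C b a (-ω')) (lambShift C b a (-ω))) (𝓝[≠] ω)
        (𝓝 (mfCoefficient C β a b ω ω))) ∧
      (∀ a b (ω : ℝ), Tendsto (fun r : ℝ => 1 / (2 * (Real.pi : ℂ)) *
          ∫ Ω in {Ω : ℝ | r < |Ω - ω|}, specDensity C a b Ω / ((ω : ℂ) - Ω))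
        (𝓝[>] 0) (𝓝 (lambShift C a b ω)))) := by
  refine ⟨⟨fun ω ω' Ω h h1 h2 => kernelD_eq_formula hβ h h1 h2, continuous_kernelD hβ⟩, ?_, ?_⟩
  · intro κ K _ _ _ _ B hB hc
    exact ⟨hB.hasSum_corr, hB.summable_kernelD hβ, isMeanForceCorrection_iff S hB hβ hc,
      fun a b ω ω' s₁ s₂ s₃ s₄ h hω hω' h₁ h₂ h₃ h₄ =>
        hB.spectralSum_kernelD hβ h hω hω' h₁ h₂ h₃ h₄⟩
  · intro κ K _ _ _ _ B C hB hc hlim hcont hint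
    have h : IsGibbsLimit β B C := ⟨hB, hlim, hcont, hint⟩
    refine ⟨h.integrable_kernelD_mul hβ, fun X hX => ?_, fun a b ω ω' hne =>
      h.mfCoefficient_eq hβ a b hne, h.tendsto_lambCombination hβ, h.tendsto_principalValue⟩
    have e : X = fun N => meanForceCorrection S (B N) β := funext fun N =>
      (isMeanForceCorrection_iff S (hB N) hβ (hc N) _).1 (hX N)
    rw [e]
    simp only [meanForceCorrection, OpenSystem.ofCoefficients]
    exact tendsto_finsetSum _ fun ω _ => tendsto_finsetSum _ fun ω' _ =>
      tendsto_finsetSum _ fun a _ => tendsto_finsetSum _ fun b _ =>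
        (h.tendsto_spectralSum_kernelD hβ a b ω ω').smul_const _
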